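/- \textbf{Model.} Let $m_c,m_b,m_u,\mathcal I_b,\mathcal I_u,L,d_G,g,U_{max}>0$, $M=\frac{m_bd_G}{L}+m_u$, $\mathcal I_0=\frac{m_bd_G^2+\mathcal I_b}{L}+m_uL$, and consider $$m_c\ddot x=u_3,\qquad M(-\sin\alpha\,\ddot x+\cos\alpha\, g)+\mathcal I_0\ddot\alpha=u_1\sin(\beta-\alpha),\qquad \mathcal I_u\ddot\beta=u_2 .$$ With $\sigma_\lambda(x)=\mathrm{sign}(x)\min(|x|,\lambda)$ and parameters $k_{p,x},k_{d,x},\lambda_1,\lambda_2,k_{p,\alpha},k_{d,\alpha},\epsilon>0$, the inputs are, without actuator saturation, $$u_3=-\sigma_{\lambda_1}\bigl(k_{d,x}\dot x+\sigma_{\lambda_2}(k_{p,x}(x-\bar x))\bigr),\qquad f_t=-k_{p,\alpha}(\alpha-\bar\alpha)-k_{d,\alpha}\dot\alpha+Mg\cos\alpha,$$ $$\bar\theta=\sigma_{\pi/2}(\gamma\arctan(\epsilon f_t)),\quad \gamma=\frac{\pi}{2\arctan(\epsilon U_{max})},\qquad u_1=\frac{f_t}{\sin\bar\theta}\ \ \Bigl(u_1=\tfrac1{\gamma\epsilon}\text{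 if }f_t=0\Bigr),$$ $$u_2=-k_{p,\beta}(\beta-\bar\beta)-k_{d,\beta}\dot\beta,\qquad \bar\beta=\alpha+\bar\theta .$$ Put $\alpha_{min}=0,\ \alpha_{max}=\pi$ if $U_{max}\ge Mg$, and $\alpha_{min}=\arccos\frac{U_{max}}{Mg}$, $\alpha_{max}=\arccos\frac{-U_{max}}{Mg}$ otherwise. Let $\theta=\beta-\alpha$. \textbf{Gains.} An asymptotic gain from a signal $u$ to a signal $y$ is the least $\gamma\in[0,\infty]$ with $\limsup_{t\to\infty}|y|\le\gamma\limsup_{t\to\infty}|u|$ for all admissible inputs and all solutions. $\gamma_{in}$ is the asymptotic gain from $w$ to $\tilde\beta$ of the inner loop $\dot{\tilde\beta}=\dot\beta-w$, $\mathcal I_u\ddot\beta=-k_{p,\beta}\tilde\beta-k_{d,\beta}\dot\beta$ (the input $w$ stands for $\dot{\bar\beta}$). For $\tilde\theta_{max}\in(0,\pi/2)$, $\gamma_{out}=\gamma_{out}(\tilde\theta_{max})$ is the asymptotic gain from $\tilde\beta$ to $\dot{\bar\beta}$ of the outer loop $\mathcal I_0\ddot\alpha=u_1\sin(\bar\theta+\tilde\beta)-Mg\cos\alpha$,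 over continuous inputs with $|\tilde\beta|\le\tilde\theta_{max}$. \textbf{Proposition.} Let $\bar x\in\mathbb R$, $\bar\alpha\in[\alpha_{min},\alpha_{max}]$, and let $\bar\beta_\infty$ be the resulting steady-state attitude, that is the value of $\bar\beta$ at $\alpha=\bar\alpha$, $\dot\alpha=0$. The gain $\gamma_{out}$ is finite for all sufficiently small $\tilde\theta_{max}>0$. For every $\tilde\theta_{max}\in(0,\pi/2)$ and for suitably large $k_{p,\beta},k_{d,\beta}$ (there is $K>0$, independent of the initial condition, such that $k_{d,\beta}\ge K$ and $k_{p,\beta}\ge K k_{d,\beta}$ suffice): $\gamma_{in}$ is finite, $\gamma_{in}\gamma_{out}<1$ if $\gamma_{out}$ is finite, the equilibrium $(x,\dot x,\alpha,\dot\alpha,\beta,\dot\beta)=(\bar x,0,\bar\alpha,0,\bar\beta_\infty,0)$ of the closed loop is asymptotically stable, and every closed-loop solution on $[0,\infty)$ whose initial condition satisfies $$\sqrt{\theta^2(0)+\dot\theta^2(0)}+\gamma_{in}\sqrt{\alpha^2(0)+\dot\alpha^2(0)}<(1-\gamma_{in}\gamma_{out})\,\tilde\theta_{max}$$ (a condition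 that fails by convention if $\gamma_{out}=\infty$) converges to this equilibrium. -/

import Mathlib

open Filter Topology Set
open scoped ENNReal

namespace UavUgv

noncomputable section

/-! ### Stability of an autonomous differential equation -/

/-- `X` solves `X' = F X` on `[0, ∞)` (one-sided derivative at `0`). -/
def IsSolution {E : Type*} [NormedAddCommGroup E] [NormedSpace ℝ E]
    (F : E → E) (X : ℝ → E) : Prop :=
  ∀ t : ℝ, 0 ≤ t → HasDerivWithinAt X (F (X t)) (Ici 0) t

/-- The point `e` is an equilibrium of `X' = F X`, stable in the sense of Lyapunov and locally
attractive. -/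
def AsymptoticallyStable {E : Type*} [NormedAddCommGroup E] [NormedSpace ℝ E]
    (F : E → E) (e : E) : Prop :=
  F e = 0 ∧
  (∀ r : ℝ, 0 < r → ∃ δ : ℝ, 0 < δ ∧ ∀ X : ℝ → E, IsSolution F X → ‖X 0 - e‖ < δ →
    ∀ t : ℝ, 0 ≤ t → ‖X t - e‖ < r) ∧
  (∃ δ : ℝ, 0 < δ ∧ ∀ X : ℝ → E, IsSolution F X → ‖X 0 - e‖ < δ →
    Tendsto X atTop (𝓝 e))

/-- `γ` is an asymptotic gain from the signal `u` to the signal `y`: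
`limsup |y(t)| ≤ γ limsup |u(t)|` as `t → ∞`, in `[0, ∞]`. -/
def AsymptoticGainBound (γ : ℝ≥0∞) (u y : ℝ → ℝ) : Prop :=
  limsup (fun t => ‖y t‖ₑ) atTop ≤ γ * limsup (fun t => ‖u t‖ₑ) atTop

/-! ### Model and control parameters -/

/-- Physical parameters of the cart, the object and the aerial vehicle. -/
structure Plant where
  /-- mass of the ground vehicle -/
  mc : ℝ
  /-- mass of the object -/
  mb : ℝ
  /-- mass of the aerial vehicle -/
  mu : ℝ
  /-- moment of inertia of the object -/
  Ib : ℝ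
  /-- moment of inertia of the aerial vehicle -/
  Iu : ℝ
  /-- length of the object -/
  L : ℝ
  /-- distance from the ground vehicle to the center of mass of the object -/
  dG : ℝ
  /-- gravity acceleration -/
  g : ℝ
  /-- maximal thrust -/
  Umax : ℝ
  mc_pos : 0 < mc
  mb_pos : 0 < mb
  mu_pos : 0 < mu
  Ib_pos : 0 < Ib
  Iu_pos : 0 < Iu
  L_pos : 0 < L
  dG_pos : 0 < dG
  g_pos : 0 < g
  Umax_pos : 0 < Umax

/-- Control parameters of the ground vehicle loop and of the inclination loop (all parameters
except the two attitude gains). -/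
structure Tuning where
  kpx : ℝ
  kdx : ℝ
  lam1 : ℝ
  lam2 : ℝ
  /-- proportional gain of the inclination loop -/
  kpa : ℝ
  /-- derivative gain of the inclination loop -/
  kda : ℝ
  /-- shape parameter of the attitude mapping -/
  eps : ℝ
  kpx_pos : 0 < kpx
  kdx_pos : 0 < kdx
  lam1_pos : 0 < lam1
  lam2_pos : 0 < lam2
  kpa_pos : 0 < kpa
  kda_pos : 0 < kda
  eps_pos : 0 < eps

/-- Apparent mass `M = m_b d_G / L + m_u`. -/
def Plant.M (P : Plant) : ℝ := P.mb * P.dG / P.L + P.mu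

/-- Moment of inertia divided by the length, `I₀ = (m_b d_G² + I_b) / L + m_u L`. -/
def Plant.I0 (P : Plant) : ℝ := (P.mb * P.dG ^ 2 + P.Ib) / P.L + P.mu * P.L

/-- Smallest attainable inclination of equilibrium. -/
def Plant.alphaMin (P : Plant) : ℝ :=
  if P.M * P.g ≤ P.Umax then 0 else Real.arccos (P.Umax / (P.M * P.g))

/-- Largest attainable inclination of equilibrium. -/
def Plant.alphaMax (P : Plant) : ℝ :=
  if P.M * P.g ≤ P.Umax then Real.pi else Real.arccos (-P.Umax / (P.M * P.g))

/-! ### Control laws -/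

/-- The saturation `σ_l(x) = sign(x) min(|x|, l)`. -/
def sat (l x : ℝ) : ℝ := Real.sign x * min |x| l

/-- Nested saturated PD force of the ground vehicle. -/
def u3 (C : Tuning) (xbar x vx : ℝ) : ℝ :=
  -sat C.lam1 (C.kdx * vx + sat C.lam2 (C.kpx * (x - xbar)))

/-- Reference for the tangential force: PD with gravity compensation. -/
def ft (P : Plant) (C : Tuning) (abar a va : ℝ) : ℝ :=
  -C.kpa * (a - abar) - C.kda * va + P.M * P.g * Real.cos a

/-- The parameter `γ = π / (2 arctan (ε U_max))` of the attitude mapping. -/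
def gam (P : Plant) (C : Tuning) : ℝ := Real.pi / (2 * Real.arctan (C.eps * P.Umax))

/-- Desired relative attitude as a function of the tangential force. -/
def thetaBar (P : Plant) (C : Tuning) (f : ℝ) : ℝ :=
  sat (Real.pi / 2) (gam P C * Real.arctan (C.eps * f))

/-- Thrust `u₁ = f / sin θ̄(f)`, extended to `f = 0` by its limit `1 / (γ ε)`. -/
def u1 (P : Plant) (C : Tuning) (f : ℝ) : ℝ :=
  if f = 0 then 1 / (gam P C * C.eps) else f / Real.sin (thetaBar P C f)

/-- Desired attitude `β̄ = α + θ̄` of the aerial vehicle in the object state `(a, va)`. -/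
def betaBar (P : Plant) (C : Tuning) (abar a va : ℝ) : ℝ :=
  a + thetaBar P C (ft P C abar a va)

/-- PD torque on the attitude; `e` is the attitude error and `vb` the attitude rate. -/
def u2 (kp kd e vb : ℝ) : ℝ := -kp * e - kd * vb

/-! ### Closed loop -/

/-- Object acceleration obtained from
`M (-sin α x'' + g cos α) + I₀ α'' = u₁ sin (β - α)`,
with the object in the state `(a, va)`, relative attitude `th = β - α` and cart acceleration
`ax`. -/
def objAcc (P : Plant) (C : Tuning) (abar a va th ax : ℝ) : ℝ :=
  (u1 P C (ft P C abar a va) * Real.sin th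
    - P.M * (-Real.sin a * ax + Real.cos a * P.g)) / P.I0

/-- Closed-loop vector field on the states `(x, x', α, α', β, β')`, with attitude gains `kp`,
`kd` and without actuator saturation. -/
def closedLoop (P : Plant) (C : Tuning) (kp kd xbar abar : ℝ) (s : Fin 6 → ℝ) : Fin 6 → ℝ :=
  ![s 1,
    u3 C xbar (s 0) (s 1) / P.mc,
    s 3,
    objAcc P C abar (s 2) (s 3) (s 4 - s 2) (u3 C xbar (s 0) (s 1) / P.mc),
    s 5,
    u2 kp kd (s 4 - betaBar P C abar (s 2) (s 3)) (s 5) / P.Iu]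

/-- The equilibrium `(x̄, ᾱ, β̄)` at rest, `β̄` being the steady-state attitude for `ᾱ`. -/
def equilibrium (P : Plant) (C : Tuning) (xbar abar : ℝ) : Fin 6 → ℝ :=
  ![xbar, 0, abar, 0, betaBar P C abar abar 0, 0]

/-! ### Gains of the two loops -/

/-- Asymptotic gain `γ_in` of the attitude loop `e' = v - w`, `I_u v' = u₂(e, v)` from the
input `w` (the rate of the desired attitude) to the attitude error `e`. -/
def gammaIn (P : Plant) (kp kd : ℝ) : ℝ≥0∞ :=
  sInf {γ : ℝ≥0∞ | ∀ w e v : ℝ → ℝ, ContinuousOn w (Ici 0) →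
    (∀ t : ℝ, 0 ≤ t → HasDerivWithinAt e (v t - w t) (Ici 0) t) →
    (∀ t : ℝ, 0 ≤ t → HasDerivWithinAt v (u2 kp kd (e t) (v t) / P.Iu) (Ici 0) t) →
    AsymptoticGainBound γ w e}

/-- Asymptotic gain `γ_out` of the inclination loop from the attitude error `e`, restricted to
`|e| ≤ θmax`, to the rate of the desired attitude, for a cart at rest or in uniform motion. The
relative attitude is `θ̄ + e`. The desired attitude is differentiable except at isolated times at
which the saturation in `θ̄` becomes active or inactive; there `deriv` is `0`, which leaves the
upper limit unchanged. -/
def gammaOut (P : Plant) (C : Tuning) (abar θmax : ℝ) : ℝ≥0∞ :=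
  sInf {γ : ℝ≥0∞ | ∀ e a va : ℝ → ℝ, ContinuousOn e (Ici 0) →
    (∀ t : ℝ, 0 ≤ t → |e t| ≤ θmax) →
    (∀ t : ℝ, 0 ≤ t → HasDerivWithinAt a (va t) (Ici 0) t) →
    (∀ t : ℝ, 0 ≤ t → HasDerivWithinAt va
      (objAcc P C abar (a t) (va t) (thetaBar P C (ft P C abar (a t) (va t)) + e t) 0)
      (Ici 0) t) →
    AsymptoticGainBound γ e (deriv (fun t => betaBar P C abar (a t) (va t)))}

/-- The small-gain condition
`√(θ² + θ'²) + γ_in √(α² + α'²) < (1 - γ_in γ_out) θmax` on a state, `θ = β - α` being the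
relative attitude. The product of gains is on the left, so that the condition fails when a gain
is infinite. -/
def SmallGainCondition (γin γout : ℝ≥0∞) (θmax : ℝ) (s : Fin 6 → ℝ) : Prop :=
  ENNReal.ofReal √((s 4 - s 2) ^ 2 + (s 5 - s 3) ^ 2)
    + γin * ENNReal.ofReal √((s 2) ^ 2 + (s 3) ^ 2)
    + γin * γout * ENNReal.ofReal θmax < ENNReal.ofReal θmax

end

end UavUgv

namespace UavUgv

/-! ### Saturations and one-sided derivatives -/

/-! The cart is autonomous, and a strict Lyapunov function (`cartLyap`) shows that it converges. The
rest of the system therefore sees a cart acceleration that is bounded by λ₁/m_c and tends to zero.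

Write a = k_d/I_u and b = k_p/I_u for the attitude gains, ρ = a/b, m = min(a, b/a) and y = α'. The
torque damps the absolute attitude rate, so at constant y the attitude error settles at -ρy. In the
coordinates z = β - β̄ + ρy and q = β' - α' the attitude loop is a damped oscillator forced only by
α'' and by the rate of the relative reference θ̄ (`AttitudeMotion`). The quadratic function `quad`
gives it a decay rate of order m and the bound γ_in ≤ 16/m (`gammaIn_le`), while a constant and a
resonant input give γ_in ≥ 1/m (`le_gammaIn`). Large gains mean large m, whence γ_in γ_out < 1.

While the attitude error is at most some θ₀, the inclination loop is a perturbed damped oscillator,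
input-to-state stable with linear gain (`exists_inclLyap_decay`). This makes γ_out finite for small
θmax. For large m the sum of the two Lyapunov functions decays (`exists_composite_decay`), which
gives asymptotic stability, and convergence of every solution whose attitude error is eventually
below θ₀.

It remains to reach that regime from the small-gain region. Asymptotic gains say nothing about
transients. The condition is used instead through γ_in ≥ 1/m, as the bound |α(0)|, |α'(0)| ≤ m θmax,
which grows with the gains. The lag ρy is then at most θmax < π/2 at the start, so the thrust keeps
the positive effectiveness cos(ρy). In the variables (α - ᾱ)/m and Y = y/m, the kinetic energy ∫
s/cos(rs) ds with r = ρm ≤ 1 cancels this factor in the power balance; it is at least -log cos(rY),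
so a bound on the energy keeps the effectiveness away from zero. The main forcing left is f_t z/m.
Here z need not be small, since θ̄ may move at a rate of order m; but θ̄ moves only while |f_t| ≤
U_max, so z weighted by f_t/m is small. With n = √m, the function `excursion` combines the energy,
the weighted and the plain attitude error, and decays to O(1/n) (`excursion_rate_le`,
`exists_excursion_bound`). Eventually α - ᾱ and y are O(n^(3/2)), hence ρy and z are O(n^(-1/2)),
and the attitude error falls below θ₀ (`exists_small_attitude_error`). -/

lemma sat_eq {l : ℝ} (hl : 0 < l) (x : ℝ) : sat l x = max (-l) (min x l) := by
  unfold sat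
  rcases lt_trichotomy x 0 with h | h | h
  · rw [Real.sign_of_neg h, abs_of_neg h, min_eq_left (by linarith : x ≤ l)]
    rcases le_total (-x) l with h' | h'
    · rw [min_eq_left h', max_eq_right (by linarith)]; ring
    · rw [min_eq_right h', max_eq_left (by linarith)]; ring
  · subst h; simp [hl.le]
  · rw [Real.sign_of_pos h, abs_of_pos h, one_mul, max_eq_right]
    exact le_trans (by linarith) (le_min h.le hl.le)

lemma sat_continuous {l : ℝ} (hl : 0 < l) : Continuous (sat l) := by
  have : sat l = fun x => max (-l) (min x l) := funext (sat_eq hl)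
  rw [this]; fun_prop

lemma abs_sat_le {l : ℝ} (hl : 0 < l) (x : ℝ) : |sat l x| ≤ l := by
  rw [sat_eq hl, abs_le]
  exact ⟨le_max_left _ _, max_le (by linarith) (min_le_right _ _)⟩

lemma sat_of_abs_le {l x : ℝ} (hl : 0 < l) (h : |x| ≤ l) : sat l x = x := by
  rw [abs_le] at h
  rw [sat_eq hl, min_eq_left h.2, max_eq_right h.1]

lemma sat_of_le {l x : ℝ} (hl : 0 < l) (h : l ≤ x) : sat l x = l := by
  rw [sat_eq hl, min_eq_right h, max_eq_right (by linarith)]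

lemma sat_of_le_neg {l x : ℝ} (hl : 0 < l) (h : x ≤ -l) : sat l x = -l := by
  rw [sat_eq hl, min_eq_left (by linarith), max_eq_left h]

lemma sat_mono {l : ℝ} (hl : 0 < l) : Monotone (sat l) := by
  intro x y h
  rw [sat_eq hl, sat_eq hl]
  exact max_le_max le_rfl (min_le_min h le_rfl)

lemma sat_zero (l : ℝ) : sat l 0 = 0 := by simp [sat]

lemma abs_sat_sub_le {l : ℝ} (hl : 0 < l) (x y : ℝ) : |sat l x - sat l y| ≤ |x - y| := by
  rw [sat_eq hl, sat_eq hl]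
  calc |max (-l) (min x l) - max (-l) (min y l)| ≤ |min x l - min y l| :=
        by simpa [max_comm] using abs_max_sub_max_le_abs (min x l) (min y l) (-l)
    _ ≤ |x - y| := by
        have h := abs_min_sub_min_le_max x l y l
        simpa using h

/-- At the corner g t = l the sign of g' decides which branch is followed to the right of t. If g' =
0 the increment of the minimum is dominated by that of g, so the derivative is zero as well.
One-sided derivatives thus survive the saturations of the control laws, and all Lyapunov arguments
below rely on right derivatives only. -/
lemma exists_hasDerivWithinAt_min {g : ℝ → ℝ} {g' t : ℝ} (l : ℝ)
    (hg : HasDerivWithinAt g g' (Ici t) t) :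
    ∃ d : ℝ, 0 ≤ d ∧ d ≤ 1 ∧ HasDerivWithinAt (fun s => min (g s) l) (d * g') (Ici t) t ∧
      (l < g t → d = 0) := by
  have hc : Tendsto g (𝓝[Ici t] t) (𝓝 (g t)) := hg.continuousWithinAt
  rcases lt_trichotomy (g t) l with h | h | h
  · refine ⟨1, zero_le_one, le_rfl, ?_, fun h' => absurd h' h.not_gt⟩
    rw [one_mul]
    refine hg.congr_of_eventuallyEq ?_ (min_eq_left h.le)
    filter_upwards [hc.eventually (eventually_lt_nhds h)] with s hs using min_eq_left hs.le
  · have hI := hasDerivWithinAt_Ioi_iff_Ici.mpr hg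
    have hsl := (hasDerivWithinAt_iff_tendsto_slope' (by simp)).mp hI
    rcases lt_trichotomy g' 0 with h0 | h0 | h0
    · refine ⟨1, zero_le_one, le_rfl, ?_, fun h' => absurd h h'.ne'⟩
      rw [one_mul, ← hasDerivWithinAt_Ioi_iff_Ici]
      refine hI.congr_of_eventuallyEq ?_ (min_eq_left h.le)
      filter_upwards [hsl.eventually (eventually_lt_nhds h0), self_mem_nhdsWithin] with s hs hs'
      have hs' : t < s := hs'
      rw [slope_def_field, div_lt_iff₀ (by linarith)] at hs
      exact min_eq_left (by linarith)
    · refine ⟨0, le_rfl, zero_le_one, ?_, fun _ => rfl⟩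
      subst h0
      rw [zero_mul]
      rw [hasDerivWithinAt_iff_isLittleO] at hg ⊢
      refine Asymptotics.IsBigO.trans_isLittleO (Asymptotics.IsBigO.of_bound 1 (Eventually.of_forall fun s => ?_)) hg
      have := abs_min_sub_min_le_max (g s) l (g t) l
      simpa using this
    · refine ⟨0, le_rfl, zero_le_one, ?_, fun _ => rfl⟩
      rw [zero_mul, ← hasDerivWithinAt_Ioi_iff_Ici]
      refine (hasDerivWithinAt_const t (Ioi t) l).congr_of_eventuallyEq ?_ (min_eq_right h.ge)
      filter_upwards [hsl.eventually (eventually_gt_nhds h0), self_mem_nhdsWithin] with s hs hs'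
      have hs' : t < s := hs'
      rw [slope_def_field, lt_div_iff₀ (by linarith)] at hs
      exact min_eq_right (by linarith)
  · refine ⟨0, le_rfl, zero_le_one, ?_, fun _ => rfl⟩
    rw [zero_mul]
    refine (hasDerivWithinAt_const t (Ici t) l).congr_of_eventuallyEq ?_ (min_eq_right h.le)
    filter_upwards [hc.eventually (eventually_gt_nhds h)] with s hs using min_eq_right hs.le

/-- A saturation of a function with a right derivative has a right derivative. -/
lemma exists_hasDerivWithinAt_sat {g : ℝ → ℝ} {g' t l : ℝ} (hl : 0 < l)
    (hg : HasDerivWithinAt g g' (Ici t) t) :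
    ∃ d : ℝ, 0 ≤ d ∧ d ≤ 1 ∧ HasDerivWithinAt (fun s => sat l (g s)) (d * g') (Ici t) t ∧
      (l < |g t| → d = 0) := by
  obtain ⟨d₁, h0, h1, hd, hz⟩ := exists_hasDerivWithinAt_min l hg
  obtain ⟨d₂, k0, k1, kd, kz⟩ := exists_hasDerivWithinAt_min l hd.fun_neg
  refine ⟨d₂ * d₁, mul_nonneg k0 h0, mul_le_one₀ k1 h0 h1, ?_, fun h => ?_⟩
  · have h2 : (fun s => sat l (g s)) = fun s => -min (-min (g s) l) l := by
      funext s
      rw [sat_eq hl, ← max_neg_neg, neg_neg, max_comm]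
    rw [h2, show d₂ * d₁ * g' = -(d₂ * -(d₁ * g')) by ring]
    exact kd.fun_neg
  · rcases lt_abs.mp h with h | h
    · rw [hz h, mul_zero]
    · rw [kz (by rw [min_eq_left (by linarith)]; exact h), zero_mul]

/-! ### Comparison -/

/-- A solution of `g' ≤ -c g + k` decays exponentially to the level `k / c`. -/
lemma le_of_deriv_right_le {g g' : ℝ → ℝ} {T c k : ℝ} (hc : 0 < c)
    (hcont : ContinuousOn g (Ici T))
    (hg : ∀ t, T ≤ t → HasDerivWithinAt g (g' t) (Ici t) t)
    (h : ∀ t, T ≤ t → g' t ≤ -c * g t + k) (t : ℝ) (ht : T ≤ t) :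
    g t ≤ k / c + (g T - k / c) * Real.exp (-c * (t - T)) := by
  have key : (g t - k / c) * Real.exp (c * (t - T)) ≤ g T - k / c := by
    have := image_le_of_deriv_right_le_deriv_boundary
      (f := fun s => (g s - k / c) * Real.exp (c * (s - T)))
      (f' := fun s => g' s * Real.exp (c * (s - T))
        + (g s - k / c) * (Real.exp (c * (s - T)) * c))
      (a := T) (b := t) (B := fun _ => g T - k / c) (B' := fun _ => 0)
      ?_ ?_ ?_ continuousOn_const (fun _ _ => hasDerivWithinAt_const _ _ _) ?_ (right_mem_Icc.mpr ht)
    · exact this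
    · exact ((hcont.mono Icc_subset_Ici_self).sub continuousOn_const).mul
        (by fun_prop)
    · intro s hs
      have he : HasDerivAt (fun s => Real.exp (c * (s - T))) (Real.exp (c * (s - T)) * c) s := by
        have h1 : HasDerivAt (fun s => c * (s - T)) c s := by
          simpa using ((hasDerivAt_id s).sub_const T).const_mul c
        exact h1.exp
      exact ((hg s hs.1).sub_const _).fun_mul he.hasDerivWithinAt
    · simp
    · intro s hs
      have h1 := h s hs.1
      have h2 : g' s + (g s - k / c) * c ≤ 0 := by
        have : k / c * c = k := div_mul_cancel₀ k hc.ne'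
        nlinarith
      have := mul_nonpos_of_nonpos_of_nonneg h2 (Real.exp_pos (c * (s - T))).le
      linarith
  have h2 := mul_le_mul_of_nonneg_right key (Real.exp_pos (-c * (t - T))).le
  rw [mul_assoc, ← Real.exp_add] at h2
  have : c * (t - T) + -c * (t - T) = 0 := by ring
  rw [this, Real.exp_zero, mul_one] at h2
  linarith

lemma eventually_le_of_deriv_right_le {g g' : ℝ → ℝ} {T c k : ℝ} (hc : 0 < c)
    (hcont : ContinuousOn g (Ici T))
    (hg : ∀ t, T ≤ t → HasDerivWithinAt g (g' t) (Ici t) t)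
    (h : ∀ t, T ≤ t → g' t ≤ -c * g t + k) {η : ℝ} (hη : 0 < η) :
    ∀ᶠ t in atTop, g t ≤ k / c + η := by
  have hlim : Tendsto (fun t => (g T - k / c) * Real.exp (-c * (t - T))) atTop (𝓝 0) := by
    have h1 : Tendsto (fun t : ℝ => -(c * (t - T))) atTop atBot :=
      tendsto_neg_atTop_atBot.comp
        ((tendsto_atTop_add_const_right _ _ tendsto_id).const_mul_atTop hc)
    have := (Real.tendsto_exp_atBot.comp h1).const_mul (g T - k / c)
    simpa [Function.comp_def] using this
  filter_upwards [hlim.eventually (eventually_lt_nhds hη), eventually_ge_atTop T] with t h1 h2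
  have := le_of_deriv_right_le hc hcont hg h t h2
  linarith

/-- A solution of `g' ≤ -c g + k(t)` with `k(t) → 0` has upper limit at most zero. -/
lemma eventually_le_of_deriv_right_le_tendsto {g g' k : ℝ → ℝ} {T c : ℝ} (hc : 0 < c)
    (hcont : ContinuousOn g (Ici T))
    (hg : ∀ t, T ≤ t → HasDerivWithinAt g (g' t) (Ici t) t)
    (hk : Tendsto k atTop (𝓝 0))
    (h : ∀ t, T ≤ t → g' t ≤ -c * g t + k t) {η : ℝ} (hη : 0 < η) :
    ∀ᶠ t in atTop, g t ≤ η := by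
  obtain ⟨T', hT'⟩ := eventually_atTop.mp
    (hk.eventually (eventually_lt_nhds (show (0 : ℝ) < c * (η / 2) by positivity)))
  have := eventually_le_of_deriv_right_le (g := g) (g' := g') (T := max T T') (k := c * (η / 2)) hc
    (hcont.mono (Ici_subset_Ici.mpr (le_max_left _ _)))
    (fun t ht => hg t (le_trans (le_max_left _ _) ht))
    (fun t ht => (h t (le_trans (le_max_left _ _) ht)).trans
      (by have := hT' t (le_trans (le_max_right _ _) ht); linarith)) (half_pos hη)
  filter_upwards [this] with t ht
  rw [mul_div_cancel_left₀ _ hc.ne'] at ht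
  linarith

/-- A sublevel set on whose boundary the derivative is negative is invariant. -/
lemma le_of_deriv_right_neg {g g' : ℝ → ℝ} {T B : ℝ}
    (hcont : ContinuousOn g (Ici T))
    (hg : ∀ t, T ≤ t → HasDerivWithinAt g (g' t) (Ici t) t) (h0 : g T ≤ B)
    (h : ∀ t, T ≤ t → g t = B → g' t < 0) (t : ℝ) (ht : T ≤ t) : g t ≤ B :=
  image_le_of_deriv_right_lt_deriv_boundary' (f := g) (f' := g')
    (a := T) (b := t) (B := fun _ => B) (B' := fun _ => 0)
    (hcont.mono Icc_subset_Ici_self) (fun s hs => hg s hs.1) h0 continuousOn_const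
    (fun _ _ => hasDerivWithinAt_const _ _ _) (fun s hs => h s hs.1) (right_mem_Icc.mpr ht)

/-! ### Gains -/

/-- Every level above the upper limit is an eventual bound, and the excess η tends to zero.
Positivity of c disposes of an infinite upper limit, the product then being infinite. -/
lemma asymptoticGainBound_of_eventually {c : ℝ} (hc : 0 < c) {u y : ℝ → ℝ}
    (h : ∀ R : ℝ, 0 < R → (∀ᶠ t in atTop, |u t| ≤ R) → ∀ᶠ t in atTop, |y t| ≤ c * R) :
    AsymptoticGainBound (ENNReal.ofReal c) u y := by
  unfold AsymptoticGainBound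
  set ℓ := limsup (fun t => ‖u t‖ₑ) atTop with hℓ
  by_cases htop : ℓ = ⊤
  · rw [htop, ENNReal.mul_top (by simpa using hc)]; exact le_top
  have key : ∀ η : ℝ, 0 < η →
      limsup (fun t => ‖y t‖ₑ) atTop ≤ ENNReal.ofReal c * (ℓ + ENNReal.ofReal η) := by
    intro η hη
    have hlt : ℓ < ℓ + ENNReal.ofReal η :=
      ENNReal.lt_add_right htop (by simpa using hη)
    have hu : ∀ᶠ t in atTop, |u t| ≤ ℓ.toReal + η := by
      filter_upwards [eventually_lt_of_limsup_lt hlt] with t ht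
      have hfin : ℓ + ENNReal.ofReal η ≠ ⊤ := by simp [htop]
      have := (ENNReal.toReal_lt_toReal (by simp) hfin).mpr ht
      rw [ENNReal.toReal_add htop (by simp), ENNReal.toReal_ofReal hη.le, toReal_enorm,
        Real.norm_eq_abs] at this
      exact this.le
    have hy := h _ (by positivity) hu
    refine limsup_le_of_le (by isBoundedDefault) ?_
    filter_upwards [hy] with t ht
    rw [← ENNReal.ofReal_toReal htop, ← ENNReal.ofReal_add (by positivity) hη.le,
      ← ENNReal.ofReal_mul hc.le, ← ofReal_norm]
    exact ENNReal.ofReal_le_ofReal ht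
  have hlim : Tendsto (fun η : ℝ => ENNReal.ofReal c * (ℓ + ENNReal.ofReal η)) (𝓝[>] 0)
      (𝓝 (ENNReal.ofReal c * (ℓ + ENNReal.ofReal 0))) := by
    refine ENNReal.Tendsto.const_mul ?_ (Or.inr (by simp))
    exact tendsto_const_nhds.add ((ENNReal.continuous_ofReal.tendsto 0).mono_left nhdsWithin_le_nhds)
  rw [ENNReal.ofReal_zero, add_zero] at hlim
  exact ge_of_tendsto hlim (by filter_upwards [self_mem_nhdsWithin] with η hη using key η hη)

/-! ### Quadratic Lyapunov function of a damped second-order system -/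

/-- Lyapunov function of `z' = q + p`, `q' = -b z - a q + r`. -/
noncomputable def quad (μ b z q : ℝ) : ℝ := z ^ 2 + q ^ 2 / b + 2 * μ / b * (z * q)

section quad

variable {μ a b : ℝ}

lemma sixteen_mul_sq_le (hμ : 0 < μ) (ha : 4 * μ ≤ a) (hb : 4 * μ * a ≤ b) : 16 * μ ^ 2 ≤ b := by
  nlinarith

/-- Since 16 μ² ≤ b, the cross term is at most a quarter of the diagonal part, so `quad` is
equivalent to z² + q²/b with constants that do not depend on the gains. -/
lemma abs_cross_le (hμ : 0 < μ) (ha : 4 * μ ≤ a) (hb : 4 * μ * a ≤ b) (z q : ℝ) :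
    |2 * μ / b * (z * q)| ≤ 1 / 4 * (z ^ 2 + q ^ 2 / b) := by
  have h16 := sixteen_mul_sq_le hμ ha hb
  have hb0 : 0 < b := by nlinarith [sq_nonneg μ]
  rw [abs_le]
  have e1 : 2 * μ / b * (z * q) = (2 * μ * (z * q)) / b := by ring
  have e2 : 1 / 4 * (z ^ 2 + q ^ 2 / b) = (1 / 4 * (b * z ^ 2 + q ^ 2)) / b := by field_simp
  have h0 := mul_le_mul_of_nonneg_right h16 (sq_nonneg z)
  rw [e1, e2, ← neg_div]
  constructor
  · apply div_le_div_of_nonneg_right _ hb0.le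
    nlinarith [sq_nonneg (4 * μ * z + q)]
  · apply div_le_div_of_nonneg_right _ hb0.le
    nlinarith [sq_nonneg (4 * μ * z - q)]

lemma le_quad (hμ : 0 < μ) (ha : 4 * μ ≤ a) (hb : 4 * μ * a ≤ b) (z q : ℝ) :
    3 / 4 * (z ^ 2 + q ^ 2 / b) ≤ quad μ b z q := by
  have := (abs_le.mp (abs_cross_le hμ ha hb z q)).1
  unfold quad; linarith

lemma quad_le (hμ : 0 < μ) (ha : 4 * μ ≤ a) (hb : 4 * μ * a ≤ b) (z q : ℝ) :
    quad μ b z q ≤ 5 / 4 * (z ^ 2 + q ^ 2 / b) := by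
  have := (abs_le.mp (abs_cross_le hμ ha hb z q)).2
  unfold quad; linarith

lemma quad_nonneg (hμ : 0 < μ) (ha : 4 * μ ≤ a) (hb : 4 * μ * a ≤ b) (z q : ℝ) :
    0 ≤ quad μ b z q := by
  have h16 := sixteen_mul_sq_le hμ ha hb
  have hb0 : 0 < b := by nlinarith [sq_nonneg μ]
  exact le_trans (by positivity) (le_quad hμ ha hb z q)

lemma sq_le_quad (hμ : 0 < μ) (ha : 4 * μ ≤ a) (hb : 4 * μ * a ≤ b) (z q : ℝ) :
    z ^ 2 ≤ 4 / 3 * quad μ b z q := by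
  have h16 := sixteen_mul_sq_le hμ ha hb
  have hb0 : 0 < b := by nlinarith [sq_nonneg μ]
  have := le_quad hμ ha hb z q
  have : 0 ≤ q ^ 2 / b := by positivity
  linarith

lemma sq_le_mul_quad (hμ : 0 < μ) (ha : 4 * μ ≤ a) (hb : 4 * μ * a ≤ b) (z q : ℝ) :
    q ^ 2 ≤ 4 / 3 * b * quad μ b z q := by
  have h16 := sixteen_mul_sq_le hμ ha hb
  have hb0 : 0 < b := by nlinarith [sq_nonneg μ]
  have h1 := le_quad hμ ha hb z q
  have h2 : q ^ 2 = b * (q ^ 2 / b) := by field_simp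
  have h3 : q ^ 2 / b ≤ 4 / 3 * quad μ b z q := by nlinarith [sq_nonneg z]
  calc q ^ 2 = b * (q ^ 2 / b) := h2
    _ ≤ b * (4 / 3 * quad μ b z q) := by gcongr
    _ = _ := by ring

/-- The diagonal part dissipates only 2a q²/b; the cross term adds the missing -2μ z². Young's
inequality spends at most μ z² and three quarters of the dissipation in q on the indefinite terms.
What remains is at least μ (z² + q²/b), hence 4/5 μ times `quad` by `quad_le`. -/
lemma quad_deriv_le (hμ : 0 < μ) (ha : 4 * μ ≤ a) (hb : 4 * μ * a ≤ b) (z q p r : ℝ) :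
    2 * z * (q + p) + 2 * q * (-b * z - a * q + r) / b
      + 2 * μ / b * ((q + p) * q + z * (-b * z - a * q + r))
      ≤ -(4 / 5 * μ) * quad μ b z q + 5 * p ^ 2 / μ + 5 * r ^ 2 / (a * b) := by
  have h16 := sixteen_mul_sq_le hμ ha hb
  have ha0 : 0 < a := by linarith
  have hb0 : 0 < b := by nlinarith [sq_nonneg μ]
  have t1 : 2 * z * p ≤ μ / 4 * z ^ 2 + 4 * p ^ 2 / μ := by
    have : μ / 4 * z ^ 2 + 4 * p ^ 2 / μ - 2 * z * p = (μ * z - 4 * p) ^ 2 / (4 * μ) := by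
      field_simp; ring
    have : 0 ≤ (μ * z - 4 * p) ^ 2 / (4 * μ) := by positivity
    linarith
  have t2 : 2 * q * r / b ≤ a / (4 * b) * q ^ 2 + 4 * r ^ 2 / (a * b) := by
    have : a / (4 * b) * q ^ 2 + 4 * r ^ 2 / (a * b) - 2 * q * r / b
        = (a * q - 4 * r) ^ 2 / (4 * a * b) := by
      field_simp; ring
    have : 0 ≤ (a * q - 4 * r) ^ 2 / (4 * a * b) := by positivity
    linarith
  have t3 : 2 * μ / b * (p * q) ≤ a / (4 * b) * q ^ 2 + p ^ 2 / μ := by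
    have e : a / (4 * b) * q ^ 2 + 4 * μ ^ 2 * p ^ 2 / (a * b) - 2 * μ / b * (p * q)
        = (a * q - 4 * μ * p) ^ 2 / (4 * a * b) := by
      field_simp; ring
    have : 0 ≤ (a * q - 4 * μ * p) ^ 2 / (4 * a * b) := by positivity
    have : 4 * μ ^ 2 * p ^ 2 / (a * b) ≤ p ^ 2 / μ := by
      rw [div_le_div_iff₀ (by positivity) hμ]
      have : 4 * μ ^ 2 * μ ≤ a * b := by
        calc 4 * μ ^ 2 * μ = (4 * μ) * μ ^ 2 := by ring
          _ ≤ a * b := by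
            apply mul_le_mul ha _ (by positivity) ha0.le
            nlinarith [sq_nonneg μ]
      nlinarith [mul_le_mul_of_nonneg_left this (sq_nonneg p)]
    linarith
  have t4 : 2 * μ / b * (z * r) ≤ μ / 4 * z ^ 2 + r ^ 2 / (a * b) := by
    have e : μ / 4 * z ^ 2 + 4 * μ * r ^ 2 / b ^ 2 - 2 * μ / b * (z * r)
        = μ * (b * z - 4 * r) ^ 2 / (4 * b ^ 2) := by
      field_simp; ring
    have : 0 ≤ μ * (b * z - 4 * r) ^ 2 / (4 * b ^ 2) := by positivity
    have : 4 * μ * r ^ 2 / b ^ 2 ≤ r ^ 2 / (a * b) := by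
      rw [div_le_div_iff₀ (by positivity) (by positivity)]
      nlinarith [mul_le_mul_of_nonneg_right hb (show 0 ≤ r ^ 2 * b by positivity)]
    linarith
  have t5 : -(2 * μ * a / b * (z * q)) ≤ a / (2 * b) * q ^ 2 + μ / 2 * z ^ 2 := by
    have e : a / (2 * b) * q ^ 2 + 2 * μ ^ 2 * a / b * z ^ 2 + 2 * μ * a / b * (z * q)
        = a * (q + 2 * μ * z) ^ 2 / (2 * b) := by
      field_simp; ring
    have : 0 ≤ a * (q + 2 * μ * z) ^ 2 / (2 * b) := by positivity
    have : 2 * μ ^ 2 * a / b ≤ μ / 2 := by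
      rw [div_le_div_iff₀ hb0 (by norm_num)]; nlinarith
    have := mul_le_mul_of_nonneg_right this (sq_nonneg z)
    linarith
  have t6 : 2 * μ / b * q ^ 2 ≤ a / (2 * b) * q ^ 2 := by
    apply mul_le_mul_of_nonneg_right _ (sq_nonneg q)
    rw [div_le_div_iff₀ hb0 (by positivity)]; nlinarith
  have t7 : μ * (q ^ 2 / b) ≤ a / (2 * b) * q ^ 2 := by
    have : a / (2 * b) * q ^ 2 = a / 2 * (q ^ 2 / b) := by field_simp
    rw [this]
    exact mul_le_mul_of_nonneg_right (by linarith) (by positivity)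
  have e : 2 * z * (q + p) + 2 * q * (-b * z - a * q + r) / b
      + 2 * μ / b * ((q + p) * q + z * (-b * z - a * q + r))
      = 2 * z * p - 4 * (a / (2 * b) * q ^ 2) + 2 * q * r / b + 2 * μ / b * q ^ 2
        + 2 * μ / b * (p * q) - 2 * μ * z ^ 2 + -(2 * μ * a / b * (z * q))
        + 2 * μ / b * (z * r) := by field_simp; ring
  have t8 : a / (4 * b) * q ^ 2 = 1 / 2 * (a / (2 * b) * q ^ 2) := by ring
  have hq := mul_le_mul_of_nonneg_left (quad_le hμ ha hb z q) (show 0 ≤ 4 / 5 * μ by positivity)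
  have p1 : 4 * p ^ 2 / μ + p ^ 2 / μ = 5 * p ^ 2 / μ := by ring
  have p2 : 4 * r ^ 2 / (a * b) + r ^ 2 / (a * b) = 5 * r ^ 2 / (a * b) := by ring
  rw [e]
  linarith

lemma hasDerivWithinAt_quad (μ b : ℝ) {z q : ℝ → ℝ} {z' q' t : ℝ} {s : Set ℝ}
    (hz : HasDerivWithinAt z z' s t) (hq : HasDerivWithinAt q q' s t) :
    HasDerivWithinAt (fun τ => quad μ b (z τ) (q τ))
      (2 * z t * z' + 2 * q t * q' / b + 2 * μ / b * (z' * q t + z t * q')) s t := by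
  unfold quad
  refine HasDerivWithinAt.congr_deriv (((hz.fun_pow 2).fun_add ((hq.fun_pow 2).div_const b)).fun_add
    ((hz.fun_mul hq).const_mul (2 * μ / b))) ?_
  push_cast; ring

lemma continuousOn_quad (μ b : ℝ) {z q : ℝ → ℝ} {s : Set ℝ}
    (hz : ContinuousOn z s) (hq : ContinuousOn q s) :
    ContinuousOn (fun τ => quad μ b (z τ) (q τ)) s := by
  unfold quad
  exact ((hz.pow 2).add ((hq.pow 2).div_const b)).add ((hz.mul hq).const_mul _)

end quad

/-! ### Attitude mapping and thrust -/

section actuator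

variable (P : Plant) (C : Tuning)

lemma Plant.M_pos : 0 < P.M := by
  have := P.mb_pos; have := P.dG_pos; have := P.L_pos; have := P.mu_pos
  unfold Plant.M; positivity

lemma Plant.I0_pos : 0 < P.I0 := by
  have := P.mb_pos; have := P.dG_pos; have := P.L_pos; have := P.mu_pos; have := P.Ib_pos
  unfold Plant.I0; positivity

lemma arctan_eps_Umax_pos : 0 < Real.arctan (C.eps * P.Umax) := by
  have := C.eps_pos; have := P.Umax_pos
  exact Real.arctan_pos.mpr (by positivity)

lemma gam_pos : 0 < gam P C := by
  have := arctan_eps_Umax_pos P C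
  unfold gam; positivity

lemma gam_mul_arctan : gam P C * Real.arctan (C.eps * P.Umax) = Real.pi / 2 := by
  have := arctan_eps_Umax_pos P C
  unfold gam; field_simp

lemma thetaBar_neg (f : ℝ) : thetaBar P C (-f) = -thetaBar P C f := by
  unfold thetaBar
  rw [mul_neg, Real.arctan_neg, mul_neg]
  simp [sat, Real.sign_neg]

lemma u1_neg (f : ℝ) : u1 P C (-f) = u1 P C f := by
  unfold u1
  simp only [neg_eq_zero, thetaBar_neg, Real.sin_neg, neg_div_neg_eq]

lemma thetaBar_of_Umax_le {f : ℝ} (hf : P.Umax ≤ f) : thetaBar P C f = Real.pi / 2 := by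
  apply sat_of_le (by positivity)
  rw [← gam_mul_arctan P C]
  exact mul_le_mul_of_nonneg_left
    (Real.arctan_mono (mul_le_mul_of_nonneg_left hf C.eps_pos.le)) (gam_pos P C).le

lemma thetaBar_of_le_Umax {f : ℝ} (h0 : 0 ≤ f) (hf : f ≤ P.Umax) :
    thetaBar P C f = gam P C * Real.arctan (C.eps * f) := by
  apply sat_of_abs_le (by positivity)
  have h1 : 0 ≤ Real.arctan (C.eps * f) := Real.arctan_nonneg.mpr (mul_nonneg C.eps_pos.le h0)
  rw [abs_of_nonneg (mul_nonneg (gam_pos P C).le h1), ← gam_mul_arctan P C]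
  exact mul_le_mul_of_nonneg_left
    (Real.arctan_mono (mul_le_mul_of_nonneg_left hf C.eps_pos.le)) (gam_pos P C).le

lemma abs_thetaBar_le (f : ℝ) : |thetaBar P C f| ≤ Real.pi / 2 := abs_sat_le (by positivity) _

lemma thetaBar_pos {f : ℝ} (hf : 0 < f) : 0 < thetaBar P C f := by
  rcases le_total f P.Umax with h | h
  · rw [thetaBar_of_le_Umax P C hf.le h]
    exact mul_pos (gam_pos P C) (Real.arctan_pos.mpr (mul_pos C.eps_pos hf))
  · rw [thetaBar_of_Umax_le P C h]; positivity

lemma continuous_thetaBar : Continuous (thetaBar P C) := by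
  unfold thetaBar
  exact (sat_continuous (by positivity)).comp (by fun_prop)

lemma abs_arctan_sub_le (x y : ℝ) : |Real.arctan x - Real.arctan y| ≤ |x - y| := by
  have h := Convex.norm_image_sub_le_of_norm_deriv_le (f := Real.arctan) (C := 1) (s := univ)
    (x := y) (y := x) (fun x _ => Real.differentiable_arctan x) (fun x _ => ?_) convex_univ
    (mem_univ _) (mem_univ _)
  · simpa using h
  · rw [Real.deriv_arctan, Real.norm_eq_abs, abs_of_pos (by positivity),
      div_le_one (by positivity)]
    nlinarith [sq_nonneg x]

lemma abs_thetaBar_sub_le (f₁ f₂ : ℝ) :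
    |thetaBar P C f₁ - thetaBar P C f₂| ≤ gam P C * C.eps * |f₁ - f₂| := by
  refine (abs_sat_sub_le (by positivity) _ _).trans ?_
  rw [← mul_sub, abs_mul, abs_of_pos (gam_pos P C), mul_assoc]
  refine mul_le_mul_of_nonneg_left ((abs_arctan_sub_le _ _).trans ?_) (gam_pos P C).le
  rw [← mul_sub, abs_mul, abs_of_pos C.eps_pos]

lemma u1_mul_sin_thetaBar (f : ℝ) : u1 P C f * Real.sin (thetaBar P C f) = f := by
  by_cases hf : f = 0
  · subst hf; simp [thetaBar, sat_zero]
  have key : ∀ f, 0 < f → Real.sin (thetaBar P C f) ≠ 0 := by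
    intro f hf
    have := abs_le.mp (abs_thetaBar_le P C f)
    exact (Real.sin_pos_of_pos_of_lt_pi (thetaBar_pos P C hf)
      (by linarith [Real.pi_pos])).ne'
  have h0 : Real.sin (thetaBar P C f) ≠ 0 := by
    rcases lt_or_gt_of_ne hf with h | h
    · have := key (-f) (by linarith)
      rwa [thetaBar_neg, Real.sin_neg, neg_ne_zero] at this
    · exact key f h
  unfold u1
  rw [if_neg hf, div_mul_cancel₀ _ h0]

lemma div_sqrt_le_arctan {x : ℝ} (hx : 0 ≤ x) : x / √(1 + x ^ 2) ≤ Real.arctan x := by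
  rw [← Real.sin_arctan]
  exact Real.sin_le (Real.arctan_nonneg.mpr hx)

/-- The thrust exceeds `|f|` by a bounded amount, and its component orthogonal to the desired
force is bounded. -/
lemma exists_u1_bound : ∃ c : ℝ, 0 < c ∧ ∀ f : ℝ, 0 ≤ u1 P C f ∧ u1 P C f ≤ c + |f| ∧
    |u1 P C f * Real.cos (thetaBar P C f)| ≤ c := by
  have hg := gam_pos P C
  have he := C.eps_pos
  have hU := P.Umax_pos
  set R := √(1 + (C.eps * P.Umax) ^ 2) with hR
  have hR1 : 1 ≤ R := by
    rw [hR, Real.one_le_sqrt]; nlinarith [sq_nonneg (C.eps * P.Umax)]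
  have hp := Real.pi_gt_three
  -- For 0 ≤ f ≤ U_max, arctan(εf) ≥ εf/R and Jordan's inequality sin θ ≥ 2θ/π give sin θ̄ ≥ f/c, so
  -- the thrust is at most c. Beyond U_max the reference is π/2: the thrust equals f and its
  -- orthogonal component vanishes. Negative f follow by parity.
  set c := Real.pi * R / (2 * (gam P C * C.eps)) with hc
  have hc0 : 0 < c := by positivity
  have small : ∀ f, 0 ≤ f → f ≤ P.Umax → 0 ≤ u1 P C f ∧ u1 P C f ≤ c := by
    intro f h0 hf
    rcases h0.eq_or_lt with h | h
    · subst h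
      simp only [u1, if_true]
      refine ⟨by positivity, ?_⟩
      rw [hc, div_le_div_iff₀ (by positivity) (by positivity)]
      nlinarith [mul_pos hg he, mul_pos (mul_pos hg he) (show 0 < Real.pi * R - 2 by nlinarith)]
    · have hth : gam P C * (C.eps * f / R) ≤ thetaBar P C f := by
        rw [thetaBar_of_le_Umax P C h0 hf]
        refine mul_le_mul_of_nonneg_left ?_ hg.le
        refine le_trans ?_ (div_sqrt_le_arctan (by positivity))
        apply div_le_div_of_nonneg_left (by positivity) (by positivity)
        rw [hR]
        apply Real.sqrt_le_sqrt
        gcongr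
      have hsin : 2 / Real.pi * (gam P C * (C.eps * f / R)) ≤ Real.sin (thetaBar P C f) :=
        (mul_le_mul_of_nonneg_left hth (by positivity)).trans
          (Real.mul_le_sin (thetaBar_pos P C h).le (abs_le.mp (abs_thetaBar_le P C f)).2)
      have hpos : 0 < 2 / Real.pi * (gam P C * (C.eps * f / R)) := by positivity
      simp only [u1, if_neg h.ne']
      refine ⟨div_nonneg h0 (hpos.le.trans hsin), ?_⟩
      refine (div_le_div_of_nonneg_left h0 hpos hsin).trans (le_of_eq ?_)
      rw [hc]; field_simp
  have nn : ∀ f, 0 ≤ f → 0 ≤ u1 P C f ∧ u1 P C f ≤ c + |f| ∧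
      |u1 P C f * Real.cos (thetaBar P C f)| ≤ c := by
    intro f h0
    rcases le_total f P.Umax with h | h
    · obtain ⟨h1, h2⟩ := small f h0 h
      refine ⟨h1, by linarith [abs_nonneg f], ?_⟩
      rw [abs_mul, abs_of_nonneg h1]
      exact (mul_le_of_le_one_right h1 (Real.abs_cos_le_one _)).trans h2
    · have hf : 0 < f := hU.trans_le h
      have : u1 P C f = f := by
        simp [u1, if_neg hf.ne', thetaBar_of_Umax_le P C h]
      rw [this, thetaBar_of_Umax_le P C h, abs_of_pos hf]
      refine ⟨h0, by linarith, by simp [hc0.le]⟩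
  refine ⟨c, hc0, fun f => ?_⟩
  rcases le_total 0 f with h | h
  · exact nn f h
  · have := nn (-f) (by linarith)
    rwa [u1_neg, thetaBar_neg, Real.cos_neg, abs_neg] at this

lemma hasDerivWithinAt_ft (abar : ℝ) {α y : ℝ → ℝ} {y' t : ℝ} {s : Set ℝ}
    (hα : HasDerivWithinAt α (y t) s t) (hy : HasDerivWithinAt y y' s t) :
    HasDerivWithinAt (fun τ => ft P C abar (α τ) (y τ))
      (-C.kpa * y t - C.kda * y' - P.M * P.g * (Real.sin (α t) * y t)) s t := by
  unfold ft
  refine HasDerivWithinAt.congr_deriv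
    ((((hα.sub_const abar).const_mul (-C.kpa)).fun_sub (hy.const_mul C.kda)).fun_add
    (hα.cos.const_mul (P.M * P.g))) ?_
  ring

/-- The attitude reference has a right derivative, which vanishes when the reference is saturated. -/
lemma exists_hasDerivWithinAt_thetaBar {f : ℝ → ℝ} {f' t : ℝ}
    (hf : HasDerivWithinAt f f' (Ici t) t) :
    ∃ D : ℝ, HasDerivWithinAt (fun τ => thetaBar P C (f τ)) D (Ici t) t ∧
      |D| ≤ gam P C * C.eps * |f'| ∧ (P.Umax < |f t| → D = 0) := by
  have hg := gam_pos P C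
  have he := C.eps_pos
  have h1 := ((hf.const_mul C.eps).arctan).const_mul (gam P C)
  obtain ⟨d, d0, d1, hd, hz⟩ := exists_hasDerivWithinAt_sat (l := Real.pi / 2) (by positivity) h1
  refine ⟨_, hd, ?_, fun h => ?_⟩
  · have hq : 0 ≤ 1 / (1 + (C.eps * f t) ^ 2) := by positivity
    have hq1 : 1 / (1 + (C.eps * f t) ^ 2) ≤ 1 := by
      rw [div_le_one (by positivity)]; nlinarith [sq_nonneg (C.eps * f t)]
    rw [abs_mul, abs_mul, abs_mul, abs_mul, abs_of_nonneg d0, abs_of_pos hg, abs_of_pos he,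
      abs_of_nonneg hq]
    have k1 : 1 / (1 + (C.eps * f t) ^ 2) * (C.eps * |f'|) ≤ C.eps * |f'| :=
      mul_le_of_le_one_left (by positivity) hq1
    calc d * (gam P C * (1 / (1 + (C.eps * f t) ^ 2) * (C.eps * |f'|)))
        ≤ gam P C * (1 / (1 + (C.eps * f t) ^ 2) * (C.eps * |f'|)) :=
          mul_le_of_le_one_left (by positivity) d1
      _ ≤ gam P C * (C.eps * |f'|) := by gcongr
      _ = _ := by ring
  · rw [hz ?_, zero_mul]
    rw [abs_mul, abs_of_pos hg, ← gam_mul_arctan P C]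
    refine mul_lt_mul_of_pos_left ?_ hg
    rcases lt_abs.mp h with h | h
    · exact lt_of_lt_of_le (Real.arctan_strictMono (mul_lt_mul_of_pos_left h he)) (le_abs_self _)
    · refine lt_of_lt_of_le (Real.arctan_strictMono (mul_lt_mul_of_pos_left h he)) ?_
      rw [mul_neg, Real.arctan_neg]; exact neg_le_abs _

/-! ### Bounds on the acceleration of the object -/

lemma I0_mul_objAcc (abar α y th ax : ℝ) :
    P.I0 * objAcc P C abar α y th ax = u1 P C (ft P C abar α y) * Real.sin th
      + P.M * Real.sin α * ax - P.M * P.g * Real.cos α := by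
  unfold objAcc
  rw [mul_div_cancel₀ _ P.I0_pos.ne']; ring

lemma u1_mul_sin_add (f e : ℝ) : u1 P C f * Real.sin (thetaBar P C f + e)
    = f * Real.cos e + u1 P C f * Real.cos (thetaBar P C f) * Real.sin e := by
  rw [Real.sin_add, mul_add, ← mul_assoc, u1_mul_sin_thetaBar]; ring

lemma abs_mul_sin_le (c x : ℝ) : |c * Real.sin x| ≤ |c| := by
  rw [abs_mul]; exact mul_le_of_le_one_right (abs_nonneg _) (Real.abs_sin_le_one _)

lemma abs_mul_cos_le (c x : ℝ) : |c * Real.cos x| ≤ |c| := by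
  rw [abs_mul]; exact mul_le_of_le_one_right (abs_nonneg _) (Real.abs_cos_le_one _)

lemma abs_sin_le_abs (x : ℝ) : |Real.sin x| ≤ |x| := Real.abs_sin_le_abs

lemma abs_one_sub_cos_le (x : ℝ) : |1 - Real.cos x| ≤ |x| := by
  rw [abs_of_nonneg (by linarith [Real.cos_le_one x])]
  rcases le_total |x| 2 with h | h
  · have := Real.one_sub_sq_div_two_le_cos (x := x)
    nlinarith [sq_abs x, abs_nonneg x]
  · linarith [Real.neg_one_le_cos x]

/-- Deviation of the inclination dynamics from a damped oscillator caused by an attitude error `e`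
and a cart acceleration `ax`. -/
lemma exists_objAcc_error_bound : ∃ c : ℝ, 0 < c ∧ ∀ abar α y e ax : ℝ,
    |P.I0 * objAcc P C abar α y (thetaBar P C (ft P C abar α y) + e) ax
      + C.kpa * (α - abar) + C.kda * y|
      ≤ |1 - Real.cos e| * (C.kpa * |α - abar| + C.kda * |y|) + c * (|e| + |ax|) := by
  obtain ⟨c, hc, hb⟩ := exists_u1_bound P C
  have hM := P.M_pos
  have hg := P.g_pos
  have hkp := C.kpa_pos
  have hkd := C.kda_pos
  refine ⟨P.M * P.g + c + P.M, by positivity, fun abar α y e ax => ?_⟩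
  rw [I0_mul_objAcc, u1_mul_sin_add]
  have hu := (hb (ft P C abar α y)).2.2
  set w := u1 P C (ft P C abar α y) * Real.cos (thetaBar P C (ft P C abar α y))
  -- Without attitude error the tangential thrust is exactly f_t and compensates gravity. Each term
  -- of the deviation therefore carries a factor 1 - cos e, sin e or ax.
  have e1 : ft P C abar α y * Real.cos e + w * Real.sin e + P.M * Real.sin α * ax
      - P.M * P.g * Real.cos α + C.kpa * (α - abar) + C.kda * y
      = (1 - Real.cos e) * (C.kpa * (α - abar) + C.kda * y)
        - (1 - Real.cos e) * (P.M * P.g * Real.cos α) + w * Real.sin e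
        + P.M * ax * Real.sin α := by unfold ft; ring
  rw [e1]
  have b1 : |(1 - Real.cos e) * (C.kpa * (α - abar) + C.kda * y)|
      ≤ |1 - Real.cos e| * (C.kpa * |α - abar| + C.kda * |y|) := by
    rw [abs_mul]
    refine mul_le_mul_of_nonneg_left ((abs_add_le _ _).trans ?_) (abs_nonneg _)
    rw [abs_mul, abs_mul, abs_of_pos hkp, abs_of_pos hkd]
  have b2 : |(1 - Real.cos e) * (P.M * P.g * Real.cos α)| ≤ |e| * (P.M * P.g) := by
    rw [abs_mul]
    refine mul_le_mul (abs_one_sub_cos_le e) ((abs_mul_cos_le _ _).trans ?_) (abs_nonneg _)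
      (abs_nonneg _)
    rw [abs_of_pos (by positivity)]
  have b3 : |w * Real.sin e| ≤ c * |e| := by
    rw [abs_mul]; exact mul_le_mul hu (abs_sin_le_abs e) (abs_nonneg _) hc.le
  have b4 : |P.M * ax * Real.sin α| ≤ P.M * |ax| := by
    refine (abs_mul_sin_le _ _).trans ?_
    rw [abs_mul, abs_of_pos hM]
  have := abs_add_le ((1 - Real.cos e) * (C.kpa * (α - abar) + C.kda * y)
        - (1 - Real.cos e) * (P.M * P.g * Real.cos α) + w * Real.sin e) (P.M * ax * Real.sin α)
  have := abs_add_le ((1 - Real.cos e) * (C.kpa * (α - abar) + C.kda * y)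
        - (1 - Real.cos e) * (P.M * P.g * Real.cos α)) (w * Real.sin e)
  have := abs_sub ((1 - Real.cos e) * (C.kpa * (α - abar) + C.kda * y))
    ((1 - Real.cos e) * (P.M * P.g * Real.cos α))
  have := abs_nonneg e
  have := abs_nonneg ax
  nlinarith [mul_nonneg hM.le (abs_nonneg e), mul_nonneg (mul_pos hM hg).le (abs_nonneg ax),
    mul_nonneg hc.le (abs_nonneg ax)]

/-- Linear bound on the acceleration of the object. -/
lemma exists_objAcc_linear_bound : ∃ c : ℝ, 0 < c ∧ ∀ abar α y e ax : ℝ,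
    |objAcc P C abar α y (thetaBar P C (ft P C abar α y) + e) ax|
      ≤ c * (|α - abar| + |y| + |e| + |ax|) := by
  obtain ⟨c, hc, hb⟩ := exists_objAcc_error_bound P C
  have hI := P.I0_pos
  have hkp := C.kpa_pos
  have hkd := C.kda_pos
  refine ⟨(3 * C.kpa + 3 * C.kda + c) / P.I0, by positivity, fun abar α y e ax => ?_⟩
  have h := hb abar α y e ax
  set A := objAcc P C abar α y (thetaBar P C (ft P C abar α y) + e) ax
  have h2 : |1 - Real.cos e| ≤ 2 := by
    rw [abs_le]; constructor <;> linarith [Real.cos_le_one e, Real.neg_one_le_cos e]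
  have h3 := mul_le_mul_of_nonneg_right h2
    (show 0 ≤ C.kpa * |α - abar| + C.kda * |y| by positivity)
  have h4 : |P.I0 * A| ≤ |P.I0 * A + C.kpa * (α - abar) + C.kda * y|
      + C.kpa * |α - abar| + C.kda * |y| := by
    have k := abs_sub (P.I0 * A + C.kpa * (α - abar) + C.kda * y)
      (C.kpa * (α - abar) + C.kda * y)
    have k2 := abs_add_le (C.kpa * (α - abar)) (C.kda * y)
    rw [abs_mul C.kpa, abs_mul C.kda, abs_of_pos hkp, abs_of_pos hkd] at k2
    have k3 : P.I0 * A + C.kpa * (α - abar) + C.kda * y - (C.kpa * (α - abar) + C.kda * y)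
      = P.I0 * A := by ring
    rw [k3] at k
    linarith
  rw [abs_mul, abs_of_pos hI] at h4
  rw [div_mul_eq_mul_div, le_div_iff₀ hI]
  have := abs_nonneg e
  have := abs_nonneg ax
  have := abs_nonneg y
  have := abs_nonneg (α - abar)
  nlinarith [mul_nonneg hkp.le (abs_nonneg y), mul_nonneg hkp.le (abs_nonneg e),
    mul_nonneg hkp.le (abs_nonneg ax), mul_nonneg hkd.le (abs_nonneg (α - abar)),
    mul_nonneg hkd.le (abs_nonneg e), mul_nonneg hkd.le (abs_nonneg ax),
    mul_nonneg hc.le (abs_nonneg y), mul_nonneg hc.le (abs_nonneg (α - abar))]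

/-- Bound on the acceleration of the object that is uniform in the relative attitude. -/
lemma exists_objAcc_affine_bound : ∃ c : ℝ, 0 < c ∧ ∀ abar α y th ax : ℝ,
    |objAcc P C abar α y th ax| ≤ c * (1 + |α - abar| + |y| + |ax|) ∧
    |ft P C abar α y| ≤ c * (1 + |α - abar| + |y|) := by
  obtain ⟨c, hc, hb⟩ := exists_u1_bound P C
  have hI := P.I0_pos
  have hM := P.M_pos
  have hg := P.g_pos
  have hkp := C.kpa_pos
  have hkd := C.kda_pos
  set s := C.kpa + C.kda + P.M * P.g with hs
  have hs0 : 0 < s := by positivity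
  have hft : ∀ abar α y : ℝ, |ft P C abar α y| ≤ s * (1 + |α - abar| + |y|) := by
    intro abar α y
    unfold ft
    have k1 := abs_add_le (-C.kpa * (α - abar) - C.kda * y) (P.M * P.g * Real.cos α)
    have k2 := abs_sub (-C.kpa * (α - abar)) (C.kda * y)
    have k3 := abs_mul_cos_le (P.M * P.g) α
    rw [abs_mul, abs_mul, abs_neg, abs_of_pos hkp, abs_of_pos hkd] at k2
    rw [abs_of_pos (by positivity : 0 < P.M * P.g)] at k3
    have := abs_nonneg y
    have := abs_nonneg (α - abar)
    rw [hs]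
    nlinarith [mul_nonneg hkp.le (abs_nonneg y), mul_nonneg hkd.le (abs_nonneg (α - abar)),
      mul_nonneg (mul_pos hM hg).le (abs_nonneg y),
      mul_nonneg (mul_pos hM hg).le (abs_nonneg (α - abar))]
  have hK : 0 < (c + s + P.M + P.M * P.g) / P.I0 := by positivity
  refine ⟨(c + s + P.M + P.M * P.g) / P.I0 + s, by positivity, fun abar α y th ax => ⟨?_, ?_⟩⟩
  · have h1 := I0_mul_objAcc P C abar α y th ax
    have hu := hb (ft P C abar α y)
    have k1 := abs_mul_sin_le (u1 P C (ft P C abar α y)) th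
    rw [abs_of_nonneg hu.1] at k1
    have k2 := abs_mul_sin_le (P.M * ax) α
    rw [abs_mul P.M, abs_of_pos hM] at k2
    have k3 := abs_mul_cos_le (P.M * P.g) α
    rw [abs_of_pos (by positivity : 0 < P.M * P.g)] at k3
    have k4 := abs_sub (u1 P C (ft P C abar α y) * Real.sin th + P.M * ax * Real.sin α)
      (P.M * P.g * Real.cos α)
    have k5 := abs_add_le (u1 P C (ft P C abar α y) * Real.sin th) (P.M * ax * Real.sin α)
    have k6 : P.I0 * |objAcc P C abar α y th ax|
        = |u1 P C (ft P C abar α y) * Real.sin th + P.M * ax * Real.sin α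
          - P.M * P.g * Real.cos α| := by
      rw [show P.I0 * |objAcc P C abar α y th ax| = |P.I0 * objAcc P C abar α y th ax| by
        rw [abs_mul, abs_of_pos hI], h1]
      congr 1; ring
    have k7 := hft abar α y
    have hx := abs_nonneg ax
    have hy := abs_nonneg y
    have ha := abs_nonneg (α - abar)
    have h8 : |objAcc P C abar α y th ax|
        ≤ (c + s + P.M + P.M * P.g) / P.I0 * (1 + |α - abar| + |y| + |ax|) := by
      rw [div_mul_eq_mul_div, le_div_iff₀ hI]
      nlinarith [mul_nonneg hc.le (add_nonneg (add_nonneg ha hy) hx),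
        mul_nonneg hs0.le hx, mul_nonneg hM.le (add_nonneg ha hy),
        mul_nonneg (mul_pos hM hg).le (add_nonneg (add_nonneg ha hy) hx)]
    refine h8.trans ?_
    gcongr
    linarith
  · refine (hft abar α y).trans ?_
    gcongr
    linarith

/-- Inclination dynamics for a relative attitude `θ̄ - w + z`. -/
lemma exists_objAcc_shift_bound : ∃ c : ℝ, 0 < c ∧ ∀ abar α y w z ax : ℝ,
    |P.I0 * objAcc P C abar α y (thetaBar P C (ft P C abar α y) - w + z) ax
      + (C.kpa * (α - abar) + C.kda * y) * Real.cos w|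
      ≤ c * (1 + |ax| + |z|) + |ft P C abar α y| * |z| := by
  obtain ⟨c, hc, hb⟩ := exists_u1_bound P C
  have hM := P.M_pos
  have hg := P.g_pos
  refine ⟨c + 2 * (P.M * P.g) + P.M, by positivity, fun abar α y w z ax => ?_⟩
  rw [I0_mul_objAcc]
  set f := ft P C abar α y with hf
  have hu := hb f
  have e0 : f = -(C.kpa * (α - abar) + C.kda * y) + P.M * P.g * Real.cos α := by
    rw [hf]; unfold ft; ring
  -- The part w of the error may be large. It multiplies the desired force by cos w and adds a
  -- bounded multiple of the orthogonal thrust; only z is treated as a Lipschitz perturbation of the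
  -- sine, which costs the whole thrust c + |f|.
  have e1 := u1_mul_sin_add P C f (-w)
  rw [Real.cos_neg, Real.sin_neg, ← sub_eq_add_neg] at e1
  have e2 : u1 P C f * Real.sin (thetaBar P C f - w + z) + P.M * Real.sin α * ax
      - P.M * P.g * Real.cos α + (C.kpa * (α - abar) + C.kda * y) * Real.cos w
      = u1 P C f * (Real.sin (thetaBar P C f - w + z) - Real.sin (thetaBar P C f - w))
        + P.M * P.g * Real.cos α * Real.cos w
        - u1 P C f * Real.cos (thetaBar P C f) * Real.sin w + P.M * ax * Real.sin α
        - P.M * P.g * Real.cos α := by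
    have : (C.kpa * (α - abar) + C.kda * y) = P.M * P.g * Real.cos α - f := by rw [e0]; ring
    rw [this, mul_sub, e1]; ring
  rw [e2]
  have hsin : |Real.sin (thetaBar P C f - w + z) - Real.sin (thetaBar P C f - w)| ≤ |z| := by
    have h := Convex.norm_image_sub_le_of_norm_deriv_le (f := Real.sin) (C := 1) (s := univ)
      (x := thetaBar P C f - w) (y := thetaBar P C f - w + z)
      (fun x _ => Real.differentiable_sin x)
      (fun x _ => by rw [Real.deriv_sin]; exact Real.abs_cos_le_one x) convex_univ
      (mem_univ _) (mem_univ _)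
    simpa using h
  have b1 : |u1 P C f * (Real.sin (thetaBar P C f - w + z) - Real.sin (thetaBar P C f - w))|
      ≤ (c + |f|) * |z| := by
    rw [abs_mul, abs_of_nonneg hu.1]
    exact mul_le_mul hu.2.1 hsin (abs_nonneg _) (by positivity)
  have hMg : |P.M * P.g| = P.M * P.g := abs_of_pos (by positivity)
  have b2 : |P.M * P.g * Real.cos α * Real.cos w| ≤ P.M * P.g :=
    (abs_mul_cos_le _ _).trans ((abs_mul_cos_le _ _).trans hMg.le)
  have b3 : |u1 P C f * Real.cos (thetaBar P C f) * Real.sin w| ≤ c :=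
    (abs_mul_sin_le _ _).trans hu.2.2
  have b4 : |P.M * ax * Real.sin α| ≤ P.M * |ax| := by
    refine (abs_mul_sin_le _ _).trans ?_
    rw [abs_mul, abs_of_pos hM]
  have b5 : |P.M * P.g * Real.cos α| ≤ P.M * P.g := (abs_mul_cos_le _ _).trans hMg.le
  have hz := abs_nonneg z
  have hx := abs_nonneg ax
  have hR : (c + |f|) * |z| + P.M * P.g + c + P.M * |ax| + P.M * P.g
      ≤ (c + 2 * (P.M * P.g) + P.M) * (1 + |ax| + |z|) + |f| * |z| := by
    nlinarith [mul_nonneg hM.le hz, mul_nonneg (mul_pos hM hg).le hz,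
      mul_nonneg (mul_pos hM hg).le hx, mul_nonneg hc.le hx]
  refine le_trans ?_ hR
  rw [abs_le] at *
  constructor <;> linarith [b1.1, b1.2, b2.1, b2.2, b3.1, b3.2, b4.1, b4.2, b5.1, b5.2]

end actuator

/-! ### Strict Lyapunov functions -/

section lyapunov

variable {E : Type*} [NormedAddCommGroup E] {V D : E → ℝ}

lemma exists_level_of_pos (hV : Continuous V) (hpos : ∀ x, x ≠ 0 → 0 < V x)
    (hcpt : ∀ c, IsCompact {x | V x ≤ c}) {r : ℝ} (hr : 0 < r) :
    ∃ η : ℝ, 0 < η ∧ ∀ x, V x < η → ‖x‖ < r := by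
  have hK : IsCompact ({x | V x ≤ 1} ∩ {x | r ≤ ‖x‖}) :=
    (hcpt 1).inter_right (isClosed_le continuous_const continuous_norm)
  rcases Set.eq_empty_or_nonempty ({x | V x ≤ 1} ∩ {x | r ≤ ‖x‖}) with h | h
  · refine ⟨1, one_pos, fun x hx => ?_⟩
    by_contra hn
    exact (h ▸ (⟨hx.le, not_lt.mp hn⟩ : x ∈ {x | V x ≤ 1} ∩ {x | r ≤ ‖x‖}) : x ∈ (∅ : Set E))
  · obtain ⟨x₀, hx₀, hmin⟩ := hK.exists_isMinOn h hV.continuousOn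
    have h0 : x₀ ≠ 0 := by
      rintro rfl
      have h2 : r ≤ ‖(0 : E)‖ := hx₀.2
      rw [norm_zero] at h2
      linarith
    refine ⟨min 1 (V x₀), lt_min one_pos (hpos _ h0), fun x hx => ?_⟩
    by_contra hn
    have := hmin (show x ∈ {x | V x ≤ 1} ∩ {x | r ≤ ‖x‖} from
      ⟨hx.le.trans (min_le_left _ _), not_lt.mp hn⟩)
    exact absurd (hx.trans_le (min_le_right _ _)) (not_lt.mpr this)

lemma antitone_of_deriv_right_nonpos {g g' : ℝ → ℝ} (hcont : ContinuousOn g (Ici 0))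
    (hg : ∀ t, 0 ≤ t → HasDerivWithinAt g (g' t) (Ici t) t) {c : ℝ} (h : ∀ t, 0 ≤ t → g' t ≤ -c)
    {s t : ℝ} (hs : 0 ≤ s) (hst : s ≤ t) : g t ≤ g s - c * (t - s) := by
  have hB : ∀ x, HasDerivAt (fun x => g s - c * (x - s)) (-c) x := fun x => by
    simpa using (((hasDerivAt_id x).sub_const s).const_mul c).const_sub (g s)
  exact image_le_of_deriv_right_le_deriv_boundary (f := g) (f' := g') (a := s) (b := t)
    (B := fun x => g s - c * (x - s)) (B' := fun _ => -c)
    (hcont.mono (Icc_subset_Ici_self.trans (Ici_subset_Ici.mpr hs)))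
    (fun x hx => hg x (hs.trans hx.1)) (by simp)
    (by fun_prop) (fun x _ => (hB x).hasDerivWithinAt) (fun x hx => h x (hs.trans hx.1))
    (right_mem_Icc.mpr hst)

lemma stable_of_lyapunov (hV : Continuous V) (hV0 : V 0 = 0) (hpos : ∀ x, x ≠ 0 → 0 < V x)
    (hcpt : ∀ c, IsCompact {x | V x ≤ c}) {r : ℝ} (hr : 0 < r) :
    ∃ δ : ℝ, 0 < δ ∧ ∀ (X : ℝ → E) (φ : ℝ → ℝ), ContinuousOn X (Ici 0) →
      (∀ t, 0 ≤ t → HasDerivWithinAt (fun s => V (X s)) (φ t) (Ici t) t) →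
      (∀ t, 0 ≤ t → φ t ≤ 0) → ‖X 0‖ < δ → ∀ t, 0 ≤ t → ‖X t‖ < r := by
  obtain ⟨η, hη, h⟩ := exists_level_of_pos hV hpos hcpt hr
  have hnhds : ∀ᶠ x in 𝓝 (0 : E), V x < η :=
    hV.continuousAt.eventually (by rw [hV0]; exact eventually_lt_nhds hη)
  obtain ⟨δ, hδ, hb⟩ := Metric.eventually_nhds_iff.mp hnhds
  refine ⟨δ, hδ, fun X φ hX hd hφ h0 t ht => h _ ?_⟩
  have := antitone_of_deriv_right_nonpos (hV.comp_continuousOn hX) hd (c := 0)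
    (fun t ht => by simpa using hφ t ht) le_rfl ht
  simp only [Function.comp] at this
  have h1 := hb (y := X 0) (by simpa using h0)
  linarith

/-- If V never fell below η, the trajectory would stay in the compact shell η ≤ V ≤ V (X 0), where D
has a positive minimum c. At time V (X 0) / c the value of V would then be at most zero. -/
lemma tendsto_zero_of_lyapunov (hV : Continuous V) (hV0 : V 0 = 0) (hpos : ∀ x, x ≠ 0 → 0 < V x)
    (hcpt : ∀ c, IsCompact {x | V x ≤ c}) (hD : Continuous D) (hDnn : ∀ x, 0 ≤ D x)
    (hDpos : ∀ x, x ≠ 0 → 0 < D x) {X : ℝ → E} {φ : ℝ → ℝ} (hX : ContinuousOn X (Ici 0))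
    (hd : ∀ t, 0 ≤ t → HasDerivWithinAt (fun s => V (X s)) (φ t) (Ici t) t)
    (hφ : ∀ t, 0 ≤ t → φ t ≤ -D (X t)) : Tendsto X atTop (𝓝 0) := by
  have hanti : ∀ s t, 0 ≤ s → s ≤ t → V (X t) ≤ V (X s) := fun s t hs hst => by
    have := antitone_of_deriv_right_nonpos (hV.comp_continuousOn hX) hd (c := 0)
      (fun t ht => by linarith [hφ t ht, hDnn (X t)]) hs hst
    simp only [Function.comp] at this
    linarith
  rw [Metric.tendsto_atTop]
  intro r hr
  obtain ⟨η, hη, h⟩ := exists_level_of_pos hV hpos hcpt hr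
  suffices hT : ∃ T, 0 ≤ T ∧ V (X T) < η by
    obtain ⟨T, hT0, hT⟩ := hT
    exact ⟨T, fun t ht => by simpa using h _ ((hanti T t hT0 ht).trans_lt hT)⟩
  by_contra! hn
  have hK : IsCompact ({x | V x ≤ V (X 0)} ∩ {x | η ≤ V x}) :=
    (hcpt _).inter_right (isClosed_le continuous_const hV)
  have hmem : ∀ t, 0 ≤ t → X t ∈ {x | V x ≤ V (X 0)} ∩ {x | η ≤ V x} :=
    fun t ht => ⟨hanti 0 t le_rfl ht, hn t ht⟩
  obtain ⟨x₀, hx₀, hmin⟩ := hK.exists_isMinOn ⟨_, hmem 0 le_rfl⟩ hD.continuousOn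
  have hx0 : x₀ ≠ 0 := by
    rintro rfl
    have h2 : η ≤ V 0 := hx₀.2
    linarith
  have hc := hDpos _ hx0
  set c := D x₀
  set T := (V (X 0) / c) with hTdef
  have hV00 : 0 ≤ V (X 0) := hη.le.trans (hn 0 le_rfl)
  have hT0 : 0 ≤ T := div_nonneg hV00 hc.le
  have := antitone_of_deriv_right_nonpos (hV.comp_continuousOn hX) hd (c := c)
      (fun t ht => by
        have h1 : c ≤ D (X t) := hmin (hmem t ht)
        linarith [hφ t ht]) le_rfl hT0
  have h2 : c * (T - 0) = V (X 0) := by rw [hTdef, sub_zero]; field_simp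
  have h3 := hn T hT0
  simp only [Function.comp] at this
  linarith

end lyapunov

/-! ### Primitive of the saturation -/

/-- Primitive of `sat l` vanishing at `0`. -/
noncomputable def satPrim (l r : ℝ) : ℝ := r * sat l r - sat l r ^ 2 / 2

section satPrim

variable {l : ℝ}

/-- The saturation is the projection onto [-l, l], and this is its variational inequality. It yields
convexity of the primitive. -/
lemma sat_proj (hl : 0 < l) (x y : ℝ) : 0 ≤ (sat l x - sat l y) * (x - sat l x) := by
  have hy := abs_le.mp (abs_sat_le hl y)
  rcases le_total |x| l with h | h
  · rw [sat_of_abs_le hl h]; simp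
  · rcases le_abs.mp h with h | h
    · rw [sat_of_le hl h]; exact mul_nonneg (by linarith) (by linarith)
    · rw [sat_of_le_neg hl (by linarith)]
      exact mul_nonneg_of_nonpos_of_nonpos (by linarith) (by linarith)

lemma satPrim_convex (hl : 0 < l) (x y : ℝ) : sat l y * (x - y) ≤ satPrim l x - satPrim l y := by
  have := sat_proj hl x y
  unfold satPrim
  nlinarith [sq_nonneg (sat l x - sat l y)]

/-- The convexity inequality, applied from both end points, places the remainder between 0 and (sat
x - sat r)(x - r) ≤ (x - r)². -/
lemma hasDerivAt_satPrim (hl : 0 < l) (r : ℝ) : HasDerivAt (satPrim l) (sat l r) r := by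
  rw [hasDerivAt_iff_isLittleO]
  have h2 : (fun x : ℝ => (x - r) ^ 2) =o[𝓝 r] fun x => x - r := by
    have h3 : Tendsto (fun x : ℝ => x - r) (𝓝 r) (𝓝 0) := by
      have : Continuous fun x : ℝ => x - r := by fun_prop
      simpa using this.tendsto r
    simpa [Function.comp_def] using (Asymptotics.isLittleO_pow_id (𝕜 := ℝ) one_lt_two).comp_tendsto h3
  refine (Asymptotics.IsBigO.of_bound 1 (Eventually.of_forall fun x => ?_)).trans_isLittleO h2
  have a1 := satPrim_convex hl x r
  have a2 := satPrim_convex hl r x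
  have a3 := abs_sat_sub_le hl x r
  have a4 : (sat l x - sat l r) * (x - r) ≤ (x - r) ^ 2 := by
    calc _ ≤ |(sat l x - sat l r) * (x - r)| := le_abs_self _
      _ = |sat l x - sat l r| * |x - r| := abs_mul _ _
      _ ≤ |x - r| * |x - r| := mul_le_mul_of_nonneg_right a3 (abs_nonneg _)
      _ = _ := by rw [← sq, sq_abs]
  rw [one_mul, Real.norm_eq_abs, Real.norm_eq_abs, abs_of_nonneg (sq_nonneg (x - r)), smul_eq_mul,
    abs_of_nonneg (by linarith)]
  linarith

lemma sq_sat_le_satPrim (hl : 0 < l) (r : ℝ) : sat l r ^ 2 / 2 ≤ satPrim l r := by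
  have := sat_proj hl r 0
  rw [sat_zero] at this
  unfold satPrim
  nlinarith

lemma mul_abs_le_satPrim (hl : 0 < l) (r : ℝ) : l * |r| - l ^ 2 / 2 ≤ satPrim l r := by
  unfold satPrim
  rcases le_total |r| l with h | h
  · rw [sat_of_abs_le hl h]; nlinarith [sq_abs r, sq_nonneg (|r| - l)]
  · rcases le_abs.mp h with h | h
    · rw [sat_of_le hl h, abs_of_nonneg (by linarith)]; linarith
    · rw [sat_of_le_neg hl (by linarith), abs_of_nonpos (by linarith)]; linarith

lemma sat_ne_zero (hl : 0 < l) {r : ℝ} (hr : r ≠ 0) : sat l r ≠ 0 := by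
  rcases le_total |r| l with h | h
  · rwa [sat_of_abs_le hl h]
  · rcases le_abs.mp h with h | h
    · rw [sat_of_le hl h]; exact hl.ne'
    · rw [sat_of_le_neg hl (by linarith)]; linarith

lemma continuous_satPrim (hl : 0 < l) : Continuous (satPrim l) :=
  continuous_iff_continuousAt.mpr fun r => (hasDerivAt_satPrim hl r).continuousAt

lemma sat_sat {l₁ l₂ : ℝ} (h1 : 0 < l₁) (h2 : 0 < l₂) (x : ℝ) :
    sat l₁ (sat l₂ x) = sat (min l₁ l₂) x := by
  have h := lt_min h1 h2
  rcases le_total |x| (min l₁ l₂) with hx | hx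
  · rw [sat_of_abs_le h hx, sat_of_abs_le h2 (hx.trans (min_le_right _ _)),
      sat_of_abs_le h1 (hx.trans (min_le_left _ _))]
  · rcases le_abs.mp hx with hx | hx
    · rw [sat_of_le h hx]
      rcases le_total l₁ l₂ with h12 | h12
      · rw [min_eq_left h12] at hx ⊢
        apply sat_of_le h1
        rw [← sat_of_abs_le h2 (show |l₁| ≤ l₂ by rwa [abs_of_pos h1])]
        exact sat_mono h2 hx
      · rw [min_eq_right h12] at hx ⊢
        rw [sat_of_le h2 hx, sat_of_abs_le h1 (by rwa [abs_of_pos h2])]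
    · have hx : x ≤ -min l₁ l₂ := by linarith
      rw [sat_of_le_neg h hx]
      rcases le_total l₁ l₂ with h12 | h12
      · rw [min_eq_left h12] at hx ⊢
        apply sat_of_le_neg h1
        rw [← sat_of_abs_le h2 (show |-l₁| ≤ l₂ by rwa [abs_neg, abs_of_pos h1])]
        exact sat_mono h2 hx
      · rw [min_eq_right h12] at hx ⊢
        rw [sat_of_le_neg h2 hx, sat_of_abs_le h1 (by rwa [abs_neg, abs_of_pos h2])]

end satPrim

/-! ### The cart -/

section cart

variable (P : Plant) (C : Tuning)

/-- Weight of the energy in the Lyapunov function of the cart. -/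
noncomputable def cartWeight : ℝ := C.kpx + 1 + 4 * C.kpx * C.kdx ^ 2 / P.mc

/-- Strict Lyapunov function of the cart with nested saturated feedback. -/
noncomputable def cartLyap (w : ℝ × ℝ) : ℝ :=
  cartWeight P C * (P.mc * w.2 ^ 2 / 2 + satPrim (min C.lam1 C.lam2) (C.kpx * w.1) / C.kpx)
    + (satPrim C.lam1 (C.kdx * w.2 + sat C.lam2 (C.kpx * w.1))
      - satPrim C.lam1 (sat C.lam2 (C.kpx * w.1)))

/-- Dissipation rate of `cartLyap`. -/
noncomputable def cartDiss (w : ℝ × ℝ) : ℝ :=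
  C.kdx / P.mc * sat C.lam1 (C.kdx * w.2 + sat C.lam2 (C.kpx * w.1)) ^ 2
    + w.2 * (sat C.lam1 (C.kdx * w.2 + sat C.lam2 (C.kpx * w.1))
      - sat C.lam1 (sat C.lam2 (C.kpx * w.1)))

lemma mul_sat_add_sub_nonneg (v φ : ℝ) :
    0 ≤ v * (sat C.lam1 (C.kdx * v + φ) - sat C.lam1 φ) := by
  rcases le_total 0 v with h | h
  · exact mul_nonneg h (sub_nonneg.mpr (sat_mono C.lam1_pos
      (by have := mul_nonneg C.kdx_pos.le h; linarith)))
  · exact mul_nonneg_of_nonpos_of_nonpos h (sub_nonpos.mpr (sat_mono C.lam1_pos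
      (by have := mul_nonpos_of_nonneg_of_nonpos C.kdx_pos.le h; linarith)))

lemma cartDiss_nonneg (w : ℝ × ℝ) : 0 ≤ cartDiss P C w := by
  have := mul_sat_add_sub_nonneg C w.2 (sat C.lam2 (C.kpx * w.1))
  have := C.kdx_pos
  have := P.mc_pos
  unfold cartDiss; positivity

/-- The first term vanishes only where the inner saturation balances the damping. There the velocity
is nonzero unless the state is zero, and the second term becomes v · sat(k_d v) > 0. Strictness
makes an invariance principle unnecessary. -/
lemma cartDiss_pos {w : ℝ × ℝ} (hw : w ≠ 0) : 0 < cartDiss P C w := by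
  have hn := mul_sat_add_sub_nonneg C w.2 (sat C.lam2 (C.kpx * w.1))
  have hk := C.kdx_pos
  have hm := P.mc_pos
  by_cases hs : C.kdx * w.2 + sat C.lam2 (C.kpx * w.1) = 0
  · have hφ : sat C.lam2 (C.kpx * w.1) = -(C.kdx * w.2) := by linarith
    have hv : w.2 ≠ 0 := by
      intro hv
      apply hw
      by_cases h1 : w.1 = 0
      · exact Prod.ext h1 hv
      · exact absurd (by rw [hφ, hv]; simp)
          (sat_ne_zero C.lam2_pos (mul_ne_zero C.kpx_pos.ne' h1))
    have hne := sat_ne_zero C.lam1_pos (mul_ne_zero hk.ne' hv)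
    unfold cartDiss
    rw [hs, hφ, sat_zero] at hn ⊢
    have hodd : sat C.lam1 (-(C.kdx * w.2)) = -sat C.lam1 (C.kdx * w.2) := by
      simp [sat, Real.sign_neg]
    have : w.2 * (0 - sat C.lam1 (-(C.kdx * w.2))) ≠ 0 := by
      rw [hodd]; exact mul_ne_zero hv (by simpa using hne)
    have := lt_of_le_of_ne hn this.symm
    simpa using this
  · have := pow_pos (abs_pos.mpr (sat_ne_zero C.lam1_pos hs)) 2
    rw [sq_abs] at this
    unfold cartDiss; positivity

lemma continuous_cartDiss : Continuous (cartDiss P C) := by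
  have h1 := sat_continuous C.lam1_pos
  have h2 := sat_continuous C.lam2_pos
  unfold cartDiss; fun_prop

lemma continuous_cartLyap : Continuous (cartLyap P C) := by
  have h1 := continuous_satPrim C.lam1_pos
  have h2 := sat_continuous C.lam2_pos
  have h3 := continuous_satPrim (lt_min C.lam1_pos C.lam2_pos)
  unfold cartLyap; fun_prop

lemma cartWeight_pos : 0 < cartWeight P C := by
  have := C.kpx_pos
  have := P.mc_pos
  unfold cartWeight; positivity

/-- By convexity the difference of primitives is at least σ k_d v, with σ the saturated position.
The last summand of `cartWeight` is large enough for half of the weighted energy to absorb this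
product. -/
lemma le_cartLyap (w : ℝ × ℝ) :
    cartWeight P C * P.mc / 4 * w.2 ^ 2
      + cartWeight P C / 2 * (satPrim (min C.lam1 C.lam2) (C.kpx * w.1) / C.kpx)
      ≤ cartLyap P C w := by
  have hN := cartWeight_pos P C
  have hm := P.mc_pos
  have hk := C.kpx_pos
  have hd := C.kdx_pos
  have hl := lt_min C.lam1_pos C.lam2_pos
  have h1 := satPrim_convex C.lam1_pos (C.kdx * w.2 + sat C.lam2 (C.kpx * w.1))
    (sat C.lam2 (C.kpx * w.1))
  rw [sat_sat C.lam1_pos C.lam2_pos, add_sub_cancel_right] at h1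
  have h2 := sq_sat_le_satPrim hl (C.kpx * w.1)
  have hN2 : 4 * C.kpx * C.kdx ^ 2 ≤ cartWeight P C ^ 2 * P.mc := by
    have e : cartWeight P C * P.mc = (C.kpx + 1) * P.mc + 4 * C.kpx * C.kdx ^ 2 := by
      unfold cartWeight; field_simp
    have : 1 ≤ cartWeight P C := by
      have : 0 ≤ 4 * C.kpx * C.kdx ^ 2 / P.mc := by positivity
      unfold cartWeight; linarith
    have h3 : 4 * C.kpx * C.kdx ^ 2 ≤ cartWeight P C * P.mc := by rw [e]; nlinarith
    nlinarith [mul_le_mul_of_nonneg_right this (mul_pos hN hm).le]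
  unfold cartLyap
  set N := cartWeight P C
  set σ := sat (min C.lam1 C.lam2) (C.kpx * w.1)
  set Q := satPrim (min C.lam1 C.lam2) (C.kpx * w.1)
  have h4 : -(N * P.mc / 4 * w.2 ^ 2 + N / 2 * (Q / C.kpx)) ≤ σ * (C.kdx * w.2) := by
    have e : N * P.mc / 4 * w.2 ^ 2 + C.kdx ^ 2 * σ ^ 2 / (N * P.mc) + σ * (C.kdx * w.2)
        = (N * P.mc * w.2 + 2 * C.kdx * σ) ^ 2 / (4 * (N * P.mc)) := by
      field_simp; ring
    have e0 : 0 ≤ (N * P.mc * w.2 + 2 * C.kdx * σ) ^ 2 / (4 * (N * P.mc)) := by positivity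
    have : C.kdx ^ 2 * σ ^ 2 / (N * P.mc) ≤ N / 2 * (Q / C.kpx) := by
      rw [← mul_div_assoc, div_le_div_iff₀ (by positivity) hk]
      have hS : 0 ≤ Q := le_trans (by positivity) h2
      calc C.kdx ^ 2 * σ ^ 2 * C.kpx ≤ C.kdx ^ 2 * (2 * Q) * C.kpx := by
            gcongr; linarith
        _ = (4 * C.kpx * C.kdx ^ 2) * (Q / 2) := by ring
        _ ≤ (N ^ 2 * P.mc) * (Q / 2) := by gcongr
        _ = _ := by ring
    linarith
  linarith

lemma cartLyap_zero : cartLyap P C 0 = 0 := by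
  simp [cartLyap, satPrim, sat_zero]

lemma cartLyap_pos {w : ℝ × ℝ} (hw : w ≠ 0) : 0 < cartLyap P C w := by
  have hN := cartWeight_pos P C
  have hm := P.mc_pos
  have hk := C.kpx_pos
  have hl := lt_min C.lam1_pos C.lam2_pos
  refine lt_of_lt_of_le ?_ (le_cartLyap P C w)
  have h2 := sq_sat_le_satPrim hl (C.kpx * w.1)
  by_cases h1 : w.1 = 0
  · have hv : w.2 ≠ 0 := fun hv => hw (Prod.ext h1 hv)
    have : 0 ≤ satPrim (min C.lam1 C.lam2) (C.kpx * w.1) := le_trans (by positivity) h2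
    positivity
  · have h3 := sat_ne_zero hl (mul_ne_zero hk.ne' h1)
    have : 0 < satPrim (min C.lam1 C.lam2) (C.kpx * w.1) := lt_of_lt_of_le (by positivity) h2
    positivity

lemma isCompact_cartLyap_le (c : ℝ) : IsCompact {w | cartLyap P C w ≤ c} := by
  have hN := cartWeight_pos P C
  have hm := P.mc_pos
  have hk := C.kpx_pos
  have hl := lt_min C.lam1_pos C.lam2_pos
  refine Metric.isCompact_of_isClosed_isBounded
    (isClosed_le (continuous_cartLyap P C) continuous_const) ?_
  rw [isBounded_iff_forall_norm_le]
  set l := min C.lam1 C.lam2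
  set N := cartWeight P C with hNdef
  refine ⟨max ((c * C.kpx * 2 / N + l ^ 2 / 2) / l / C.kpx) (c * (4 / (N * P.mc)) + 1),
    fun w hw => ?_⟩
  have hw : cartLyap P C w ≤ c := hw
  have h1 := (le_cartLyap P C w).trans hw
  have h2 := sq_sat_le_satPrim hl (C.kpx * w.1)
  have h3 := mul_abs_le_satPrim hl (C.kpx * w.1)
  have h4 : 0 ≤ satPrim l (C.kpx * w.1) := le_trans (by positivity) h2
  rw [← hNdef] at h1
  rw [Prod.norm_def]
  refine max_le_max ?_ ?_
  · have h5 : N / 2 * (satPrim l (C.kpx * w.1) / C.kpx) ≤ c := by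
      have : 0 ≤ N * P.mc / 4 * w.2 ^ 2 := by positivity
      linarith
    have h6 : satPrim l (C.kpx * w.1) ≤ c * C.kpx * 2 / N := by
      rw [le_div_iff₀ hN]
      have := mul_le_mul_of_nonneg_right h5 (show 0 ≤ C.kpx * 2 by positivity)
      have e : N / 2 * (satPrim l (C.kpx * w.1) / C.kpx) * (C.kpx * 2)
        = satPrim l (C.kpx * w.1) * N := by field_simp
      linarith
    rw [Real.norm_eq_abs, le_div_iff₀ hk, le_div_iff₀ hl]
    rw [abs_mul, abs_of_pos hk] at h3
    nlinarith
  · have h5 : N * P.mc / 4 * w.2 ^ 2 ≤ c := by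
      have : 0 ≤ N / 2 * (satPrim l (C.kpx * w.1) / C.kpx) := by positivity
      linarith
    have h6 : w.2 ^ 2 ≤ c * (4 / (N * P.mc)) := by
      rw [← mul_div_assoc, le_div_iff₀ (by positivity)]
      nlinarith
    rw [Real.norm_eq_abs]
    nlinarith [sq_abs w.2, sq_nonneg (|w.2| - 1)]

lemma exists_hasDerivWithinAt_cartLyap {ξ v : ℝ → ℝ} {t : ℝ}
    (hξ : HasDerivWithinAt ξ (v t) (Ici t) t)
    (hv : HasDerivWithinAt v (-sat C.lam1 (C.kdx * v t + sat C.lam2 (C.kpx * ξ t)) / P.mc)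
      (Ici t) t) :
    ∃ d, HasDerivWithinAt (fun s => cartLyap P C (ξ s, v s)) d (Ici t) t ∧
      d ≤ -cartDiss P C (ξ t, v t) := by
  have hm := P.mc_pos
  have hk := C.kpx_pos
  have hl := lt_min C.lam1_pos C.lam2_pos
  have hkξ := hξ.const_mul C.kpx
  obtain ⟨d, d0, d1, hφ, -⟩ := exists_hasDerivWithinAt_sat C.lam2_pos hkξ
  have hs := (hv.const_mul C.kdx).fun_add hφ
  have hA := (hasDerivAt_satPrim hl (C.kpx * ξ t)).comp_hasDerivWithinAt t hkξ
  have hB := (hasDerivAt_satPrim C.lam1_pos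
    (C.kdx * v t + sat C.lam2 (C.kpx * ξ t))).comp_hasDerivWithinAt t hs
  have hC := (hasDerivAt_satPrim C.lam1_pos
    (sat C.lam2 (C.kpx * ξ t))).comp_hasDerivWithinAt t hφ
  refine ⟨_, ((((hv.fun_pow 2).const_mul P.mc).div_const 2).fun_add
    (hA.div_const C.kpx)).const_mul (cartWeight P C) |>.fun_add (hB.fun_sub hC), ?_⟩
  have hnn := mul_sat_add_sub_nonneg C (v t) (sat C.lam2 (C.kpx * ξ t))
  rw [← sat_sat C.lam1_pos C.lam2_pos]
  unfold cartDiss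
  simp only
  set σs := sat C.lam1 (C.kdx * v t + sat C.lam2 (C.kpx * ξ t))
  set σφ := sat C.lam1 (sat C.lam2 (C.kpx * ξ t))
  have hN : C.kpx + 1 ≤ cartWeight P C := by
    have := C.kdx_pos
    have : 0 ≤ 4 * C.kpx * C.kdx ^ 2 / P.mc := by positivity
    unfold cartWeight; linarith
  -- The slope d of the inner saturation is unknown in [0, 1], but it enters only through d k_p v
  -- (σs - σφ), a nonnegative quantity that the energy dissipates with the weight `cartWeight` ≥ k_p
  -- + 1.
  have e : cartWeight P C * (P.mc * ((2 : ℕ) * v t ^ (2 - 1) * (-σs / P.mc)) / 2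
      + σφ * (C.kpx * v t) / C.kpx)
      + (σs * (C.kdx * (-σs / P.mc) + d * (C.kpx * v t)) - σφ * (d * (C.kpx * v t)))
      = -(C.kdx / P.mc * σs ^ 2) - (cartWeight P C - d * C.kpx) * (v t * (σs - σφ)) := by
    field_simp; push_cast; ring
  rw [e]
  have : 1 ≤ cartWeight P C - d * C.kpx := by nlinarith
  nlinarith

variable {P C} in
/-- Trajectories of the cart are trajectories of the shifted dissipative system. -/
lemma cart_right_deriv {xbar : ℝ} {x v : ℝ → ℝ}
    (hx : ∀ t, 0 ≤ t → HasDerivWithinAt x (v t) (Ici 0) t)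
    (hv : ∀ t, 0 ≤ t → HasDerivWithinAt v (u3 C xbar (x t) (v t) / P.mc) (Ici 0) t) :
    ContinuousOn (fun t => (x t - xbar, v t)) (Ici 0) ∧
    ∃ φ : ℝ → ℝ, ∀ t, 0 ≤ t →
      HasDerivWithinAt (fun s => cartLyap P C (x s - xbar, v s)) (φ t) (Ici t) t ∧
      φ t ≤ -cartDiss P C (x t - xbar, v t) := by
  refine ⟨?_, ?_⟩
  · have hxc : ContinuousOn x (Ici 0) := fun t ht => (hx t ht).continuousWithinAt
    exact ContinuousOn.prodMk (hxc.sub continuousOn_const)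
      (fun t ht => (hv t ht).continuousWithinAt)
  · have h : ∀ t, ∃ d, 0 ≤ t →
      HasDerivWithinAt (fun s => cartLyap P C (x s - xbar, v s)) d (Ici t) t ∧
      d ≤ -cartDiss P C (x t - xbar, v t) := by
      intro t
      by_cases ht : 0 ≤ t
      · obtain ⟨d, hd⟩ := exists_hasDerivWithinAt_cartLyap P C (ξ := fun s => x s - xbar) (v := v)
          (t := t) (((hx t ht).mono (Ici_subset_Ici.mpr ht)).sub_const xbar)
          ((hv t ht).mono (Ici_subset_Ici.mpr ht))
        exact ⟨d, fun _ => hd⟩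
      · exact ⟨0, fun h => absurd h ht⟩
    choose φ hφ using h
    exact ⟨φ, hφ⟩

lemma cart_stable (xbar : ℝ) {r : ℝ} (hr : 0 < r) :
    ∃ δ : ℝ, 0 < δ ∧ ∀ x v : ℝ → ℝ,
      (∀ t, 0 ≤ t → HasDerivWithinAt x (v t) (Ici 0) t) →
      (∀ t, 0 ≤ t → HasDerivWithinAt v (u3 C xbar (x t) (v t) / P.mc) (Ici 0) t) →
      |x 0 - xbar| < δ → |v 0| < δ → ∀ t, 0 ≤ t → |x t - xbar| < r ∧ |v t| < r := by
  obtain ⟨δ, hδ, h⟩ := stable_of_lyapunov (continuous_cartLyap P C) (cartLyap_zero P C)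
    (fun _ => cartLyap_pos P C) (isCompact_cartLyap_le P C) hr
  refine ⟨δ, hδ, fun x v hx hv h1 h2 t ht => ?_⟩
  obtain ⟨hc, φ, hφ⟩ := cart_right_deriv hx hv
  have := h _ φ hc (fun t ht => (hφ t ht).1)
    (fun t ht => (hφ t ht).2.trans (neg_nonpos.mpr (cartDiss_nonneg P C _)))
    (by rw [Prod.norm_def]; exact max_lt h1 h2) t ht
  rw [Prod.norm_def, max_lt_iff] at this
  exact this

lemma cart_tendsto {xbar : ℝ} {x v : ℝ → ℝ}
    (hx : ∀ t, 0 ≤ t → HasDerivWithinAt x (v t) (Ici 0) t)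
    (hv : ∀ t, 0 ≤ t → HasDerivWithinAt v (u3 C xbar (x t) (v t) / P.mc) (Ici 0) t) :
    Tendsto x atTop (𝓝 xbar) ∧ Tendsto v atTop (𝓝 0) := by
  obtain ⟨hc, φ, hφ⟩ := cart_right_deriv hx hv
  have h := tendsto_zero_of_lyapunov (continuous_cartLyap P C) (cartLyap_zero P C)
    (fun _ => cartLyap_pos P C) (isCompact_cartLyap_le P C) (continuous_cartDiss P C)
    (cartDiss_nonneg P C) (fun _ => cartDiss_pos P C) hc (fun t ht => (hφ t ht).1)
    (fun t ht => (hφ t ht).2)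
  rw [Prod.zero_eq_mk, nhds_prod_eq, tendsto_prod_iff'] at h
  refine ⟨?_, h.2⟩
  simpa using h.1.add_const xbar

lemma abs_u3_le (xbar x v : ℝ) : |u3 C xbar x v| ≤ C.lam1 := by
  unfold u3
  rw [abs_neg]; exact abs_sat_le C.lam1_pos _

lemma abs_u3_le_linear (xbar x v : ℝ) :
    |u3 C xbar x v| ≤ C.kdx * |v| + C.kpx * |x - xbar| := by
  unfold u3
  rw [abs_neg]
  have h1 := abs_sat_sub_le C.lam1_pos (C.kdx * v + sat C.lam2 (C.kpx * (x - xbar))) 0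
  have h2 := abs_sat_sub_le C.lam2_pos (C.kpx * (x - xbar)) 0
  simp only [sat_zero, sub_zero] at h1 h2
  have h3 := abs_add_le (C.kdx * v) (sat C.lam2 (C.kpx * (x - xbar)))
  rw [abs_mul, abs_of_pos C.kdx_pos] at h3
  rw [abs_mul, abs_of_pos C.kpx_pos] at h2
  linarith

end cart

/-! ### The gain of the attitude loop -/

section gammaIn

variable (P : Plant) {kp kd : ℝ}

/-- The input is the perturbation p = -w in `quad_deriv_le`. Against |w| ≤ R the function settles
below (25/4 + 1) R²/μ², where 1 is the slack, and e² is at most 4/3 of this, which is less than 16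
R²/μ². -/
lemma gammaIn_le {μ : ℝ} (hμ : 0 < μ) (ha : 4 * μ ≤ kd / P.Iu)
    (hb : 4 * μ * (kd / P.Iu) ≤ kp / P.Iu) :
    gammaIn P kp kd ≤ ENNReal.ofReal (4 / μ) := by
  have hI := P.Iu_pos
  refine sInf_le fun w e v hw he hv => ?_
  refine asymptoticGainBound_of_eventually (by positivity) fun R hR hwR => ?_
  obtain ⟨T₀, hT₀⟩ := eventually_atTop.mp hwR
  set T := max T₀ 0
  have hT : 0 ≤ T := le_max_right _ _
  set a := kd / P.Iu with ha'
  set b := kp / P.Iu with hb'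
  have hsub : ∀ t, T ≤ t → Ici t ⊆ Ici (0 : ℝ) := fun t ht => Ici_subset_Ici.mpr (hT.trans ht)
  have ab0 : 0 < a * b := by
    have := sixteen_mul_sq_le hμ ha hb
    have h1 : 0 < a := by linarith
    have h2 : 0 < b := by nlinarith [pow_pos hμ 2]
    positivity
  have hq : ∀ t, u2 kp kd (e t) (v t) / P.Iu = -b * e t - a * v t + 0 := fun t => by
    rw [ha', hb']; unfold u2; field_simp; ring
  have hec : ContinuousOn e (Ici T) :=
    fun t ht => ((he t (hT.trans ht)).continuousWithinAt).mono (Ici_subset_Ici.mpr hT)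
  have hvc : ContinuousOn v (Ici T) :=
    fun t ht => ((hv t (hT.trans ht)).continuousWithinAt).mono (Ici_subset_Ici.mpr hT)
  have key := eventually_le_of_deriv_right_le (T := T) (c := 4 / 5 * μ) (k := 5 * R ^ 2 / μ)
    (by positivity) (continuousOn_quad μ b hec hvc)
    (fun t ht => hasDerivWithinAt_quad μ b ((he t (hT.trans ht)).mono (hsub t ht))
      ((hv t (hT.trans ht)).mono (hsub t ht)))
    (fun t ht => by
      rw [hq t, sub_eq_add_neg (v t) (w t)]
      refine (quad_deriv_le hμ ha hb (e t) (v t) (-w t) 0).trans ?_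
      have h1 : (-w t) ^ 2 ≤ R ^ 2 := by
        rw [neg_sq, ← sq_abs]
        exact pow_le_pow_left₀ (abs_nonneg _) (hT₀ t ((le_max_left _ _).trans ht)) 2
      have h2 : 5 * (-w t) ^ 2 / μ ≤ 5 * R ^ 2 / μ := by gcongr
      have h3 : 5 * (0 : ℝ) ^ 2 / (a * b) = 0 := by simp
      rw [h3]; linarith)
    (η := R ^ 2 / μ ^ 2) (by positivity)
  filter_upwards [key] with t ht
  have h1 := sq_le_quad hμ ha hb (e t) (v t)
  have h2 : 5 * R ^ 2 / μ / (4 / 5 * μ) = 25 / 4 * (R ^ 2 / μ ^ 2) := by field_simp; ring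
  rw [h2] at ht
  apply abs_le_of_sq_le_sq _ (by positivity)
  have h3 : (4 / μ * R) ^ 2 = 16 * (R ^ 2 / μ ^ 2) := by field_simp; ring
  have h4 : 0 ≤ R ^ 2 / μ ^ 2 := by positivity
  rw [h3]; linarith

/-- A constant input is tracked with the constant error -k_d/k_p, because the torque damps the
absolute rate. -/
lemma le_gammaIn_static (hkp : 0 < kp) (hkd : 0 < kd) :
    ENNReal.ofReal (kd / kp) ≤ gammaIn P kp kd := by
  have hI := P.Iu_pos
  refine le_sInf fun γ hγ => ?_
  have h := hγ (fun _ => 1) (fun _ => -(kd / kp)) (fun _ => 1) continuousOn_const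
    (fun t _ => by simpa using hasDerivWithinAt_const t (Ici 0) (-(kd / kp)))
    (fun t _ => by
      have : u2 kp kd (-(kd / kp)) 1 / P.Iu = 0 := by unfold u2; field_simp; ring
      rw [this]; exact hasDerivWithinAt_const _ _ _)
  unfold AsymptoticGainBound at h
  rw [limsup_const, limsup_const, enorm_neg, ← ofReal_norm, Real.norm_of_nonneg (by positivity)] at h
  simpa using h

/-- At the frequency ω with ω² = k_p/I_u stiffness and inertia cancel and only damping limits the
response: at the times 2πn/ω the error has modulus I_u/k_d. Together with the static bound this
shows that γ_in is at least the inverse of the bandwidth. -/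
lemma le_gammaIn_resonant (hkp : 0 < kp) (hkd : 0 < kd) :
    ENNReal.ofReal (P.Iu / kd) ≤ gammaIn P kp kd := by
  have hI := P.Iu_pos
  refine le_sInf fun γ hγ => ?_
  set ω := √(kp / P.Iu) with hω
  have hω0 : 0 < ω := Real.sqrt_pos.mpr (by positivity)
  have hω2 : kp = ω ^ 2 * P.Iu := by
    rw [hω, Real.sq_sqrt (by positivity)]; field_simp
  have hl : ∀ t, HasDerivAt (fun s => ω * s) ω t := fun t => by
    simpa using (hasDerivAt_id t).const_mul ω
  have hc := fun t => (hl t).cos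
  have hs := fun t => (hl t).sin
  have h := hγ (fun t => Real.cos (ω * t))
    (fun t => -(P.Iu / kd) * Real.cos (ω * t) - 1 / ω * Real.sin (ω * t))
    (fun t => ω * (P.Iu / kd) * Real.sin (ω * t))
    (by fun_prop)
    (fun t _ => (((hc t).const_mul _).fun_sub ((hs t).const_mul (1 / ω))).hasDerivWithinAt.congr_deriv
      (by field_simp))
    (fun t _ => ((hs t).const_mul (ω * (P.Iu / kd))).hasDerivWithinAt.congr_deriv
      (by unfold u2; rw [hω2]; field_simp; ring))
  unfold AsymptoticGainBound at h
  have h1 : limsup (fun t => ‖Real.cos (ω * t)‖ₑ) atTop ≤ 1 := by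
    refine limsup_le_of_le (by isBoundedDefault) (Eventually.of_forall fun t => ?_)
    rw [← ofReal_norm, ENNReal.ofReal_le_one]
    exact Real.abs_cos_le_one _
  have h2 : ENNReal.ofReal (P.Iu / kd) ≤
      limsup (fun t => ‖-(P.Iu / kd) * Real.cos (ω * t) - 1 / ω * Real.sin (ω * t)‖ₑ) atTop := by
    refine le_limsup_of_frequently_le ?_ (by isBoundedDefault)
    rw [frequently_atTop]
    intro T
    obtain ⟨n, hn⟩ := exists_nat_ge (T * ω / (2 * Real.pi))
    refine ⟨n * (2 * Real.pi) / ω, ?_, ?_⟩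
    · rw [le_div_iff₀ hω0]
      rwa [div_le_iff₀ (by positivity)] at hn
    · have e1 : ω * (n * (2 * Real.pi) / ω) = n * (2 * Real.pi) := by field_simp
      have e2 : Real.sin (n * (2 * Real.pi)) = 0 := by
        have := Real.sin_nat_mul_pi (n * 2)
        push_cast at this
        rw [← this]; congr 1; ring
      rw [e1, Real.cos_nat_mul_two_pi, e2, ← ofReal_norm]
      simp [abs_of_pos hI, abs_of_pos hkd]
  calc _ ≤ _ := h2
    _ ≤ _ := h
    _ ≤ γ * 1 := by gcongr
    _ = γ := mul_one _

end gammaIn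

/-! ### The inclination loop -/

section inclination

variable (P : Plant) (C : Tuning)

/-- Decay parameter of the inclination loop. -/
noncomputable def inclRate : ℝ :=
  min (C.kda / P.I0) ((C.kpa / P.I0) / (C.kda / P.I0)) / 4

/-- Lyapunov function of the inclination loop. -/
noncomputable def inclLyap (z y : ℝ) : ℝ := quad (inclRate P C) (C.kpa / P.I0) z y

/-- Derivative of `inclLyap` for `z' = y`, `y' = acc`. -/
noncomputable def inclLyapDeriv (z y acc : ℝ) : ℝ :=
  2 * z * y + 2 * y * acc / (C.kpa / P.I0)
    + 2 * inclRate P C / (C.kpa / P.I0) * (y * y + z * acc)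

lemma inclRate_spec : 0 < inclRate P C ∧ 4 * inclRate P C ≤ C.kda / P.I0 ∧
    4 * inclRate P C * (C.kda / P.I0) ≤ C.kpa / P.I0 := by
  have hI := P.I0_pos
  have hkp := C.kpa_pos
  have hkd := C.kda_pos
  have h1 : 0 < C.kda / P.I0 := by positivity
  have h2 : 0 < (C.kpa / P.I0) / (C.kda / P.I0) := by positivity
  have h3 := lt_min h1 h2
  have e : 4 * inclRate P C = min (C.kda / P.I0) ((C.kpa / P.I0) / (C.kda / P.I0)) := by
    unfold inclRate; ring
  refine ⟨by unfold inclRate; positivity, ?_, ?_⟩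
  · rw [e]; exact min_le_left _ _
  · rw [e, ← le_div_iff₀ h1]; exact min_le_right _ _

lemma hasDerivWithinAt_inclLyap {z y : ℝ → ℝ} {acc t : ℝ} {s : Set ℝ}
    (hz : HasDerivWithinAt z (y t) s t) (hy : HasDerivWithinAt y acc s t) :
    HasDerivWithinAt (fun τ => inclLyap P C (z τ) (y τ)) (inclLyapDeriv P C (z t) (y t) acc) s t :=
  hasDerivWithinAt_quad _ _ hz hy

lemma sq_le_of_abs_le_error {d e z y w p q c : ℝ}
    (h : |d| ≤ |e| * (p * |z| + q * |y|) + c * (|e| + |w|)) :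
    d ^ 2 ≤ 4 * e ^ 2 * ((p ^ 2 + q ^ 2) * (z ^ 2 + y ^ 2)) + 4 * c ^ 2 * (e ^ 2 + w ^ 2) := by
  have k1 : d ^ 2 ≤ (|e| * (p * |z| + q * |y|) + c * (|e| + |w|)) ^ 2 := by
    rw [← sq_abs d]; exact pow_le_pow_left₀ (abs_nonneg _) h 2
  have k2 : (p * |z| + q * |y|) ^ 2 ≤ 2 * ((p ^ 2 + q ^ 2) * (z ^ 2 + y ^ 2)) := by
    have e1 : (p * |z| + q * |y|) ^ 2 = (p ^ 2 + q ^ 2) * (|z| ^ 2 + |y| ^ 2)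
      - (p * |y| - q * |z|) ^ 2 := by ring
    rw [e1, sq_abs, sq_abs]
    have : 0 ≤ (p ^ 2 + q ^ 2) * (z ^ 2 + y ^ 2) := by positivity
    linarith [sq_nonneg (p * |y| - q * |z|)]
  have k3 : (c * (|e| + |w|)) ^ 2 ≤ c ^ 2 * (2 * (e ^ 2 + w ^ 2)) := by
    have := add_sq_le (a := |e|) (b := |w|)
    rw [sq_abs, sq_abs] at this
    rw [mul_pow]; exact mul_le_mul_of_nonneg_left this (sq_nonneg c)
  have k4 : (|e| * (p * |z| + q * |y|)) ^ 2
      ≤ e ^ 2 * (2 * ((p ^ 2 + q ^ 2) * (z ^ 2 + y ^ 2))) := by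
    rw [mul_pow, sq_abs]; exact mul_le_mul_of_nonneg_left k2 (sq_nonneg e)
  have k5 := add_sq_le (a := |e| * (p * |z| + q * |y|)) (b := c * (|e| + |w|))
  linarith

/-- The inclination loop is input-to-state stable with respect to small attitude errors and to
the cart acceleration. -/
lemma exists_inclLyap_decay : ∃ θ₀ c k : ℝ, 0 < θ₀ ∧ θ₀ < Real.pi / 2 ∧ 0 < c ∧ 0 < k ∧
    (∀ z y, 0 ≤ inclLyap P C z y ∧ z ^ 2 + y ^ 2 ≤ k * inclLyap P C z y ∧
      inclLyap P C z y ≤ k * (z ^ 2 + y ^ 2)) ∧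
    ∀ abar α y e ax : ℝ, |e| ≤ θ₀ →
      inclLyapDeriv P C (α - abar) y
        (objAcc P C abar α y (thetaBar P C (ft P C abar α y) + e) ax)
        ≤ -c * inclLyap P C (α - abar) y + k * (e ^ 2 + ax ^ 2) := by
  obtain ⟨hμ, ha, hb⟩ := inclRate_spec P C
  obtain ⟨c₀, hc₀, herr⟩ := exists_objAcc_error_bound P C
  have hI := P.I0_pos
  have hkp := C.kpa_pos
  have hkd := C.kda_pos
  set μ := inclRate P C
  set a := C.kda / P.I0 with ha'
  set b := C.kpa / P.I0 with hb'
  have ha0 : 0 < a := by positivity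
  have hb0 : 0 < b := by positivity
  -- `z² + y² ≤ k₁ V`
  set k₁ := 4 / 3 * (1 + b) with hk₁
  have hk₁0 : 0 < k₁ := by positivity
  have hlow : ∀ z y, z ^ 2 + y ^ 2 ≤ k₁ * inclLyap P C z y := fun z y => by
    have h1 := sq_le_quad hμ ha hb z y
    have h2 := sq_le_mul_quad hμ ha hb z y
    unfold inclLyap; rw [hk₁]; linarith
  have hup : ∀ z y, inclLyap P C z y ≤ 5 / 4 * (1 + 1 / b) * (z ^ 2 + y ^ 2) := fun z y => by
    refine (quad_le hμ ha hb z y).trans ?_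
    rw [mul_assoc]
    refine mul_le_mul_of_nonneg_left ?_ (by norm_num)
    have e1 : y ^ 2 / b = 1 / b * y ^ 2 := by ring
    have : 0 ≤ 1 / b * z ^ 2 := by positivity
    rw [e1]; nlinarith [sq_nonneg y]
  set L := 5 / (a * b * P.I0 ^ 2) with hL
  have hL0 : 0 < L := by positivity
  set Q := 4 * L * (C.kpa ^ 2 + C.kda ^ 2) * k₁ with hQ
  have hQ0 : 0 < Q := by positivity
  -- The perturbation contains e² Q V. This threshold lets it consume at most half of the decay rate
  -- 4/5 μ, and the bound 1 keeps θ₀ below π/2.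
  set θ₀ := min 1 (√(2 / 5 * μ / Q)) with hθ
  have hs : 0 < 2 / 5 * μ / Q := by positivity
  have hθ0 : 0 < θ₀ := lt_min one_pos (Real.sqrt_pos.mpr hs)
  refine ⟨θ₀, 2 / 5 * μ, k₁ + 5 / 4 * (1 + 1 / b) + 4 * L * c₀ ^ 2, hθ0, ?_, by positivity,
    by positivity, fun z y => ⟨quad_nonneg hμ ha hb z y, ?_, ?_⟩, fun abar α y e ax he => ?_⟩
  · exact (min_le_left _ _).trans_lt (by linarith [Real.pi_gt_three])
  · refine (hlow z y).trans (mul_le_mul_of_nonneg_right ?_ (quad_nonneg hμ ha hb z y))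
    have : 0 ≤ 5 / 4 * (1 + 1 / b) := by positivity
    have : 0 ≤ 4 * L * c₀ ^ 2 := by positivity
    linarith
  · refine (hup z y).trans (mul_le_mul_of_nonneg_right ?_ (by positivity))
    have : 0 ≤ 4 * L * c₀ ^ 2 := by positivity
    linarith
  · have h := herr abar α y e ax
    set acc := objAcc P C abar α y (thetaBar P C (ft P C abar α y) + e) ax
    set z := α - abar
    set d := P.I0 * acc + C.kpa * z + C.kda * y with hd
    have hacc : acc = -b * z - a * y + d / P.I0 := by
      rw [hd, ha', hb']; field_simp; ring
    have hq := quad_deriv_le hμ ha hb z y 0 (d / P.I0)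
    rw [← hacc, add_zero] at hq
    have e1 : 5 * (d / P.I0) ^ 2 / (a * b) = L * d ^ 2 := by rw [hL]; field_simp
    have e2 : 5 * (0 : ℝ) ^ 2 / μ = 0 := by simp
    rw [e1, e2, add_zero] at hq
    -- bound of the perturbation
    have hcos := abs_one_sub_cos_le e
    have h1 : |d| ≤ |e| * (C.kpa * |z| + C.kda * |y|) + c₀ * (|e| + |ax|) := by
      refine h.trans ?_
      gcongr
    have h2 : d ^ 2 ≤ 4 * e ^ 2 * ((C.kpa ^ 2 + C.kda ^ 2) * (z ^ 2 + y ^ 2))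
        + 4 * c₀ ^ 2 * (e ^ 2 + ax ^ 2) :=
      sq_le_of_abs_le_error h1
    have h3 : e ^ 2 ≤ 2 / 5 * μ / Q := by
      calc e ^ 2 = |e| ^ 2 := (sq_abs e).symm
        _ ≤ (√(2 / 5 * μ / Q)) ^ 2 :=
          pow_le_pow_left₀ (abs_nonneg _) (he.trans (min_le_right _ _)) 2
        _ = _ := Real.sq_sqrt hs.le
    have hV := quad_nonneg hμ ha hb z y
    have h4 : L * (4 * e ^ 2 * ((C.kpa ^ 2 + C.kda ^ 2) * (z ^ 2 + y ^ 2)))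
        ≤ 2 / 5 * μ * quad μ b z y := by
      calc L * (4 * e ^ 2 * ((C.kpa ^ 2 + C.kda ^ 2) * (z ^ 2 + y ^ 2)))
          ≤ L * (4 * e ^ 2 * ((C.kpa ^ 2 + C.kda ^ 2) * (k₁ * quad μ b z y))) := by
            have := hlow z y
            unfold inclLyap at this
            gcongr
        _ = e ^ 2 * (Q * quad μ b z y) := by rw [hQ]; ring
        _ ≤ 2 / 5 * μ / Q * (Q * quad μ b z y) := by gcongr
        _ = _ := by field_simp
    have h5 := mul_le_mul_of_nonneg_left h2 hL0.le
    have h6 : 0 ≤ (k₁ + 5 / 4 * (1 + 1 / b)) * (e ^ 2 + ax ^ 2) := by positivity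
    unfold inclLyap
    change 2 * z * y + 2 * y * acc / b + 2 * μ / b * (y * y + z * acc) ≤ _
    linarith

/-- Right derivative of the relative attitude reference along a motion of the object. -/
lemma exists_thetaBar_rate : ∃ c : ℝ, 0 < c ∧ ∀ (abar : ℝ) (α y : ℝ → ℝ) (y' t : ℝ),
    HasDerivWithinAt α (y t) (Ici t) t → HasDerivWithinAt y y' (Ici t) t →
    ∃ D : ℝ, HasDerivWithinAt (fun τ => thetaBar P C (ft P C abar (α τ) (y τ))) D (Ici t) t ∧
      |D| ≤ c * (|y t| + |y'|) ∧ (P.Umax < |ft P C abar (α t) (y t)| → D = 0) := by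
  have hg := gam_pos P C
  have he := C.eps_pos
  have hkp := C.kpa_pos
  have hkd := C.kda_pos
  have hM := P.M_pos
  have hgg := P.g_pos
  refine ⟨gam P C * C.eps * (C.kpa + C.kda + P.M * P.g), by positivity,
    fun abar α y y' t hα hy => ?_⟩
  obtain ⟨D, h1, h2, h3⟩ := exists_hasDerivWithinAt_thetaBar P C (hasDerivWithinAt_ft P C abar hα hy)
  refine ⟨D, h1, h2.trans ?_, h3⟩
  rw [mul_assoc (gam P C * C.eps)]
  refine mul_le_mul_of_nonneg_left ?_ (by positivity)
  have k1 := abs_sub (-C.kpa * y t - C.kda * y') (P.M * P.g * (Real.sin (α t) * y t))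
  have k2 := abs_sub (-C.kpa * y t) (C.kda * y')
  have k3 : |P.M * P.g * (Real.sin (α t) * y t)| ≤ P.M * P.g * |y t| := by
    rw [abs_mul, abs_mul (Real.sin _), abs_of_pos (by positivity : 0 < P.M * P.g)]
    refine mul_le_mul_of_nonneg_left ?_ (by positivity)
    exact mul_le_of_le_one_left (abs_nonneg _) (Real.abs_sin_le_one _)
  rw [abs_mul, abs_mul, abs_neg, abs_of_pos hkp, abs_of_pos hkd] at k2
  nlinarith [mul_nonneg hkp.le (abs_nonneg y'), mul_nonneg hkd.le (abs_nonneg (y t)),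
    mul_nonneg (mul_pos hM hgg).le (abs_nonneg y')]

/-- At a corner `deriv` takes its default value 0, so a bound on the right derivative suffices there
too. -/
lemma abs_deriv_le_of_hasDerivWithinAt {f : ℝ → ℝ} {D t : ℝ}
    (h : HasDerivWithinAt f D (Ici t) t) : |deriv f t| ≤ |D| := by
  by_cases hd : DifferentiableAt ℝ f t
  · rw [(uniqueDiffWithinAt_Ici t).eq_deriv _ hd.hasDerivAt.hasDerivWithinAt h]
  · rw [deriv_zero_of_not_differentiableAt hd, abs_zero]; exact abs_nonneg D

/-- For errors below θ₀ the inclination loop has a linear gain: |e| ≤ R eventually forces the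
deviation and the rate below q R. The acceleration is bounded linearly by these and e, and the rate
of the reference linearly by rate and acceleration. -/
theorem exists_gammaOut_lt_top (abar : ℝ) : ∃ θ₀ : ℝ, 0 < θ₀ ∧ θ₀ < Real.pi / 2 ∧
    ∀ θmax : ℝ, 0 < θmax → θmax ≤ θ₀ → gammaOut P C abar θmax < ⊤ := by
  obtain ⟨θ₀, c, k, hθ₀, hθpi, hc, hk, hV, hdec⟩ := exists_inclLyap_decay P C
  obtain ⟨cl, hcl, hacc⟩ := exists_objAcc_linear_bound P C
  obtain ⟨cr, hcr, hrate⟩ := exists_thetaBar_rate P C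
  refine ⟨θ₀, hθ₀, hθpi, fun θmax hθ hθle => ?_⟩
  set q := √(k * (k / c + 1)) with hq
  set Γ := q + cr * (q + cl * (q + q + 1)) with hΓ
  have hq0 : 0 < q := Real.sqrt_pos.mpr (by positivity)
  have hΓ0 : 0 < Γ := by positivity
  refine lt_of_le_of_lt (sInf_le (a := ENNReal.ofReal Γ) ?_) ENNReal.ofReal_lt_top
  intro e a va he hebd ha hva
  refine asymptoticGainBound_of_eventually hΓ0 fun R hR heR => ?_
  obtain ⟨T₀, hT₀⟩ := eventually_atTop.mp heR
  set T := max T₀ 0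
  have hT : 0 ≤ T := le_max_right _ _
  have hsub : ∀ t, T ≤ t → Ici t ⊆ Ici (0 : ℝ) := fun t ht => Ici_subset_Ici.mpr (hT.trans ht)
  have hac : ContinuousOn a (Ici T) :=
    fun t ht => ((ha t (hT.trans ht)).continuousWithinAt).mono (Ici_subset_Ici.mpr hT)
  have hvc : ContinuousOn va (Ici T) :=
    fun t ht => ((hva t (hT.trans ht)).continuousWithinAt).mono (Ici_subset_Ici.mpr hT)
  have ev := eventually_le_of_deriv_right_le (T := T) (c := c) (k := k * R ^ 2) hc
    (g := fun t => inclLyap P C (a t - abar) (va t))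
    (continuousOn_quad _ _ (hac.sub continuousOn_const) hvc)
    (fun t ht => hasDerivWithinAt_inclLyap P C
      (((ha t (hT.trans ht)).mono (hsub t ht)).sub_const abar)
      ((hva t (hT.trans ht)).mono (hsub t ht)))
    (fun t ht => by
      refine (hdec abar (a t) (va t) (e t) 0 ((hebd t (hT.trans ht)).trans hθle)).trans ?_
      have h1 : e t ^ 2 ≤ R ^ 2 := by
        rw [← sq_abs]
        exact pow_le_pow_left₀ (abs_nonneg _) (hT₀ t ((le_max_left _ _).trans ht)) 2
      have := mul_le_mul_of_nonneg_left h1 hk.le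
      linarith)
    (η := R ^ 2) (by positivity)
  filter_upwards [ev, eventually_ge_atTop T] with t ht hTt
  have ht0 := hT.trans hTt
  have h1 := (hV (a t - abar) (va t)).2.1
  have h2 : (a t - abar) ^ 2 + va t ^ 2 ≤ (q * R) ^ 2 := by
    rw [mul_pow, hq, Real.sq_sqrt (by positivity)]
    calc _ ≤ _ := h1
      _ ≤ k * (k * R ^ 2 / c + R ^ 2) := by gcongr
      _ = _ := by ring
  have hz : |a t - abar| ≤ q * R :=
    abs_le_of_sq_le_sq (by nlinarith [sq_nonneg (va t)]) (by positivity)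
  have hy : |va t| ≤ q * R :=
    abs_le_of_sq_le_sq (by nlinarith [sq_nonneg (a t - abar)]) (by positivity)
  have hA := ((ha t ht0).mono (hsub t hTt))
  have hB := ((hva t ht0).mono (hsub t hTt))
  obtain ⟨D, hD, hDle, -⟩ := hrate abar a va _ t hA hB
  have h3 := hacc abar (a t) (va t) (e t) 0
  have h4 := hT₀ t ((le_max_left _ _).trans hTt)
  have h5 : |objAcc P C abar (a t) (va t) (thetaBar P C (ft P C abar (a t) (va t)) + e t) 0|
      ≤ cl * (q * R + q * R + R) := by
    refine h3.trans ?_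
    rw [abs_zero, add_zero]
    gcongr
  have h6 : |D| ≤ cr * (q * R + cl * (q * R + q * R + R)) := by
    refine hDle.trans ?_
    gcongr
  refine (abs_deriv_le_of_hasDerivWithinAt (hA.fun_add hD)).trans ((abs_add_le _ _).trans ?_)
  calc |va t| + |D| ≤ q * R + cr * (q * R + cl * (q * R + q * R + R)) := add_le_add hy h6
    _ = Γ * R := by rw [hΓ]; ring

end inclination

/-! ### Closed loop in error coordinates -/

section motion

variable {P : Plant} {C : Tuning}

/-- Motion of the object and of the aerial vehicle under the cart acceleration `ax`. Here `a`, `b`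
are the normalized attitude gains, `z` is the attitude error corrected by its quasi-static value,
`q` the relative attitude rate, `A` the acceleration of the object and `D` the right derivative
of the relative attitude reference, with Lipschitz constant `cr`. -/
structure AttitudeMotion (P : Plant) (C : Tuning) (abar a b cr : ℝ)
    (ax α y A z q D : ℝ → ℝ) : Prop where
  deriv_α : ∀ t, 0 ≤ t → HasDerivWithinAt α (y t) (Ici 0) t
  deriv_y : ∀ t, 0 ≤ t → HasDerivWithinAt y (A t) (Ici 0) t
  acc_eq : ∀ t, 0 ≤ t → A t = objAcc P C abar (α t) (y t)
    (thetaBar P C (ft P C abar (α t) (y t)) + (z t - a / b * y t)) (ax t)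
  cont_z : ContinuousOn z (Ici 0)
  deriv_z : ∀ t, 0 ≤ t → HasDerivWithinAt z (q t + (a / b * A t - D t)) (Ici t) t
  -- The attitude error is z - (a/b) y and the absolute rate is q + y. The two contributions a y
  -- cancel, which is the purpose of the shift in z: the rate y, possibly large, does not force this
  -- equation.
  deriv_q : ∀ t, 0 ≤ t → HasDerivWithinAt q (-b * z t - a * q t + -A t) (Ici 0) t
  rate_le : ∀ t, 0 ≤ t → |D t| ≤ cr * (|y t| + |A t|)
  rate_eq_zero : ∀ t, 0 ≤ t → P.Umax < |ft P C abar (α t) (y t)| → D t = 0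

namespace AttitudeMotion

variable {abar a b cr : ℝ} {ax α y A z q D : ℝ → ℝ}

lemma cont_α (h : AttitudeMotion P C abar a b cr ax α y A z q D) : ContinuousOn α (Ici 0) :=
  fun t ht => (h.deriv_α t ht).continuousWithinAt

lemma cont_y (h : AttitudeMotion P C abar a b cr ax α y A z q D) : ContinuousOn y (Ici 0) :=
  fun t ht => (h.deriv_y t ht).continuousWithinAt

lemma cont_q (h : AttitudeMotion P C abar a b cr ax α y A z q D) : ContinuousOn q (Ici 0) :=
  fun t ht => (h.deriv_q t ht).continuousWithinAt

lemma right_α (h : AttitudeMotion P C abar a b cr ax α y A z q D) {t : ℝ} (ht : 0 ≤ t) :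
    HasDerivWithinAt α (y t) (Ici t) t := (h.deriv_α t ht).mono (Ici_subset_Ici.mpr ht)

lemma right_y (h : AttitudeMotion P C abar a b cr ax α y A z q D) {t : ℝ} (ht : 0 ≤ t) :
    HasDerivWithinAt y (A t) (Ici t) t := (h.deriv_y t ht).mono (Ici_subset_Ici.mpr ht)

lemma right_q (h : AttitudeMotion P C abar a b cr ax α y A z q D) {t : ℝ} (ht : 0 ≤ t) :
    HasDerivWithinAt q (-b * z t - a * q t + -A t) (Ici t) t :=
  (h.deriv_q t ht).mono (Ici_subset_Ici.mpr ht)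

lemma cont_incl (h : AttitudeMotion P C abar a b cr ax α y A z q D) :
    ContinuousOn (fun t => inclLyap P C (α t - abar) (y t)) (Ici 0) :=
  continuousOn_quad _ _ (h.cont_α.sub continuousOn_const) h.cont_y

lemma cont_quad (h : AttitudeMotion P C abar a b cr ax α y A z q D) (μ : ℝ) :
    ContinuousOn (fun t => quad μ b (z t) (q t)) (Ici 0) :=
  continuousOn_quad _ _ h.cont_z h.cont_q

/-- Decay of the Lyapunov function of the attitude loop. -/
lemma exists_right_deriv_quad (h : AttitudeMotion P C abar a b cr ax α y A z q D) {μ : ℝ}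
    (hμ : 0 < μ) (ha : 4 * μ ≤ a) (hb : 4 * μ * a ≤ b) {t : ℝ} (ht : 0 ≤ t) :
    ∃ d, HasDerivWithinAt (fun t => quad μ b (z t) (q t)) d (Ici t) t ∧
      d ≤ -(4 / 5 * μ) * quad μ b (z t) (q t) + 5 * (a / b * A t - D t) ^ 2 / μ
        + 5 * A t ^ 2 / (a * b) := by
  refine ⟨_, hasDerivWithinAt_quad μ b (h.deriv_z t ht) (h.right_q ht), ?_⟩
  have := quad_deriv_le hμ ha hb (z t) (q t) (a / b * A t - D t) (-A t)
  rwa [neg_sq] at this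

end AttitudeMotion

lemma gain_ratio_bounds {μ a b : ℝ} (hμ : 0 < μ) (ha : 4 * μ ≤ a) (hb : 4 * μ * a ≤ b) :
    0 < a ∧ 0 < b ∧ 0 < a / b ∧ a / b ≤ 1 / (4 * μ) ∧ 64 * μ ^ 3 ≤ a * b := by
  have ha0 : 0 < a := by linarith
  have h16 := sixteen_mul_sq_le hμ ha hb
  have hb0 : 0 < b := by nlinarith [pow_pos hμ 2]
  refine ⟨ha0, hb0, by positivity, ?_, ?_⟩
  · rw [div_le_div_iff₀ hb0 (by positivity)]; linarith
  · calc 64 * μ ^ 3 = (4 * μ) * (16 * μ ^ 2) := by ring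
      _ ≤ a * b := mul_le_mul ha h16 (by positivity) ha0.le

lemma sq_add_four_le {p q r s : ℝ} : (p + q + r + s) ^ 2 ≤ 4 * (p ^ 2 + q ^ 2 + r ^ 2 + s ^ 2) := by
  nlinarith [sq_nonneg (p - q), sq_nonneg (p - r), sq_nonneg (p - s), sq_nonneg (q - r),
    sq_nonneg (q - s), sq_nonneg (r - s)]

lemma forcing_sq_le {ρ cr cl k G V W x y z w e A D : ℝ} (hcr : 0 < cr) (hcl : 0 < cl) (hk : 0 < k)
    (hρ0 : 0 ≤ ρ) (hρ1 : ρ ≤ 1) (hA : |A| ≤ cl * (|x| + |y| + |e| + |w|)) (he : |e| ≤ |z| + |y|)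
    (hD : |D| ≤ cr * (|y| + |A|)) (hV : x ^ 2 + y ^ 2 ≤ k * V) (hW : z ^ 2 ≤ 4 / 3 * W)
    (hW0 : 0 ≤ W) (hG : G = 4 * ((1 + cr) * (1 + 2 * cl)) ^ 2 * (k + 2)) :
    A ^ 2 ≤ G * (V + W + w ^ 2) ∧ (ρ * A - D) ^ 2 ≤ G * (V + W + w ^ 2) := by
  obtain ⟨g, hg⟩ : ∃ g, g = (1 + cr) * (1 + 2 * cl) := ⟨_, rfl⟩
  have hg0 : 0 < g := by rw [hg]; positivity
  obtain ⟨S, hS⟩ : ∃ S, S = |x| + |y| + |z| + |w| := ⟨_, rfl⟩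
  have n1 := abs_nonneg x
  have n2 := abs_nonneg y
  have n3 := abs_nonneg z
  have n4 := abs_nonneg w
  have hS0 : 0 ≤ S := by rw [hS]; positivity
  have hA1 : |A| ≤ 2 * cl * S := by
    refine hA.trans ?_
    rw [mul_comm 2 cl, mul_assoc]
    refine mul_le_mul_of_nonneg_left ?_ hcl.le
    rw [hS]; linarith
  have hAg : |A| ≤ g * S := by
    refine hA1.trans (mul_le_mul_of_nonneg_right ?_ hS0)
    rw [hg]; nlinarith
  have hp : |ρ * A - D| ≤ g * S := by
    refine (abs_sub _ _).trans ?_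
    rw [abs_mul, abs_of_nonneg hρ0]
    have k1 : ρ * |A| ≤ |A| := mul_le_of_le_one_left (abs_nonneg _) hρ1
    have k2 : |y| ≤ S := by rw [hS]; linarith
    have k3 := mul_le_mul_of_nonneg_left (add_le_add k2 hA1) hcr.le
    rw [hg]; linarith
  have hS2 : (g * S) ^ 2 ≤ G * (V + W + w ^ 2) := by
    have k1 : S ^ 2 ≤ 4 * (x ^ 2 + y ^ 2 + z ^ 2 + w ^ 2) := by
      rw [hS]; refine sq_add_four_le.trans ?_
      simp only [sq_abs]; exact le_rfl
    have k2 : x ^ 2 + y ^ 2 + z ^ 2 + w ^ 2 ≤ (k + 2) * (V + W + w ^ 2) := by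
      have hV0 : 0 ≤ V := by
        by_contra hn
        linarith [sq_nonneg x, sq_nonneg y, mul_neg_of_pos_of_neg hk (not_le.mp hn)]
      have := mul_nonneg hk.le hW0
      have := mul_nonneg hk.le (sq_nonneg w)
      linarith [sq_nonneg w]
    calc (g * S) ^ 2 = g ^ 2 * S ^ 2 := mul_pow _ _ _
      _ ≤ g ^ 2 * (4 * ((k + 2) * (V + W + w ^ 2))) :=
        mul_le_mul_of_nonneg_left (by linarith) (sq_nonneg g)
      _ = _ := by rw [hG, hg]; ring
  constructor
  · rw [← sq_abs]; exact (pow_le_pow_left₀ (abs_nonneg _) hAg 2).trans hS2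
  · rw [← sq_abs]; exact (pow_le_pow_left₀ (abs_nonneg _) hp 2).trans hS2

/-- Time-scale separation. The inclination forces the attitude loop through terms divided by μ, and
the lag contributes y²/μ to the squared error. The attitude error enters the inclination loop with a
factor independent of μ and is absorbed by the decay 4/5 μ W. Each summand of the threshold for μ
pays for one coupling. -/
lemma composite_le {c k G μ V W V' W' e2 z2 y2 w2 p2 A2 r : ℝ} (hc : 0 < c) (hk : 0 < k)
    (hG0 : 0 < G)
    (hμ₀ : 1 + k ^ 2 / (2 * c) + 40 * G / c + 10 * G + 5 / 4 * (3 * k + 1 + c) ≤ μ) (hμ : 0 < μ)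
    (hV0 : 0 ≤ V) (hW0 : 0 ≤ W) (hw : 0 ≤ w2) (hV' : V' ≤ -c * V + k * (e2 + w2))
    (hW' : W' ≤ -(4 / 5 * μ) * W + 5 * p2 / μ + 5 * A2 / r)
    (he : e2 ≤ 2 * z2 + 1 / (8 * μ) * y2) (hz : z2 ≤ 4 / 3 * W) (hy : y2 ≤ k * V)
    (hA : A2 ≤ G * (V + W + w2)) (hp : p2 ≤ G * (V + W + w2)) (hr : μ ≤ r) :
    V' + W' ≤ -(c / 2) * (V + W) + (k + 1) * w2 := by
  have p1 : 0 < k ^ 2 / (2 * c) := by positivity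
  have p2' : 0 < 40 * G / c := by positivity
  obtain ⟨Y, hY⟩ : ∃ Y, Y = V + W + w2 := ⟨_, rfl⟩
  rw [← hY] at hA hp
  have hY0 : 0 ≤ Y := by rw [hY]; positivity
  have f1 : 5 * p2 / μ ≤ 5 * G / μ * Y := by
    rw [div_mul_eq_mul_div]
    exact div_le_div_of_nonneg_right (by linarith) hμ.le
  have f2 : 5 * A2 / r ≤ 5 * G / μ * Y := by
    rw [div_mul_eq_mul_div]
    exact div_le_div₀ (by positivity) (by linarith) hμ hr
  have g1 : 10 * G / μ ≤ c / 4 := by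
    have : 40 * G / c ≤ μ := by linarith
    rw [div_le_iff₀ hc] at this
    rw [div_le_iff₀ hμ]; linarith
  have g2 : 10 * G / μ ≤ 1 := by rw [div_le_one hμ]; linarith
  have g3 : k * (1 / (8 * μ) * y2) ≤ c / 4 * V := by
    have h2 : k ^ 2 / (8 * μ) ≤ c / 4 := by
      have : k ^ 2 / (2 * c) ≤ μ := by linarith
      rw [div_le_iff₀ (by positivity)] at this
      rw [div_le_iff₀ (by positivity)]; linarith
    calc k * (1 / (8 * μ) * y2) ≤ k * (1 / (8 * μ) * (k * V)) := by gcongr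
      _ = k ^ 2 / (8 * μ) * V := by ring
      _ ≤ _ := mul_le_mul_of_nonneg_right h2 hV0
  have g4 := mul_le_mul_of_nonneg_right g1 hV0
  have g5 := mul_le_mul_of_nonneg_right g2 (add_nonneg hW0 hw)
  have g6 := mul_le_mul_of_nonneg_left he hk.le
  have g7 : (3 * k + 1 + c) * W ≤ 4 / 5 * μ * W :=
    mul_le_mul_of_nonneg_right (by linarith) hW0
  have g8 := mul_nonneg hc.le hW0
  have g9 := mul_le_mul_of_nonneg_left hz hk.le
  have g10 := mul_nonneg hk.le hW0
  have e : 5 * G / μ * Y + 5 * G / μ * Y = 10 * G / μ * V + 10 * G / μ * (W + w2) := by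
    rw [hY]; ring
  linarith

variable (P C) in
/-- For fast attitude loops the sum of the two Lyapunov functions decays while the attitude error
is small. -/
lemma exists_composite_decay {cr : ℝ} (hcr : 0 < cr) :
    ∃ θ₀ μ₀ c k κ : ℝ, 0 < θ₀ ∧ 1 ≤ μ₀ ∧ 0 < c ∧ 0 < k ∧ 0 < κ ∧
      (∀ z y, 0 ≤ inclLyap P C z y ∧ z ^ 2 + y ^ 2 ≤ κ * inclLyap P C z y ∧
        inclLyap P C z y ≤ κ * (z ^ 2 + y ^ 2)) ∧
      ∀ (abar a b μ : ℝ) (ax α y A z q D : ℝ → ℝ), μ₀ ≤ μ → 4 * μ ≤ a → 4 * μ * a ≤ b →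
        AttitudeMotion P C abar a b cr ax α y A z q D →
        ∀ t, 0 ≤ t → ∃ d,
          HasDerivWithinAt (fun t => inclLyap P C (α t - abar) (y t) + quad μ b (z t) (q t)) d
            (Ici t) t ∧
          (|z t - a / b * y t| ≤ θ₀ →
            d ≤ -c * (inclLyap P C (α t - abar) (y t) + quad μ b (z t) (q t))
              + k * ax t ^ 2) := by
  obtain ⟨θ₀, c, k, hθ₀, -, hc, hk, hV, hdec⟩ := exists_inclLyap_decay P C
  obtain ⟨cl, hcl, hacc⟩ := exists_objAcc_linear_bound P C
  obtain ⟨G, hG⟩ : ∃ G, G = 4 * ((1 + cr) * (1 + 2 * cl)) ^ 2 * (k + 2) := ⟨_, rfl⟩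
  have hG0 : 0 < G := by rw [hG]; positivity
  refine ⟨θ₀, 1 + k ^ 2 / (2 * c) + 40 * G / c + 10 * G + 5 / 4 * (3 * k + 1 + c), c / 2, k + 1, k,
    hθ₀, ?_, by positivity, by positivity, hk, hV, ?_⟩
  · have : 0 ≤ k ^ 2 / (2 * c) := by positivity
    have : 0 ≤ 40 * G / c := by positivity
    linarith
  intro abar a b μ ax α y A z q D hμ₀ ha hb h t ht
  have p1 : 0 < k ^ 2 / (2 * c) := by positivity
  have p2 : 0 < 40 * G / c := by positivity
  have hμ1 : 1 ≤ μ := by linarith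
  have hμ : 0 < μ := by linarith
  obtain ⟨ha0, hb0, hab0, hab, hab3⟩ := gain_ratio_bounds hμ ha hb
  obtain ⟨d, hd, hdle⟩ := h.exists_right_deriv_quad hμ ha hb ht
  refine ⟨_, (hasDerivWithinAt_inclLyap P C ((h.right_α ht).sub_const abar)
    (h.right_y ht)).fun_add hd, fun he => ?_⟩
  have hVd := hdec abar (α t) (y t) (z t - a / b * y t) (ax t) he
  rw [← h.acc_eq t ht] at hVd
  have hA := hacc abar (α t) (y t) (z t - a / b * y t) (ax t)
  rw [← h.acc_eq t ht] at hA
  have hD := h.rate_le t ht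
  obtain ⟨hV0, hVl, -⟩ := hV (α t - abar) (y t)
  have hW0 := quad_nonneg hμ ha hb (z t) (q t)
  have hzW := sq_le_quad hμ ha hb (z t) (q t)
  set V := inclLyap P C (α t - abar) (y t)
  set W := quad μ b (z t) (q t)
  have hab1 : a / b ≤ 1 := hab.trans (by rw [div_le_one (by positivity)]; linarith)
  set ρ := a / b
  -- the attitude error
  have he1 : |z t - ρ * y t| ≤ |z t| + |y t| := by
    refine (abs_sub _ _).trans ?_
    rw [abs_mul, abs_of_pos hab0]
    gcongr
    exact mul_le_of_le_one_left (abs_nonneg _) hab1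
  have he2 : (z t - ρ * y t) ^ 2 ≤ 2 * z t ^ 2 + 1 / (8 * μ) * y t ^ 2 := by
    have h1 : (ρ * y t) ^ 2 ≤ 1 / (16 * μ) * y t ^ 2 := by
      rw [mul_pow]
      refine mul_le_mul_of_nonneg_right ?_ (sq_nonneg _)
      calc ρ ^ 2 ≤ (1 / (4 * μ)) ^ 2 := pow_le_pow_left₀ hab0.le hab 2
        _ = 1 / (16 * μ) * (1 / μ) := by field_simp; ring
        _ ≤ 1 / (16 * μ) * 1 := by
          refine mul_le_mul_of_nonneg_left ?_ (by positivity)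
          rw [div_le_one hμ]; exact hμ1
        _ = _ := mul_one _
    have e : 1 / (8 * μ) * y t ^ 2 = 2 * (1 / (16 * μ) * y t ^ 2) := by field_simp; ring
    rw [e]
    linarith [sq_nonneg (z t + ρ * y t)]
  obtain ⟨hA2, hp2⟩ := forcing_sq_le (G := G) hcr hcl hk hab0.le hab1 hA he1 hD hVl hzW hW0 hG
  have hμ3 : μ ≤ μ ^ 3 := le_self_pow₀ hμ1 three_ne_zero
  have hμab : μ ≤ a * b := by linarith
  have hy2 : y t ^ 2 ≤ k * V := by linarith [sq_nonneg (α t - abar)]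
  exact composite_le hc hk hG0 hμ₀ hμ hV0 hW0 (sq_nonneg _) hVd hdle he2 hzW hy2 hA2 hp2
    hμab

end motion

/-! ### Closed-loop solutions as attitude motions -/

section closedLoop

variable {P : Plant} {C : Tuning}

variable (P C) in
/-- Every closed-loop solution is a motion of the cart together with an attitude motion. -/
lemma exists_attitudeMotion : ∃ cr : ℝ, 0 < cr ∧ ∀ (kp kd xbar abar : ℝ) (X : ℝ → Fin 6 → ℝ),
    0 < kp → IsSolution (closedLoop P C kp kd xbar abar) X →
    (∀ t, 0 ≤ t → HasDerivWithinAt (fun s => X s 0) (X t 1) (Ici 0) t) ∧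
    (∀ t, 0 ≤ t → HasDerivWithinAt (fun s => X s 1) (u3 C xbar (X t 0) (X t 1) / P.mc) (Ici 0) t) ∧
    ∃ A D : ℝ → ℝ, AttitudeMotion P C abar (kd / P.Iu) (kp / P.Iu) cr
      (fun t => u3 C xbar (X t 0) (X t 1) / P.mc) (fun t => X t 2) (fun t => X t 3) A
      (fun t => X t 4 - betaBar P C abar (X t 2) (X t 3) + kd / P.Iu / (kp / P.Iu) * X t 3)
      (fun t => X t 5 - X t 3) D := by
  obtain ⟨cr, hcr, hrate⟩ := exists_thetaBar_rate P C
  refine ⟨cr, hcr, fun kp kd xbar abar X hkp hX => ?_⟩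
  have hI := P.Iu_pos
  have hc : ∀ i, ∀ t, 0 ≤ t → HasDerivWithinAt (fun s => X s i)
      (closedLoop P C kp kd xbar abar (X t) i) (Ici 0) t :=
    fun i t ht => hasDerivWithinAt_pi.mp (hX t ht) i
  have h0 : ∀ t, 0 ≤ t → HasDerivWithinAt (fun s => X s 0) (X t 1) (Ici 0) t := hc 0
  have h1 : ∀ t, 0 ≤ t → HasDerivWithinAt (fun s => X s 1)
    (u3 C xbar (X t 0) (X t 1) / P.mc) (Ici 0) t := hc 1
  have h2 : ∀ t, 0 ≤ t → HasDerivWithinAt (fun s => X s 2) (X t 3) (Ici 0) t := hc 2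
  have h3 : ∀ t, 0 ≤ t → HasDerivWithinAt (fun s => X s 3)
    (objAcc P C abar (X t 2) (X t 3) (X t 4 - X t 2) (u3 C xbar (X t 0) (X t 1) / P.mc))
    (Ici 0) t := hc 3
  have h4 : ∀ t, 0 ≤ t → HasDerivWithinAt (fun s => X s 4) (X t 5) (Ici 0) t := hc 4
  have h5 : ∀ t, 0 ≤ t → HasDerivWithinAt (fun s => X s 5)
    (u2 kp kd (X t 4 - betaBar P C abar (X t 2) (X t 3)) (X t 5) / P.Iu) (Ici 0) t := hc 5
  refine ⟨h0, h1, ?_⟩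
  obtain ⟨A, hA⟩ : ∃ A : ℝ → ℝ, A = fun t => objAcc P C abar (X t 2) (X t 3) (X t 4 - X t 2)
    (u3 C xbar (X t 0) (X t 1) / P.mc) := ⟨_, rfl⟩
  have h3 : ∀ t, 0 ≤ t → HasDerivWithinAt (fun s => X s 3) (A t) (Ici 0) t := by
    rw [hA]; exact h3
  have hDex : ∀ t, ∃ D, 0 ≤ t →
      HasDerivWithinAt (fun τ => thetaBar P C (ft P C abar (X τ 2) (X τ 3))) D (Ici t) t ∧
      |D| ≤ cr * (|X t 3| + |A t|) ∧ (P.Umax < |ft P C abar (X t 2) (X t 3)| → D = 0) := by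
    intro t
    by_cases ht : 0 ≤ t
    · obtain ⟨D, hD⟩ := hrate abar (fun s => X s 2) (fun s => X s 3) (A t) t
        ((h2 t ht).mono (Ici_subset_Ici.mpr ht)) ((h3 t ht).mono (Ici_subset_Ici.mpr ht))
      exact ⟨D, fun _ => hD⟩
    · exact ⟨0, fun h => absurd h ht⟩
  choose D hD using hDex
  have cont : ∀ i, ContinuousOn (fun s => X s i) (Ici 0) :=
    fun i t ht => (hc i t ht).continuousWithinAt
  refine ⟨A, D, h2, h3, fun t _ => ?_, ?_, fun t ht => ?_, fun t ht => ?_,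
    fun t ht => (hD t ht).2.1, fun t ht => (hD t ht).2.2⟩
  · rw [hA]
    simp only
    congr 1
    unfold betaBar; ring
  · have hb : ContinuousOn (fun t => betaBar P C abar (X t 2) (X t 3)) (Ici 0) := by
      unfold betaBar
      refine (cont 2).add ((continuous_thetaBar P C).comp_continuousOn ?_)
      unfold ft
      exact ((((cont 2).sub continuousOn_const).const_mul _).sub ((cont 3).const_mul _)).add
        ((Real.continuous_cos.comp_continuousOn (cont 2)).const_mul _)
    exact ((cont 4).sub hb).add ((cont 3).const_mul _)
  · have hs : Ici t ⊆ Ici (0 : ℝ) := Ici_subset_Ici.mpr ht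
    have := (((h4 t ht).mono hs).fun_sub (((h2 t ht).mono hs).fun_add (hD t ht).1)).fun_add
      (((h3 t ht).mono hs).const_mul (kd / P.Iu / (kp / P.Iu)))
    exact this.congr_deriv (by ring)
  · refine ((h5 t ht).fun_sub (h3 t ht)).congr_deriv ?_
    unfold u2
    field_simp
    ring

/-- Once the attitude error stays small, a motion with vanishing cart acceleration converges. -/
lemma AttitudeMotion.tendsto {cr θ₀ μ c k κ : ℝ} {abar a b : ℝ} {ax α y A z q D : ℝ → ℝ}
    (hκ : 0 < κ) (hc : 0 < c)
    (hV : ∀ z y, 0 ≤ inclLyap P C z y ∧ z ^ 2 + y ^ 2 ≤ κ * inclLyap P C z y ∧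
        inclLyap P C z y ≤ κ * (z ^ 2 + y ^ 2))
    (hμ : 0 < μ) (ha : 4 * μ ≤ a) (hb : 4 * μ * a ≤ b)
    (h : AttitudeMotion P C abar a b cr ax α y A z q D)
    (hdec : ∀ t, 0 ≤ t → ∃ d,
          HasDerivWithinAt (fun t => inclLyap P C (α t - abar) (y t) + quad μ b (z t) (q t)) d
            (Ici t) t ∧
          (|z t - a / b * y t| ≤ θ₀ →
            d ≤ -c * (inclLyap P C (α t - abar) (y t) + quad μ b (z t) (q t))
              + k * ax t ^ 2))
    (he : ∀ᶠ t in atTop, |z t - a / b * y t| ≤ θ₀) (hax : Tendsto ax atTop (𝓝 0)) :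
    Tendsto α atTop (𝓝 abar) ∧ Tendsto y atTop (𝓝 0) ∧ Tendsto z atTop (𝓝 0) ∧
      Tendsto q atTop (𝓝 0) := by
  obtain ⟨-, hb0, -⟩ := gain_ratio_bounds hμ ha hb
  obtain ⟨T₀, hT₀⟩ := eventually_atTop.mp he
  have hT : 0 ≤ max T₀ 0 := le_max_right _ _
  choose d hd using fun t (ht : 0 ≤ t) => hdec t ht
  have hU : Tendsto (fun t => inclLyap P C (α t - abar) (y t) + quad μ b (z t) (q t)) atTop
      (𝓝 0) := by
    rw [Metric.tendsto_nhds]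
    intro η hη
    have ev := eventually_le_of_deriv_right_le_tendsto (T := max T₀ 0) (c := c)
      (g := fun t => inclLyap P C (α t - abar) (y t) + quad μ b (z t) (q t))
      (g' := fun t => if ht : 0 ≤ t then d t ht else 0) (k := fun t => k * ax t ^ 2) hc
      ((h.cont_incl.add (h.cont_quad μ)).mono (Ici_subset_Ici.mpr hT))
      (fun t ht => by simp only [dif_pos (hT.trans ht)]; exact (hd t (hT.trans ht)).1)
      (by simpa using (hax.pow 2).const_mul k)
      (fun t ht => by
        simp only [dif_pos (hT.trans ht)]
        exact (hd t (hT.trans ht)).2 (hT₀ t ((le_max_left _ _).trans ht)))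
      (half_pos hη)
    filter_upwards [ev] with t ht
    rw [Real.dist_eq, sub_zero, abs_of_nonneg
      (add_nonneg (hV _ _).1 (quad_nonneg hμ ha hb _ _))]
    linarith
  have sq0 : ∀ (g : ℝ → ℝ) (c : ℝ), (∀ t, g t ^ 2 ≤
      c * (inclLyap P C (α t - abar) (y t) + quad μ b (z t) (q t))) →
      Tendsto g atTop (𝓝 0) := by
    intro g c hg
    have h1 : Tendsto (fun t => g t ^ 2) atTop (𝓝 0) :=
      squeeze_zero (fun t => sq_nonneg _) hg (by simpa using hU.const_mul c)
    have h2 := (Real.continuous_sqrt.tendsto 0).comp h1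
    simp only [Real.sqrt_zero, Function.comp_def, Real.sqrt_sq_eq_abs] at h2
    exact (tendsto_zero_iff_abs_tendsto_zero _).mpr h2
  have hW := fun t => quad_nonneg hμ ha hb (z t) (q t)
  refine ⟨?_, sq0 _ κ fun t => ?_, sq0 _ (4 / 3) fun t => ?_, sq0 _ (4 / 3 * b) fun t => ?_⟩
  · have := sq0 (fun t => α t - abar) κ fun t => by
      have := (hV (α t - abar) (y t)).2.1
      nlinarith [sq_nonneg (y t), mul_nonneg hκ.le (hW t)]
    simpa using this.add_const abar
  · have := (hV (α t - abar) (y t)).2.1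
    nlinarith [sq_nonneg (α t - abar), mul_nonneg hκ.le (hW t)]
  · have := sq_le_quad hμ ha hb (z t) (q t)
    linarith [(hV (α t - abar) (y t)).1]
  · have := sq_le_mul_quad hμ ha hb (z t) (q t)
    nlinarith [mul_nonneg hb0.le (hV (α t - abar) (y t)).1]

lemma continuous_betaBar (abar : ℝ) : Continuous fun p : ℝ × ℝ => betaBar P C abar p.1 p.2 := by
  unfold betaBar
  refine continuous_fst.add ((continuous_thetaBar P C).comp ?_)
  unfold ft; fun_prop

/-- Convergence of the error coordinates and of the cart gives convergence of the state. -/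
lemma tendsto_equilibrium {xbar abar ρ : ℝ} {X : ℝ → Fin 6 → ℝ}
    (h0 : Tendsto (fun t => X t 0) atTop (𝓝 xbar)) (h1 : Tendsto (fun t => X t 1) atTop (𝓝 0))
    (h2 : Tendsto (fun t => X t 2) atTop (𝓝 abar)) (h3 : Tendsto (fun t => X t 3) atTop (𝓝 0))
    (hz : Tendsto (fun t => X t 4 - betaBar P C abar (X t 2) (X t 3) + ρ * X t 3) atTop (𝓝 0))
    (hq : Tendsto (fun t => X t 5 - X t 3) atTop (𝓝 0)) :
    Tendsto X atTop (𝓝 (equilibrium P C xbar abar)) := by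
  have hb : Tendsto (fun t => betaBar P C abar (X t 2) (X t 3)) atTop
      (𝓝 (betaBar P C abar abar 0)) :=
    ((continuous_betaBar (P := P) (C := C) abar).tendsto (abar, 0)).comp (h2.prodMk_nhds h3)
  have h4 : Tendsto (fun t => X t 4) atTop (𝓝 (betaBar P C abar abar 0)) := by
    have := (hz.add hb).sub (h3.const_mul ρ)
    simp only [zero_add, mul_zero, sub_zero] at this
    exact this.congr fun t => by ring
  have h5 : Tendsto (fun t => X t 5) atTop (𝓝 0) := by
    have := hq.add h3
    simp only [zero_add] at this
    exact this.congr fun t => by ring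
  rw [tendsto_pi_nhds]
  intro i
  fin_cases i
  exacts [h0, h1, h2, h3, h4, h5]

variable (P C) in
lemma tendsto_cartAcc {xbar : ℝ} {x v : ℝ → ℝ} (hx : Tendsto x atTop (𝓝 xbar))
    (hv : Tendsto v atTop (𝓝 0)) : Tendsto (fun t => u3 C xbar (x t) (v t) / P.mc) atTop (𝓝 0) := by
  have h : Tendsto (fun t => C.kdx * |v t| + C.kpx * |x t - xbar|) atTop (𝓝 0) := by
    have := (hv.abs.const_mul C.kdx).add ((hx.sub_const xbar).abs.const_mul C.kpx)
    simpa using this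
  have h2 : Tendsto (fun t => u3 C xbar (x t) (v t)) atTop (𝓝 0) :=
    squeeze_zero_norm (fun t => abs_u3_le_linear C xbar (x t) (v t)) h
  simpa using h2.div_const P.mc

/-- At rest the reference force is the tangential weight M g cos ᾱ, and `u1_mul_sin_thetaBar` says
that the thrust at attitude θ̄ produces exactly this force. -/
lemma closedLoop_equilibrium (kp kd xbar abar : ℝ) :
    closedLoop P C kp kd xbar abar (equilibrium P C xbar abar) = 0 := by
  have h3 : u3 C xbar xbar 0 = 0 := by simp [u3, sat_zero]
  have hf : ft P C abar abar 0 = P.M * P.g * Real.cos abar := by unfold ft; ring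
  have hacc : objAcc P C abar abar 0 (betaBar P C abar abar 0 - abar) 0 = 0 := by
    have := I0_mul_objAcc P C abar abar 0 (betaBar P C abar abar 0 - abar) 0
    have e : betaBar P C abar abar 0 - abar = thetaBar P C (ft P C abar abar 0) := by
      unfold betaBar; ring
    rw [e, u1_mul_sin_thetaBar, hf] at this
    rw [e]
    have h2 : P.I0 * objAcc P C abar abar 0 (thetaBar P C (ft P C abar abar 0)) 0 = 0 := by
      rw [hf, this]; ring
    exact (mul_eq_zero.mp h2).resolve_left P.I0_pos.ne'
  funext i
  fin_cases i
  · rfl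
  · change u3 C xbar xbar 0 / P.mc = 0
    rw [h3, zero_div]
  · rfl
  · change objAcc P C abar abar 0 (betaBar P C abar abar 0 - abar) (u3 C xbar xbar 0 / P.mc) = 0
    rw [h3, zero_div, hacc]
  · rfl
  · change u2 kp kd (betaBar P C abar abar 0 - betaBar P C abar abar 0) 0 / P.Iu = 0
    simp [u2]

variable (P C) in
lemma exists_betaBar_lipschitz : ∃ c : ℝ, 0 < c ∧ ∀ abar α y : ℝ,
    |betaBar P C abar α y - betaBar P C abar abar 0| ≤ c * (|α - abar| + |y|) := by
  have hg := gam_pos P C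
  have he := C.eps_pos
  have hkp := C.kpa_pos
  have hkd := C.kda_pos
  have hM := P.M_pos
  have hgg := P.g_pos
  refine ⟨1 + gam P C * C.eps * (C.kpa + C.kda + P.M * P.g), by positivity, fun abar α y => ?_⟩
  have h1 := abs_thetaBar_sub_le P C (ft P C abar α y) (ft P C abar abar 0)
  have hcos : |Real.cos α - Real.cos abar| ≤ |α - abar| := by
    have h := Convex.norm_image_sub_le_of_norm_deriv_le (f := Real.cos) (C := 1) (s := univ)
      (x := abar) (y := α) (fun x _ => Real.differentiable_cos x)
      (fun x _ => by rw [Real.deriv_cos, norm_neg]; exact Real.abs_sin_le_one x) convex_univ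
      (mem_univ _) (mem_univ _)
    simpa using h
  have h2 : |ft P C abar α y - ft P C abar abar 0|
      ≤ (C.kpa + C.kda + P.M * P.g) * (|α - abar| + |y|) := by
    have e : ft P C abar α y - ft P C abar abar 0
      = -C.kpa * (α - abar) - C.kda * y + P.M * P.g * (Real.cos α - Real.cos abar) := by
      unfold ft; ring
    rw [e]
    have k1 := abs_add_le (-C.kpa * (α - abar) - C.kda * y)
      (P.M * P.g * (Real.cos α - Real.cos abar))
    have k2 := abs_sub (-C.kpa * (α - abar)) (C.kda * y)
    rw [abs_mul, abs_mul, abs_neg, abs_of_pos hkp, abs_of_pos hkd] at k2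
    rw [abs_mul (P.M * P.g), abs_of_pos (by positivity : 0 < P.M * P.g)] at k1
    have k3 := mul_le_mul_of_nonneg_left hcos (mul_pos hM hgg).le
    have n1 := abs_nonneg (α - abar)
    have n2 := abs_nonneg y
    linarith [mul_nonneg hkp.le n2, mul_nonneg hkd.le n1, mul_nonneg (mul_pos hM hgg).le n2]
  have h3 := mul_le_mul_of_nonneg_left h2 (mul_pos hg he).le
  have e : betaBar P C abar α y - betaBar P C abar abar 0 = (α - abar)
      + (thetaBar P C (ft P C abar α y) - thetaBar P C (ft P C abar abar 0)) := by
    unfold betaBar; ring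
  rw [e]
  refine (abs_add_le _ _).trans ?_
  linarith [abs_nonneg y]

end closedLoop

/-! ### Local asymptotic stability -/

section stability

variable {P : Plant} {C : Tuning}

/-- Decay of the composite Lyapunov function along attitude motions with a small attitude error,
for attitude loops of rate at least `μ₀`. -/
structure CompositeDecay (P : Plant) (C : Tuning) (cr θ₀ μ₀ c k κ : ℝ) : Prop where
  θ₀_pos : 0 < θ₀
  one_le_μ₀ : 1 ≤ μ₀
  c_pos : 0 < c
  k_pos : 0 < k
  κ_pos : 0 < κ
  incl_bounds : ∀ z y, 0 ≤ inclLyap P C z y ∧ z ^ 2 + y ^ 2 ≤ κ * inclLyap P C z y ∧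
    inclLyap P C z y ≤ κ * (z ^ 2 + y ^ 2)
  decay : ∀ (abar a b μ : ℝ) (ax α y A z q D : ℝ → ℝ), μ₀ ≤ μ → 4 * μ ≤ a → 4 * μ * a ≤ b →
    AttitudeMotion P C abar a b cr ax α y A z q D →
    ∀ t, 0 ≤ t → ∃ d,
      HasDerivWithinAt (fun t => inclLyap P C (α t - abar) (y t) + quad μ b (z t) (q t)) d
        (Ici t) t ∧
      (|z t - a / b * y t| ≤ θ₀ →
        d ≤ -c * (inclLyap P C (α t - abar) (y t) + quad μ b (z t) (q t)) + k * ax t ^ 2)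

variable (P C) in
lemma exists_compositeDecay {cr : ℝ} (hcr : 0 < cr) :
    ∃ θ₀ μ₀ c k κ : ℝ, CompositeDecay P C cr θ₀ μ₀ c k κ := by
  obtain ⟨θ₀, μ₀, c, k, κ, h1, h2, h3, h4, h5, h6, h7⟩ := exists_composite_decay P C hcr
  exact ⟨θ₀, μ₀, c, k, κ, h1, h2, h3, h4, h5, h6, h7⟩

/-- Sublevel sets of the composite Lyapunov function are invariant under small cart
accelerations. -/
lemma CompositeDecay.invariant {cr θ₀ μ₀ c k κ : ℝ} (H : CompositeDecay P C cr θ₀ μ₀ c k κ)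
    {abar a b μ : ℝ} {ax α y A z q D : ℝ → ℝ} (hμ₀ : μ₀ ≤ μ) (ha : 4 * μ ≤ a)
    (hb : 4 * μ * a ≤ b) (h : AttitudeMotion P C abar a b cr ax α y A z q D) {s : ℝ} (hs : 0 < s)
    (hsθ : 2 * s ≤ θ₀)
    (h0 : inclLyap P C (α 0 - abar) (y 0) + quad μ b (z 0) (q 0)
      ≤ s ^ 2 / (κ + 4 / 3 + 4 / 3 * b))
    (hax : ∀ t, 0 ≤ t → k * ax t ^ 2 ≤ c * (s ^ 2 / (κ + 4 / 3 + 4 / 3 * b)) / 2)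
    {t : ℝ} (ht : 0 ≤ t) :
    |α t - abar| ≤ s ∧ |y t| ≤ s ∧ |z t| ≤ s ∧ |q t| ≤ s := by
  have hμ : 0 < μ := by linarith [H.one_le_μ₀]
  have hc := H.c_pos
  have hκ := H.κ_pos
  obtain ⟨ha0, hb0, hab0, hab, -⟩ := gain_ratio_bounds hμ ha hb
  have hab1 : a / b ≤ 1 := hab.trans (by
    rw [div_le_one (by positivity)]; linarith [H.one_le_μ₀])
  -- The denominator adds the constants with which the composite function bounds the squares of the
  -- inclination variables, of z and of q. Below the level U₀ all four variables are thus at most s.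
  obtain ⟨U₀, hU₀⟩ : ∃ U₀, U₀ = s ^ 2 / (κ + 4 / 3 + 4 / 3 * b) := ⟨_, rfl⟩
  have hU₀0 : 0 < U₀ := by rw [hU₀]; positivity
  have hκU : (κ + 4 / 3 + 4 / 3 * b) * U₀ = s ^ 2 := by rw [hU₀]; field_simp
  rw [← hU₀] at h0 hax
  have bound : ∀ τ, inclLyap P C (α τ - abar) (y τ) + quad μ b (z τ) (q τ) ≤ U₀ →
      |α τ - abar| ≤ s ∧ |y τ| ≤ s ∧ |z τ| ≤ s ∧ |q τ| ≤ s := by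
    intro τ hτ
    obtain ⟨hV0, hV1, -⟩ := H.incl_bounds (α τ - abar) (y τ)
    have hW0 := quad_nonneg hμ ha hb (z τ) (q τ)
    have hW1 := sq_le_quad hμ ha hb (z τ) (q τ)
    have hW2 := sq_le_mul_quad hμ ha hb (z τ) (q τ)
    have k1 : κ * inclLyap P C (α τ - abar) (y τ) ≤ κ * U₀ := by gcongr; linarith
    have k2 : 4 / 3 * b * quad μ b (z τ) (q τ) ≤ 4 / 3 * b * U₀ := by gcongr; linarith
    have k3 : 0 ≤ κ * U₀ := by positivity
    have k4 : 0 ≤ 4 / 3 * b * U₀ := by positivity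
    have sq := fun x : ℝ => abs_le_of_sq_le_sq (a := x) (b := s)
    refine ⟨sq _ ?_ hs.le, sq _ ?_ hs.le, sq _ ?_ hs.le, sq _ ?_ hs.le⟩
    · linarith [sq_nonneg (y τ)]
    · linarith [sq_nonneg (α τ - abar)]
    · linarith
    · linarith
  choose d hd using fun t (ht : 0 ≤ t) => H.decay abar a b μ ax α y A z q D hμ₀ ha hb h t ht
  refine bound t (le_of_deriv_right_neg (T := 0)
    (g := fun t => inclLyap P C (α t - abar) (y t) + quad μ b (z t) (q t))
    (g' := fun t => if ht : 0 ≤ t then d t ht else 0)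
    (h.cont_incl.add (h.cont_quad μ))
    (fun t ht => by simp only [dif_pos ht]; exact (hd t ht).1) h0 (fun t ht hU => ?_) t ht)
  simp only [dif_pos ht]
  obtain ⟨-, b2, b3, -⟩ := bound t hU.le
  -- On the level set the error is at most |z| + |y| ≤ 2 s ≤ θ₀, so the decay estimate applies. The
  -- cart forcing takes only half of c U₀, and the derivative is negative.
  have he : |z t - a / b * y t| ≤ θ₀ := by
    refine (abs_sub _ _).trans ?_
    rw [abs_mul, abs_of_pos hab0]
    have := mul_le_of_le_one_left (abs_nonneg (y t)) hab1
    linarith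
  have := (hd t ht).2 he
  rw [hU] at this
  have := hax t ht
  have : 0 < c * U₀ := by positivity
  linarith

set_option maxHeartbeats 400000 in
-- Cascade argument. Stability of the cart keeps its acceleration below what an invariant sublevel
-- set of the composite function tolerates. In that set the attitude error never exceeds θ₀, and the
-- vanishing of the acceleration gives convergence.
theorem asymptoticallyStable_closedLoop {cr θ₀ μ₀ c k κ : ℝ} {kp kd xbar abar : ℝ}
    (H : CompositeDecay P C cr θ₀ μ₀ c k κ)
    (hmotion : ∀ X : ℝ → Fin 6 → ℝ, IsSolution (closedLoop P C kp kd xbar abar) X →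
      (∀ t, 0 ≤ t → HasDerivWithinAt (fun s => X s 0) (X t 1) (Ici 0) t) ∧
      (∀ t, 0 ≤ t → HasDerivWithinAt (fun s => X s 1) (u3 C xbar (X t 0) (X t 1) / P.mc)
        (Ici 0) t) ∧
      ∃ A D : ℝ → ℝ, AttitudeMotion P C abar (kd / P.Iu) (kp / P.Iu) cr
        (fun t => u3 C xbar (X t 0) (X t 1) / P.mc) (fun t => X t 2) (fun t => X t 3) A
        (fun t => X t 4 - betaBar P C abar (X t 2) (X t 3) + kd / P.Iu / (kp / P.Iu) * X t 3)
        (fun t => X t 5 - X t 3) D)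
    {μ : ℝ} (hμ₀ : μ₀ ≤ μ) (ha : 4 * μ ≤ kd / P.Iu) (hb : 4 * μ * (kd / P.Iu) ≤ kp / P.Iu) :
    AsymptoticallyStable (closedLoop P C kp kd xbar abar) (equilibrium P C xbar abar) := by
  have hμ : 0 < μ := by linarith [H.one_le_μ₀]
  have hc := H.c_pos
  have hk := H.k_pos
  have hκ := H.κ_pos
  have hθ₀ := H.θ₀_pos
  have hmc := P.mc_pos
  have hkx := C.kpx_pos
  have hdx := C.kdx_pos
  obtain ⟨ha0, hb0, hab0, hab, -⟩ := gain_ratio_bounds hμ ha hb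
  have hab1 : kd / P.Iu / (kp / P.Iu) ≤ 1 := hab.trans (by
    rw [div_le_one (by positivity)]; linarith [H.one_le_μ₀])
  obtain ⟨ρ, hρ⟩ : ∃ ρ, ρ = kd / P.Iu / (kp / P.Iu) := ⟨_, rfl⟩
  obtain ⟨b, hbdef⟩ : ∃ b, b = kp / P.Iu := ⟨_, rfl⟩
  obtain ⟨cβ, hcβ, hβ⟩ := exists_betaBar_lipschitz P C
  suffices main : ∀ r : ℝ, 0 < r → ∃ δ : ℝ, 0 < δ ∧ ∀ X : ℝ → Fin 6 → ℝ,
      IsSolution (closedLoop P C kp kd xbar abar) X → ‖X 0 - equilibrium P C xbar abar‖ < δ →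
      (∀ t, 0 ≤ t → ‖X t - equilibrium P C xbar abar‖ < r) ∧
      Tendsto X atTop (𝓝 (equilibrium P C xbar abar)) by
    refine ⟨closedLoop_equilibrium kp kd xbar abar, fun r hr => ?_, ?_⟩
    · obtain ⟨δ, hδ, h⟩ := main r hr
      exact ⟨δ, hδ, fun X hX h0 => (h X hX h0).1⟩
    · obtain ⟨δ, hδ, h⟩ := main 1 one_pos
      exact ⟨δ, hδ, fun X hX h0 => (h X hX h0).2⟩
  intro r hr
  -- If the error coordinates are at most s, then β deviates by at most (2 + 2 cβ) s: s from z, s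
  -- from the lag, and 2 cβ s from the variation of the reference.
  obtain ⟨s, hs⟩ : ∃ s, s = min (θ₀ / 2) (r / (2 * (2 + 2 * cβ))) := ⟨_, rfl⟩
  have hs0 : 0 < s := by rw [hs]; positivity
  have hsθ : 2 * s ≤ θ₀ := by
    have := min_le_left (θ₀ / 2) (r / (2 * (2 + 2 * cβ)))
    rw [← hs] at this; linarith
  have hsr : (2 + 2 * cβ) * s < r := by
    have := min_le_right (θ₀ / 2) (r / (2 * (2 + 2 * cβ)))
    rw [← hs, le_div_iff₀ (by positivity)] at this; linarith
  obtain ⟨U₀, hU₀⟩ : ∃ U₀, U₀ = s ^ 2 / (κ + 4 / 3 + 4 / 3 * b) := ⟨_, rfl⟩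
  rw [← hbdef] at hb0
  have hU₀0 : 0 < U₀ := by rw [hU₀]; positivity
  -- Largest cart acceleration under which the sublevel set at U₀ is shown to be invariant.
  obtain ⟨s₂, hs₂⟩ : ∃ s₂, s₂ = √(c * U₀ / 2 / k) := ⟨_, rfl⟩
  have hs₂0 : 0 < s₂ := by rw [hs₂]; positivity
  have hs₂2 : k * s₂ ^ 2 = c * U₀ / 2 := by
    rw [hs₂, Real.sq_sqrt (by positivity)]; field_simp
  obtain ⟨r', hr'⟩ : ∃ r', r' = min r (s₂ * P.mc / (C.kdx + C.kpx)) := ⟨_, rfl⟩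
  have hr'0 : 0 < r' := by rw [hr']; positivity
  obtain ⟨δ₁, hδ₁, hcart⟩ := cart_stable P C xbar hr'0
  -- Factor from the squared initial distance to the composite function, through |z| ≤ (2 + 2 cβ) δ
  -- and |q| ≤ 2 δ.
  obtain ⟨κ₃, hκ₃⟩ : ∃ κ₃, κ₃ = κ * 2 + 5 / 4 * ((2 + 2 * cβ) ^ 2 + 4 / b) := ⟨_, rfl⟩
  have hκ₃0 : 0 < κ₃ := by rw [hκ₃]; positivity
  refine ⟨min δ₁ (√(U₀ / κ₃)), by positivity, fun X hX h0 => ?_⟩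
  obtain ⟨hx, hv, A, D, hM⟩ := hmotion X hX
  rw [← hρ] at hM hab0 hab1
  rw [lt_min_iff] at h0
  have comp : ∀ t i, |X t i - equilibrium P C xbar abar i| ≤ ‖X t - equilibrium P C xbar abar‖ :=
    fun t i => norm_le_pi_norm (X t - equilibrium P C xbar abar) i
  obtain ⟨δ₂, hδ₂⟩ : ∃ δ₂, δ₂ = √(U₀ / κ₃) := ⟨_, rfl⟩
  have hδ₂0 : 0 < δ₂ := by rw [hδ₂]; positivity
  have hδ₂2 : κ₃ * δ₂ ^ 2 = U₀ := by
    rw [hδ₂, Real.sq_sqrt (by positivity)]; field_simp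
  rw [← hδ₂] at h0
  have i0 : |X 0 0 - xbar| < δ₁ := (comp 0 0).trans_lt h0.1
  have i1 : |X 0 1| < δ₁ := by simpa [equilibrium] using (comp 0 1).trans_lt h0.1
  have i2 : |X 0 2 - abar| ≤ δ₂ := ((comp 0 2).trans_lt h0.2).le
  have i3 : |X 0 3| ≤ δ₂ := by simpa [equilibrium] using ((comp 0 3).trans_lt h0.2).le
  have i4 : |X 0 4 - betaBar P C abar abar 0| ≤ δ₂ := ((comp 0 4).trans_lt h0.2).le
  have i5 : |X 0 5| ≤ δ₂ := by simpa [equilibrium] using ((comp 0 5).trans_lt h0.2).le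
  have hxv := hcart _ _ hx hv i0 i1
  have hax : ∀ t, 0 ≤ t → k * (u3 C xbar (X t 0) (X t 1) / P.mc) ^ 2 ≤ c * U₀ / 2 := by
    intro t ht
    obtain ⟨h1, h2⟩ := hxv t ht
    have h3 := abs_u3_le_linear C xbar (X t 0) (X t 1)
    have h4 : r' * (C.kdx + C.kpx) ≤ s₂ * P.mc := by
      rw [← le_div_iff₀ (by positivity), hr']; exact min_le_right _ _
    have h5 : |u3 C xbar (X t 0) (X t 1) / P.mc| ≤ s₂ := by
      rw [abs_div, abs_of_pos hmc, div_le_iff₀ hmc]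
      refine h3.trans (le_trans ?_ h4)
      have := mul_le_mul_of_nonneg_left h1.le hkx.le
      have := mul_le_mul_of_nonneg_left h2.le hdx.le
      linarith
    rw [← hs₂2, ← sq_abs]
    gcongr
  -- initial level
  have hz0 : |X 0 4 - betaBar P C abar (X 0 2) (X 0 3) + ρ * X 0 3| ≤ (2 + 2 * cβ) * δ₂ := by
    have h1 := hβ abar (X 0 2) (X 0 3)
    have h2 : |ρ * X 0 3| ≤ δ₂ := by
      rw [abs_mul, abs_of_pos hab0]
      exact (mul_le_of_le_one_left (abs_nonneg _) hab1).trans i3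
    have e : X 0 4 - betaBar P C abar (X 0 2) (X 0 3) + ρ * X 0 3
      = (X 0 4 - betaBar P C abar abar 0)
        - (betaBar P C abar (X 0 2) (X 0 3) - betaBar P C abar abar 0) + ρ * X 0 3 := by ring
    rw [e]
    refine (abs_add_le _ _).trans ?_
    have h3 := abs_sub (X 0 4 - betaBar P C abar abar 0)
      (betaBar P C abar (X 0 2) (X 0 3) - betaBar P C abar abar 0)
    have h4 := mul_le_mul_of_nonneg_left (add_le_add i2 i3) hcβ.le
    linarith
  have hq0 : |X 0 5 - X 0 3| ≤ 2 * δ₂ := by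
    refine (abs_sub _ _).trans ?_
    linarith
  have hbq : quad μ b (X 0 4 - betaBar P C abar (X 0 2) (X 0 3) + ρ * X 0 3) (X 0 5 - X 0 3)
      ≤ 5 / 4 * ((2 + 2 * cβ) ^ 2 + 4 / b) * δ₂ ^ 2 := by
    rw [← hbdef] at hb
    refine (quad_le hμ ha hb _ _).trans ?_
    have k1 := pow_le_pow_left₀ (abs_nonneg _) hz0 2
    have k2 := pow_le_pow_left₀ (abs_nonneg _) hq0 2
    rw [sq_abs] at k1 k2
    have k3 := div_le_div_of_nonneg_right k2 hb0.le
    have e : (2 * δ₂) ^ 2 / b = 4 / b * δ₂ ^ 2 := by ring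
    rw [e] at k3
    rw [mul_pow] at k1
    linarith
  have hU0 : inclLyap P C (X 0 2 - abar) (X 0 3)
      + quad μ b (X 0 4 - betaBar P C abar (X 0 2) (X 0 3) + ρ * X 0 3) (X 0 5 - X 0 3)
      ≤ U₀ := by
    have k1 := (H.incl_bounds (X 0 2 - abar) (X 0 3)).2.2
    have k2 := pow_le_pow_left₀ (abs_nonneg _) i2 2
    have k3 := pow_le_pow_left₀ (abs_nonneg _) i3 2
    rw [sq_abs] at k2 k3
    have k4 := mul_le_mul_of_nonneg_left (add_le_add k2 k3) hκ.le
    rw [← hδ₂2, hκ₃]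
    linarith
  rw [hU₀] at hU0 hax
  rw [hbdef] at hU0 hax
  have inv : ∀ t, 0 ≤ t → |X t 2 - abar| ≤ s ∧ |X t 3| ≤ s ∧
      |X t 4 - betaBar P C abar (X t 2) (X t 3) + ρ * X t 3| ≤ s ∧ |X t 5 - X t 3| ≤ s :=
    fun t ht => H.invariant hμ₀ ha hb hM hs0 hsθ hU0 hax ht
  refine ⟨fun t ht => ?_, ?_⟩
  · obtain ⟨j2, j3, j4, j5⟩ := inv t ht
    obtain ⟨j0, j1⟩ := hxv t ht
    have hr'r : r' ≤ r := by rw [hr']; exact min_le_left _ _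
    have hcs := mul_pos hcβ hs0
    have hsr' : s < r := by linarith
    have k4 : |X t 4 - betaBar P C abar abar 0| ≤ (2 + 2 * cβ) * s := by
      have h1 := hβ abar (X t 2) (X t 3)
      have h2 : |ρ * X t 3| ≤ s := by
        rw [abs_mul, abs_of_pos hab0]
        exact (mul_le_of_le_one_left (abs_nonneg _) hab1).trans j3
      have e : X t 4 - betaBar P C abar abar 0
        = (X t 4 - betaBar P C abar (X t 2) (X t 3) + ρ * X t 3) - ρ * X t 3
        + (betaBar P C abar (X t 2) (X t 3) - betaBar P C abar abar 0) := by ring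
      rw [e]
      refine (abs_add_le _ _).trans ?_
      have h3 := abs_sub (X t 4 - betaBar P C abar (X t 2) (X t 3) + ρ * X t 3) (ρ * X t 3)
      have h4 := mul_le_mul_of_nonneg_left (add_le_add j2 j3) hcβ.le
      linarith
    have k5 : |X t 5| ≤ 2 * s := by
      have e : X t 5 = (X t 5 - X t 3) + X t 3 := by ring
      rw [e]
      refine (abs_add_le _ _).trans ?_
      linarith
    have h2s : 2 * s < r := by linarith
    rw [pi_norm_lt_iff hr]
    intro i
    fin_cases i
    · exact j0.trans_le hr'r
    · simpa [equilibrium] using j1.trans_le hr'r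
    · exact j2.trans_lt hsr'
    · simpa [equilibrium] using j3.trans_lt hsr'
    · exact k4.trans_lt hsr
    · simpa [equilibrium] using k5.trans_lt h2s
  · obtain ⟨hx', hv'⟩ := cart_tendsto P C hx hv
    obtain ⟨t2, t3, t4, t5⟩ := AttitudeMotion.tendsto (θ₀ := θ₀) (k := k) hκ hc H.incl_bounds hμ ha hb hM
      (H.decay abar _ _ μ _ _ _ _ _ _ _ hμ₀ ha hb hM)
      (by
        filter_upwards [eventually_ge_atTop 0] with t ht
        obtain ⟨-, j3, j4, -⟩ := inv t ht
        refine (abs_sub _ _).trans ?_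
        rw [← hρ, abs_mul, abs_of_pos hab0]
        have := mul_le_of_le_one_left (abs_nonneg (X t 3)) hab1
        linarith) (tendsto_cartAcc P C hx' hv')
    exact tendsto_equilibrium hx' hv' t2 t3 t4 t5

end stability

/-! ### Energy of large motions -/

section barrier

/-- Kinetic energy adapted to the effectiveness `cos (r Y)` of the thrust, truncated at `c`. -/
noncomputable def barrier (c r Y : ℝ) : ℝ := ∫ s in (0 : ℝ)..Y, s / max c (Real.cos (r * s))

variable {c r : ℝ}

/-- The truncation keeps the denominator positive on the whole line, so the energy can be
differentiated before cos (r Y) is known to stay positive. -/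
lemma continuous_barrier_integrand (hc : 0 < c) (r : ℝ) :
    Continuous fun s : ℝ => s / max c (Real.cos (r * s)) := by
  refine continuous_id.div (by fun_prop) fun s => ?_
  exact (hc.trans_le (le_max_left _ _)).ne'

lemma hasDerivAt_barrier (hc : 0 < c) (r Y : ℝ) :
    HasDerivAt (barrier c r) (Y / max c (Real.cos (r * Y))) Y :=
  intervalIntegral.integral_hasDerivAt_right
    ((continuous_barrier_integrand hc r).intervalIntegrable _ _)
    ((continuous_barrier_integrand hc r).stronglyMeasurableAtFilter _ _)
    (continuous_barrier_integrand hc r).continuousAt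

lemma barrier_zero (c r : ℝ) : barrier c r 0 = 0 := by simp [barrier]

lemma barrier_neg (c r Y : ℝ) : barrier c r (-Y) = barrier c r Y := by
  unfold barrier
  have h := intervalIntegral.integral_comp_neg (a := 0) (b := Y)
    (fun s : ℝ => s / max c (Real.cos (r * s)))
  rw [neg_zero] at h
  have h2 : (fun x : ℝ => -x / max c (Real.cos (r * -x)))
      = fun x => -(x / max c (Real.cos (r * x))) := by
    funext x; rw [mul_neg, Real.cos_neg, neg_div]
  simp only [h2, intervalIntegral.integral_neg] at h
  rw [intervalIntegral.integral_symm (-Y) 0]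
  linarith

lemma barrier_abs (c r Y : ℝ) : barrier c r |Y| = barrier c r Y := by
  rcases abs_choice Y with h | h <;> rw [h]
  exact barrier_neg c r Y

lemma le_of_deriv_le_of_nonneg {f g f' g' : ℝ → ℝ} {Y : ℝ} (hY : 0 ≤ Y)
    (hf : ∀ s ∈ Icc 0 Y, HasDerivAt f (f' s) s) (hg : ∀ s ∈ Icc 0 Y, HasDerivAt g (g' s) s)
    (h0 : f 0 ≤ g 0) (h : ∀ s ∈ Icc 0 Y, f' s ≤ g' s) : f Y ≤ g Y :=
  image_le_of_deriv_right_le_deriv_boundary (a := 0) (b := Y)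
    (fun s hs => (hf s hs).continuousAt.continuousWithinAt)
    (fun s hs => (hf s (Ico_subset_Icc_self hs)).hasDerivWithinAt) h0
    (fun s hs => (hg s hs).continuousAt.continuousWithinAt)
    (fun s hs => (hg s (Ico_subset_Icc_self hs)).hasDerivWithinAt)
    (fun s hs => h s (Ico_subset_Icc_self hs)) (right_mem_Icc.mpr hY)

lemma hasDerivAt_half_sq (w s : ℝ) : HasDerivAt (fun s : ℝ => w * s ^ 2 / 2) (w * s) s := by
  have := (((hasDerivAt_id s).pow 2).const_mul w).div_const 2
  simp only [id] at this
  refine this.congr_deriv ?_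
  push_cast; ring

lemma half_sq_le_barrier (hc : 0 < c) (hc1 : c ≤ 1) (r Y : ℝ) : Y ^ 2 / 2 ≤ barrier c r Y := by
  rw [← barrier_abs, ← sq_abs]
  have := le_of_deriv_le_of_nonneg (abs_nonneg Y) (fun s _ => hasDerivAt_half_sq 1 s)
    (fun s _ => hasDerivAt_barrier hc r s) (by simp [barrier_zero]) (fun s hs => by
      rw [one_mul, le_div_iff₀ (hc.trans_le (le_max_left _ _))]
      exact mul_le_of_le_one_right hs.1 (max_le hc1 (Real.cos_le_one _)))
  simpa using this

lemma barrier_le_half_sq (hc : 0 < c) {r w Y : ℝ} (hw : 0 < w)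
    (h : ∀ s, |s| ≤ |Y| → w ≤ max c (Real.cos (r * s))) :
    barrier c r Y ≤ 1 / w * Y ^ 2 / 2 := by
  rw [← barrier_abs, ← sq_abs]
  refine le_of_deriv_le_of_nonneg (abs_nonneg Y) (fun s _ => hasDerivAt_barrier hc r s)
    (fun s _ => hasDerivAt_half_sq (1 / w) s) (by simp [barrier_zero]) (fun s hs => ?_)
  rw [one_div_mul_eq_div]
  exact div_le_div_of_nonneg_left hs.1 hw (h s (by rw [abs_of_nonneg hs.1]; exact hs.2))

/-- Sublevel sets of the barrier keep `cos (r Y)` away from zero. -/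
lemma le_cos_of_barrier_lt (hc : 0 < c) (hc1 : c < 1) (hr : 0 < r) (hr1 : r ≤ 1) {Y : ℝ}
    (h : barrier c r Y < -Real.log c) : c ≤ Real.cos (r * Y) := by
  rw [← barrier_abs] at h
  have hcos : Real.cos (r * Y) = Real.cos (r * |Y|) := by
    rcases abs_choice Y with h | h <;> rw [h]
    rw [mul_neg, Real.cos_neg]
  rw [hcos]
  by_contra! hlt
  set u := Real.arccos c with hu
  have hcu : Real.cos u = c := Real.cos_arccos (by linarith) hc1.le
  have hu0 : 0 < u := Real.arccos_pos.mpr hc1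
  have hu2 : u < Real.pi / 2 := Real.arccos_lt_pi_div_two.mpr hc
  have hlt2 : u < r * |Y| := by
    by_contra! hle
    have := Real.cos_le_cos_of_nonneg_of_le_pi (by positivity) (by linarith) hle
    linarith
  have hYu : u / r ≤ |Y| := by rw [div_le_iff₀ hr]; linarith
  have h1 : barrier c r (u / r) ≤ barrier c r |Y| := by
    have hd : ∀ s ∈ Icc (0 : ℝ) (|Y| - u / r),
        HasDerivAt (fun s => barrier c r (s + u / r))
          ((s + u / r) / max c (Real.cos (r * (s + u / r)))) s := fun s _ => by
      have := (hasDerivAt_barrier hc r (s + u / r)).comp_add_const s (u / r)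
      exact this
    have := le_of_deriv_le_of_nonneg (sub_nonneg.mpr hYu)
      (fun s _ => hasDerivAt_const s (barrier c r (u / r))) hd (by simp) (fun s hs => by
        have := hs.1
        exact div_nonneg (by positivity) (hc.le.trans (le_max_left _ _)))
    simpa using this
  -- Up to u/r the truncation is inactive. There the derivative r tan(r s) of -log cos(r s) is at
  -- most s/cos(r s), because sin(r s) ≤ r s and r ≤ 1. At u/r the left side equals -log c.
  have h2 : -Real.log (Real.cos (r * (u / r))) ≤ barrier c r (u / r) := by
    have hrange : ∀ s ∈ Icc (0 : ℝ) (u / r), c ≤ Real.cos (r * s) := fun s hs => by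
      rw [← hcu]
      have h3 : r * s ≤ u := by have := hs.2; rw [le_div_iff₀ hr] at this; linarith
      exact Real.cos_le_cos_of_nonneg_of_le_pi (mul_nonneg hr.le hs.1) (by linarith) h3
    have hd : ∀ s ∈ Icc (0 : ℝ) (u / r), HasDerivAt (fun s => -Real.log (Real.cos (r * s)))
        (r * Real.sin (r * s) / Real.cos (r * s)) s := fun s hs => by
      have hl : HasDerivAt (fun s => r * s) r s := by simpa using (hasDerivAt_id s).const_mul r
      have := (hl.cos.log (hc.trans_le (hrange s hs)).ne').fun_neg
      exact this.congr_deriv (by ring)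
    refine le_of_deriv_le_of_nonneg (f := fun s => -Real.log (Real.cos (r * s))) (by positivity) hd
      (fun s _ => hasDerivAt_barrier hc r s) (by simp [barrier_zero]) (fun s hs => ?_)
    have hcs := hrange s hs
    rw [max_eq_right hcs]
    apply div_le_div_of_nonneg_right _ (hc.le.trans hcs)
    have h4 : Real.sin (r * s) ≤ r * s := Real.sin_le (mul_nonneg hr.le hs.1)
    have h5 : r * Real.sin (r * s) ≤ r * (r * s) := mul_le_mul_of_nonneg_left h4 hr.le
    have h6 : r * (r * s) ≤ 1 * (1 * s) := by
      have := hs.1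
      gcongr
    linarith
  rw [mul_div_cancel₀ _ hr.ne', hcu] at h2
  linarith

end barrier

section energy

/-- Energy of the inclination `x` and its rate `Y`, in units of the attitude bandwidth. -/
noncomputable def energy (k J κ c r x Y : ℝ) : ℝ :=
  k * x ^ 2 / 2 + J * barrier c r Y + κ * J * (x * Y)

variable {k d J κ c r : ℝ}

lemma abs_energy_cross_le (hk : 0 < k) (hJ : 0 < J) (hκ2 : 4 * κ ^ 2 * J ≤ k) (hc : 0 < c)
    (hc1 : c ≤ 1) (r x Y : ℝ) :
    |κ * J * (x * Y)| ≤ k * x ^ 2 / 4 + J * barrier c r Y / 2 := by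
  have hb := half_sq_le_barrier hc hc1 r Y
  have h1 : J * Y ^ 2 / 4 ≤ J * barrier c r Y / 2 := by nlinarith
  have e1 : k * x ^ 2 / 4 + κ ^ 2 * J ^ 2 * Y ^ 2 / k - κ * J * (x * Y)
      = (k * x - 2 * κ * J * Y) ^ 2 / (4 * k) := by field_simp; ring
  have e2 : k * x ^ 2 / 4 + κ ^ 2 * J ^ 2 * Y ^ 2 / k + κ * J * (x * Y)
      = (k * x + 2 * κ * J * Y) ^ 2 / (4 * k) := by field_simp; ring
  have n1 : 0 ≤ (k * x - 2 * κ * J * Y) ^ 2 / (4 * k) := by positivity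
  have n2 : 0 ≤ (k * x + 2 * κ * J * Y) ^ 2 / (4 * k) := by positivity
  have h2 : κ ^ 2 * J ^ 2 * Y ^ 2 / k ≤ J * Y ^ 2 / 4 := by
    rw [div_le_iff₀ hk]
    have := mul_le_mul_of_nonneg_right hκ2 (show 0 ≤ J * Y ^ 2 / 4 by positivity)
    linarith
  rw [abs_le]
  constructor <;> linarith

lemma le_energy (hk : 0 < k) (hJ : 0 < J) (hκ2 : 4 * κ ^ 2 * J ≤ k) (hc : 0 < c) (hc1 : c ≤ 1)
    (r x Y : ℝ) : k * x ^ 2 / 4 + J * barrier c r Y / 2 ≤ energy k J κ c r x Y := by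
  have := (abs_le.mp (abs_energy_cross_le hk hJ hκ2 hc hc1 r x Y)).1
  unfold energy; linarith

lemma energy_le (hk : 0 < k) (hJ : 0 < J) (hκ2 : 4 * κ ^ 2 * J ≤ k) (hc : 0 < c) (hc1 : c ≤ 1)
    (r x Y : ℝ) :
    energy k J κ c r x Y ≤ 3 * k * x ^ 2 / 4 + 3 * J * barrier c r Y / 2 := by
  have := (abs_le.mp (abs_energy_cross_le hk hJ hκ2 hc hc1 r x Y)).2
  unfold energy; linarith

lemma hasDerivWithinAt_energy (hc : 0 < c) {x Y : ℝ → ℝ} {x' Y' t : ℝ} {s : Set ℝ}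
    (hx : HasDerivWithinAt x x' s t) (hY : HasDerivWithinAt Y Y' s t) :
    HasDerivWithinAt (fun τ => energy k J κ c r (x τ) (Y τ))
      (k * x t * x' + J * (Y t / max c (Real.cos (r * Y t)) * Y')
        + κ * J * (x' * Y t + x t * Y')) s t := by
  unfold energy
  refine ((((hx.fun_pow 2).const_mul k).div_const 2).fun_add
    (((hasDerivAt_barrier hc r (Y t)).comp_hasDerivWithinAt t hY).const_mul J)).fun_add
    ((hx.fun_mul hY).const_mul (κ * J)) |>.congr_deriv ?_
  push_cast; ring

/-- Dissipation of the energy for `J Y' = -(k x + d Y) co + δ`. -/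
lemma energy_deriv_le (hk : 0 < k) (hd : 0 < d) (hκ : 0 < κ)
    (hκd : κ * (J + d ^ 2 / (2 * k)) ≤ d / 2) (hc : 0 < c) {co B x Y Y' δ : ℝ} (hco : c ≤ co)
    (hco1 : co ≤ 1) (hB : |Y / co + κ * x| ≤ B) (hY' : J * Y' = -((k * x + d * Y) * co) + δ) :
    k * x * Y + J * (Y / co * Y') + κ * J * (Y * Y + x * Y')
      ≤ -min (κ * k * c / 2) (d / 2) * (x ^ 2 + Y ^ 2) + B * |δ| := by
  have hco0 : 0 < co := hc.trans_le hco
  have e : k * x * Y + J * (Y / co * Y') + κ * J * (Y * Y + x * Y')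
      = k * x * Y + Y / co * (J * Y') + κ * J * Y ^ 2 + κ * x * (J * Y') := by ring
  -- Division of the momentum by the effectiveness co cancels the indefinite term k x Y and leaves
  -- the full damping -d Y². The cross term supplies the dissipation in x.
  have e2 : k * x * Y + Y / co * (J * Y') + κ * J * Y ^ 2 + κ * x * (J * Y')
      = -(d * Y ^ 2) + κ * J * Y ^ 2 - κ * co * (k * x ^ 2 + d * (x * Y))
        + (Y / co + κ * x) * δ := by
    rw [hY']; field_simp; ring
  rw [e, e2]
  have h1 : (Y / co + κ * x) * δ ≤ B * |δ| :=
    (le_abs_self _).trans (by rw [abs_mul]; exact mul_le_mul_of_nonneg_right hB (abs_nonneg _))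
  have h2 : -(k * x ^ 2 / 2) - d ^ 2 / (2 * k) * Y ^ 2 ≤ d * (x * Y) := by
    have e3 : d * (x * Y) + k * x ^ 2 / 2 + d ^ 2 / (2 * k) * Y ^ 2
        = (k * x + d * Y) ^ 2 / (2 * k) := by field_simp; ring
    have : 0 ≤ (k * x + d * Y) ^ 2 / (2 * k) := by positivity
    linarith
  have h3 : k * x ^ 2 / 2 - d ^ 2 / (2 * k) * Y ^ 2 ≤ k * x ^ 2 + d * (x * Y) := by linarith
  have h4 := mul_le_mul_of_nonneg_left h3 (mul_pos hκ hco0).le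
  have h5 : κ * k * c / 2 * x ^ 2 ≤ κ * co * (k * x ^ 2 / 2) := by
    have := mul_le_mul_of_nonneg_right hco (show 0 ≤ κ * k * x ^ 2 / 2 by positivity)
    linarith
  have h6 : κ * co * (d ^ 2 / (2 * k) * Y ^ 2) ≤ κ * (d ^ 2 / (2 * k)) * Y ^ 2 := by
    have := mul_le_mul_of_nonneg_right hco1 (show 0 ≤ κ * (d ^ 2 / (2 * k)) * Y ^ 2 by positivity)
    linarith
  have h7 := mul_le_mul_of_nonneg_right hκd (sq_nonneg Y)
  have h8 := mul_le_mul_of_nonneg_right (min_le_left (κ * k * c / 2) (d / 2)) (sq_nonneg x)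
  have h9 := mul_le_mul_of_nonneg_right (min_le_right (κ * k * c / 2) (d / 2)) (sq_nonneg Y)
  linarith

end energy

/-! ### Large motions -/

section rates

variable {m c U f f' A D ρ p W W' r : ℝ}

/-- The acceleration, of order m, is reduced to order one by ρ ≤ 1/m. Only the reference rate D can
be a large forcing. -/
lemma forcing_sq_div_le (hm : 1 ≤ m) (hρ0 : 0 ≤ ρ) (hρ : ρ ≤ 1 / m) (hA : |A| ≤ c * m) :
    20 * (ρ * A - D) ^ 2 / m ≤ (40 * c ^ 2 + 40 * D ^ 2) / m := by
  have hm0 : 0 < m := by linarith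
  have h1 : |ρ * A| ≤ c := by
    rw [abs_mul, abs_of_nonneg hρ0]
    calc ρ * |A| ≤ 1 / m * (c * m) := mul_le_mul hρ hA (abs_nonneg _) (by positivity)
      _ = c := by field_simp
  have h2 := pow_le_pow_left₀ (abs_nonneg _) h1 2
  rw [sq_abs] at h2
  apply div_le_div_of_nonneg_right _ hm0.le
  linarith [sq_nonneg (ρ * A + D)]

lemma acc_sq_div_le (hm : 1 ≤ m) (hA : |A| ≤ c * m) (hr : m ^ 3 ≤ r) :
    5 * A ^ 2 / r ≤ 5 * c ^ 2 / m := by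
  have hm0 : 0 < m := by linarith
  have h2 := pow_le_pow_left₀ (abs_nonneg _) hA 2
  rw [sq_abs] at h2
  calc 5 * A ^ 2 / r ≤ 5 * (c * m) ^ 2 / m ^ 3 :=
        div_le_div₀ (by positivity) (by linarith) (by positivity) hr
    _ = _ := by field_simp

/-- Crude estimate: with D of order m the attitude error is merely bounded, not small. -/
lemma attitude_rate_le (hm : 1 ≤ m) (hρ0 : 0 ≤ ρ) (hρ : ρ ≤ 1 / m) (hA : |A| ≤ c * m)
    (hD : |D| ≤ c * m) (hr : m ^ 3 ≤ r)
    (hW' : W' ≤ -(m / 5) * W + 20 * (ρ * A - D) ^ 2 / m + 5 * A ^ 2 / r) :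
    W' ≤ -(m / 5) * W + 85 * c ^ 2 * m := by
  have hm0 : 0 < m := by linarith
  have h1 := forcing_sq_div_le (D := D) hm hρ0 hρ hA
  have h2 := acc_sq_div_le hm hA hr
  have h3 := pow_le_pow_left₀ (abs_nonneg _) hD 2
  rw [sq_abs, mul_pow] at h3
  have hc2 := sq_nonneg c
  have hcm : c ^ 2 ≤ c ^ 2 * m ^ 2 := le_mul_of_one_le_right hc2 (one_le_pow₀ hm)
  have h4 : (40 * c ^ 2 + 40 * D ^ 2) / m ≤ 80 * c ^ 2 * m := by
    rw [div_le_iff₀ hm0]; linarith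
  have h5 : 5 * c ^ 2 / m ≤ 5 * c ^ 2 * m := by
    rw [div_le_iff₀ hm0]; linarith
  linarith

/-- The attitude error weighted by the thrust is hardly excited by reversals of the thrust. -/
lemma weighted_rate_le (hm : 1 ≤ m) (hW : 0 ≤ W) (hρ0 : 0 ≤ ρ) (hρ : ρ ≤ 1 / m)
    (hA : |A| ≤ c * m) (hD : |D| ≤ c * m) (hf : |f| ≤ c * m) (hf' : |f'| ≤ c * m)
    (hsat : U < |f| → D = 0) (hr : m ^ 3 ≤ r)
    (hW' : W' ≤ -(m / 5) * W + 20 * (ρ * A - D) ^ 2 / m + 5 * A ^ 2 / r) :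
    (f / m) ^ 2 * W' + 2 * (f / m) * (f' / m) * W
      ≤ -(m / 10) * ((f / m) ^ 2 * W) + (45 * c ^ 4 + 40 * U ^ 2 * c ^ 2 + 10 * c ^ 2 * W) / m := by
  have hm0 : 0 < m := by linarith
  have h1 := forcing_sq_div_le (D := D) hm hρ0 hρ hA
  have h2 := acc_sq_div_le hm hA hr
  have ratio : ∀ g : ℝ, |g| ≤ c * m → (g / m) ^ 2 ≤ c ^ 2 := fun g hg => by
    rw [← sq_abs, abs_div, abs_of_pos hm0]
    exact pow_le_pow_left₀ (by positivity) (by rw [div_le_iff₀ hm0]; exact hg) 2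
  have hφ := ratio f hf
  have hψ := ratio f' hf'
  -- The crucial gain from saturation: the reference moves only while |f| ≤ U, and then the weight
  -- (f/m)² compensates D² ≤ c² m².
  have hφD : (f / m) ^ 2 * D ^ 2 ≤ U ^ 2 * c ^ 2 := by
    by_cases h : U < |f|
    · rw [hsat h]
      have : 0 ≤ U ^ 2 * c ^ 2 := by positivity
      simpa using this
    · have h3 := pow_le_pow_left₀ (abs_nonneg _) hD 2
      have h4 := pow_le_pow_left₀ (abs_nonneg _) (not_lt.mp h) 2
      rw [sq_abs] at h3 h4
      calc (f / m) ^ 2 * D ^ 2 ≤ (f / m) ^ 2 * (c * m) ^ 2 := by gcongr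
        _ = f ^ 2 * c ^ 2 := by field_simp
        _ ≤ _ := by gcongr
  obtain ⟨φ, hφ'⟩ : ∃ φ, φ = f / m := ⟨_, rfl⟩
  obtain ⟨ψ, hψ'⟩ : ∃ ψ, ψ = f' / m := ⟨_, rfl⟩
  rw [← hφ'] at hφ hφD ⊢
  rw [← hψ'] at hψ ⊢
  have k1 : φ ^ 2 * W' ≤ φ ^ 2 * (-(m / 5) * W + (40 * c ^ 2 + 40 * D ^ 2) / m + 5 * c ^ 2 / m) :=
    mul_le_mul_of_nonneg_left (by linarith) (sq_nonneg _)
  have k2 : φ ^ 2 * (-(m / 5) * W + (40 * c ^ 2 + 40 * D ^ 2) / m + 5 * c ^ 2 / m)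
      = -(m / 5) * (φ ^ 2 * W) + (45 * (φ ^ 2 * c ^ 2) + 40 * (φ ^ 2 * D ^ 2)) / m := by
    field_simp; ring
  have k3 : (45 * (φ ^ 2 * c ^ 2) + 40 * (φ ^ 2 * D ^ 2)) / m
      ≤ (45 * c ^ 4 + 40 * U ^ 2 * c ^ 2) / m := by
    apply div_le_div_of_nonneg_right _ hm0.le
    have := mul_le_mul_of_nonneg_right hφ (sq_nonneg c)
    have e : c ^ 4 = c ^ 2 * c ^ 2 := by ring
    linarith
  -- The variation of the weight is paid for by half of the decay rate m/5.
  have k4 : 2 * φ * ψ ≤ m / 10 * φ ^ 2 + 10 * c ^ 2 / m := by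
    have e : m / 10 * φ ^ 2 + 10 * ψ ^ 2 / m - 2 * φ * ψ = (m * φ - 10 * ψ) ^ 2 / (10 * m) := by
      field_simp; ring
    have n : 0 ≤ (m * φ - 10 * ψ) ^ 2 / (10 * m) := by positivity
    have : 10 * ψ ^ 2 / m ≤ 10 * c ^ 2 / m := by
      apply div_le_div_of_nonneg_right _ hm0.le; linarith
    linarith
  have k5 := mul_le_mul_of_nonneg_right k4 hW
  have e : (45 * c ^ 4 + 40 * U ^ 2 * c ^ 2 + 10 * c ^ 2 * W) / m
    = (45 * c ^ 4 + 40 * U ^ 2 * c ^ 2) / m + 10 * c ^ 2 / m * W := by ring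
  rw [e]
  linarith

/-- Rate of the Lyapunov function of large motions, from the rates of its three parts. -/
lemma excursion_rate_le {n B cs lam Q c₃ cE CE c₅ s E E' S S' δ ζ φ : ℝ} (hn : 1 ≤ n)
    (hB : 0 ≤ B) (hcs : 0 ≤ cs) (hlam : 0 ≤ lam) (hQ : Q = 10 * (B + 1)) (hc₃ : 0 ≤ c₃)
    (hn' : 10 * (2 * (B * cs) + 10 * Q * c ^ 2) ≤ n)
    (hs : 0 ≤ s) (hW : 0 ≤ W) (hS : S = φ ^ 2 * W) (hEs : E ≤ CE * s)
    (hc₅ : 0 ≤ c₅) (h51 : c₅ * CE ≤ cE) (h52 : c₅ * Q ≤ 1) (h53 : c₅ ≤ 1 / 10)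
    (hE' : E' ≤ -cE * s + B * δ) (hδ : δ ≤ (cs * (1 + lam + ζ)) / n ^ 2 + |φ| * ζ)
    (hζ : ζ ^ 2 ≤ 4 / 3 * W)
    (hS' : S' ≤ -(n ^ 2 / 10) * S + (c₃ + 10 * c ^ 2 * W) / n ^ 2)
    (hW' : W' ≤ -(n ^ 2 / 5) * W + 85 * c ^ 2 * n ^ 2) :
    E' + Q / n * S' + W' / n ^ 3
      ≤ -c₅ * (E + Q / n * S + W / n ^ 3)
        + (B * cs * (2 + lam) + B + Q * c₃ + 85 * c ^ 2) / n := by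
  have hn0 : 0 < n := by linarith
  have hQ0 : 0 < Q := by rw [hQ]; linarith
  have hS0 : 0 ≤ S := by rw [hS]; positivity
  obtain ⟨h, hh⟩ : ∃ h, h = 1 / n := ⟨_, rfl⟩
  have hnh : n * h = 1 := by rw [hh]; field_simp
  have hh0 : 0 < h := by rw [hh]; positivity
  have hh1 : h ≤ 1 := by rw [hh, div_le_one hn0]; exact hn
  have hh2 : h ^ 2 ≤ h := by nlinarith
  have hh3 : h ^ 3 ≤ h := by nlinarith
  have hh32 : h ^ 3 ≤ h ^ 2 := by nlinarith [sq_nonneg h]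
  -- the perturbation of the energy
  have a1 : ζ ≤ 1 + W := by nlinarith [sq_nonneg (ζ - 1)]
  -- Young's inequality with weight n. The resulting loss B n S in the energy rate is covered by the
  -- decay (Q/n)(n²/10) S = (B + 1) n S of the weighted term, which fixes Q.
  have a2 : |φ| * ζ ≤ n * S + h := by
    have e : n * (|φ| * ζ) ^ 2 / 2 + h / 2 - |φ| * ζ = h * (n * (|φ| * ζ) - 1) ^ 2 / 2 := by
      have e1 : h * (n * (|φ| * ζ) - 1) ^ 2 / 2
        = (n * h) * n * (|φ| * ζ) ^ 2 / 2 - (n * h) * (|φ| * ζ) + h / 2 := by ring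
      rw [e1, hnh]; ring
    have e0 : 0 ≤ h * (n * (|φ| * ζ) - 1) ^ 2 / 2 := by positivity
    have e2 : (|φ| * ζ) ^ 2 ≤ 4 / 3 * S := by
      rw [mul_pow, sq_abs, hS]
      have := mul_le_mul_of_nonneg_left hζ (sq_nonneg φ)
      linarith
    have e3 := mul_le_mul_of_nonneg_left e2 hn0.le
    have e4 : 0 ≤ n * S := by positivity
    linarith
  have a3 : (cs * (1 + lam + ζ)) / n ^ 2 ≤ cs * (2 + lam + W) * h ^ 2 := by
    have e : (cs * (1 + lam + ζ)) / n ^ 2 = cs * (1 + lam + ζ) * h ^ 2 := by rw [hh]; field_simp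
    rw [e]
    exact mul_le_mul_of_nonneg_right (mul_le_mul_of_nonneg_left (by linarith) hcs) (sq_nonneg h)
  have a4 : B * δ ≤ B * cs * (2 + lam) * h + B * cs * W * h ^ 2 + B * (n * S) + B * h := by
    have := mul_le_mul_of_nonneg_left (hδ.trans (add_le_add a3 a2)) hB
    have k := mul_le_mul_of_nonneg_left hh2 (show 0 ≤ B * cs * (2 + lam) by positivity)
    linarith
  -- the weighted attitude error
  have b1 : Q / n * S' ≤ -((B + 1) * (n * S)) + Q * c₃ * h + 10 * Q * c ^ 2 * W * h ^ 2 := by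
    have e1 : Q / n = Q * h := by rw [hh]; ring
    have e2 : (c₃ + 10 * c ^ 2 * W) / n ^ 2 = (c₃ + 10 * c ^ 2 * W) * h ^ 2 := by
      rw [hh]; field_simp
    rw [e2] at hS'
    have k1 := mul_le_mul_of_nonneg_left hS' (mul_pos hQ0 hh0).le
    have k2 : Q * h * (-(n ^ 2 / 10) * S) = -((B + 1) * (n * S)) := by
      rw [hQ]
      have : 10 * (B + 1) * h * (-(n ^ 2 / 10) * S) = -((B + 1) * ((n * h) * n * S)) := by ring
      rw [this, hnh, one_mul]
    have k3 := mul_le_mul_of_nonneg_left hh3 (show 0 ≤ Q * c₃ by positivity)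
    have k4 := mul_le_mul_of_nonneg_left hh32 (show 0 ≤ 10 * Q * c ^ 2 * W by positivity)
    rw [e1]
    have k5 : Q * h * (-(n ^ 2 / 10) * S + (c₃ + 10 * c ^ 2 * W) * h ^ 2)
      = Q * h * (-(n ^ 2 / 10) * S) + Q * c₃ * h ^ 3 + 10 * Q * c ^ 2 * W * h ^ 3 := by ring
    linarith
  -- the attitude error
  have c1 : W' / n ^ 3 ≤ -(h / 5 * W) + 85 * c ^ 2 * h := by
    have e : W' / n ^ 3 = W' * h ^ 3 := by rw [hh]; field_simp
    rw [e]
    have k1 := mul_le_mul_of_nonneg_right hW' (pow_pos hh0 3).le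
    have k2 : (-(n ^ 2 / 5) * W + 85 * c ^ 2 * n ^ 2) * h ^ 3
      = (n * h) ^ 2 * (-(h / 5 * W) + 85 * c ^ 2 * h) := by ring
    rw [k2, hnh] at k1
    linarith
  have c2 : B * cs * W * h ^ 2 + 10 * Q * c ^ 2 * W * h ^ 2 ≤ h / 10 * W := by
    have k1 : 10 * (2 * (B * cs) + 10 * Q * c ^ 2) * h ≤ 1 := by
      rw [← hnh]; exact mul_le_mul_of_nonneg_right hn' hh0.le
    have k2 := mul_le_mul_of_nonneg_right k1 (show 0 ≤ h * W by positivity)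
    have k3 : 0 ≤ B * cs * W * h ^ 2 := by positivity
    linarith
  -- decay
  have d1 : c₅ * E ≤ cE * s := by
    have k1 := mul_le_mul_of_nonneg_left hEs hc₅
    have k2 := mul_le_mul_of_nonneg_right h51 hs
    linarith
  have d2 : c₅ * (Q / n * S) ≤ n * S := by
    have e1 : c₅ * (Q / n * S) = (c₅ * Q) * (h * S) := by rw [hh]; ring
    have k1 : h * S ≤ n * S := mul_le_mul_of_nonneg_right (hh1.trans hn) hS0
    have k2 : (c₅ * Q) * (h * S) ≤ 1 * (h * S) :=
      mul_le_mul_of_nonneg_right h52 (by positivity)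
    rw [e1]; linarith
  have d3 : c₅ * (W / n ^ 3) ≤ h / 10 * W := by
    have e1 : W / n ^ 3 = h ^ 3 * W := by rw [hh]; field_simp
    have k1 : h ^ 3 * W ≤ h * W := mul_le_mul_of_nonneg_right hh3 hW
    have k2 : c₅ * (h ^ 3 * W) ≤ 1 / 10 * (h ^ 3 * W) :=
      mul_le_mul_of_nonneg_right h53 (by positivity)
    rw [e1]; linarith
  have e : (B * cs * (2 + lam) + B + Q * c₃ + 85 * c ^ 2) / n
    = B * cs * (2 + lam) * h + B * h + Q * c₃ * h + 85 * c ^ 2 * h := by rw [hh]; ring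
  rw [e]
  linarith

end rates

/-- Consequences of a bound on the energy. -/
lemma region_of_energy_le {k J κ c r x Y E₁ : ℝ} (hk : 0 < k) (hJ : 0 < J)
    (hκ2 : 4 * κ ^ 2 * J ≤ k) (hc : c = Real.exp (-(2 * E₁ / J + 1))) (hE₁ : 0 < E₁)
    (hr : 0 < r) (hr1 : r ≤ 1) (hE : energy k J κ c r x Y ≤ E₁) :
    c ≤ Real.cos (r * Y) ∧ |x| ≤ 1 + 4 * E₁ / k + 4 * E₁ / J ∧ |Y| ≤ 1 + 4 * E₁ / k + 4 * E₁ / J ∧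
      energy k J κ c r x Y ≤ (3 * k / 4 + 3 * J / (4 * c)) * (x ^ 2 + Y ^ 2) := by
  have hc0 : 0 < c := by rw [hc]; exact Real.exp_pos _
  have hc1 : c < 1 := by
    rw [hc, Real.exp_lt_one_iff]
    have : 0 < 2 * E₁ / J := by positivity
    linarith
  have h1 := le_energy hk hJ hκ2 hc0 hc1.le r x Y
  have h2 := half_sq_le_barrier hc0 hc1.le r Y
  have h3 := energy_le hk hJ hκ2 hc0 hc1.le r x Y
  have hb0 : 0 ≤ barrier c r Y := le_trans (by positivity) h2
  have hx0 : 0 ≤ k * x ^ 2 / 4 := by positivity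
  have hJb : 0 ≤ J * barrier c r Y / 2 := by positivity
  have hbE : barrier c r Y ≤ 2 * E₁ / J := by rw [le_div_iff₀ hJ]; linarith
  have p1 : 0 < 4 * E₁ / k := by positivity
  have p2 : 0 < 4 * E₁ / J := by positivity
  have sq : ∀ w v : ℝ, w ^ 2 ≤ v → |w| ≤ 1 + v := fun w v h => by
    nlinarith [sq_abs w, sq_nonneg (|w| - 1)]
  refine ⟨le_cos_of_barrier_lt hc0 hc1 hr hr1 ?_, ?_, ?_, ?_⟩
  -- The barrier is at most 2 E₁/J; the summand 1 in the exponent of c provides the strict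
  -- inequality.
  · rw [hc, Real.log_exp, ← hc]; linarith
  · have : x ^ 2 ≤ 4 * E₁ / k := by rw [le_div_iff₀ hk]; linarith
    have := sq _ _ this
    linarith
  · have : Y ^ 2 ≤ 4 * E₁ / J := by
      have e : 4 * E₁ / J = 2 * (2 * E₁ / J) := by ring
      rw [e]; linarith
    have := sq _ _ this
    linarith
  · have h4 := barrier_le_half_sq hc0 (r := r) (Y := Y) hc0 (fun s _ => le_max_left _ _)
    have h5 := mul_le_mul_of_nonneg_left h4 (show 0 ≤ 3 * J / 2 by positivity)
    have e : 3 * J / 2 * (1 / c * Y ^ 2 / 2) = 3 * J / (4 * c) * Y ^ 2 := by field_simp; ring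
    have h6 : 0 ≤ 3 * J / (4 * c) * x ^ 2 := by positivity
    have h7 : 0 ≤ 3 * k / 4 * Y ^ 2 := by positivity
    linarith

/-! ### Decay of large excursions -/

section excursion

variable {P : Plant} {C : Tuning}

/-- Lyapunov function of large motions: the energy, the attitude error weighted by the thrust, and
the attitude error. The bandwidth of the attitude loop is `n ^ 2`. -/
noncomputable def excursion (P : Plant) (C : Tuning) (abar κ c r n Q b α y z q : ℝ) : ℝ :=
  energy C.kpa P.I0 κ c r ((α - abar) / n ^ 2) (y / n ^ 2)
    + Q / n * ((ft P C abar α y / n ^ 2) ^ 2 * quad (n ^ 2 / 4) b z q)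
    + quad (n ^ 2 / 4) b z q / n ^ 3

variable {abar a b cr : ℝ} {ax α y A z q D : ℝ → ℝ}

lemma AttitudeMotion.continuousOn_excursion (h : AttitudeMotion P C abar a b cr ax α y A z q D)
    {c : ℝ} (hc : 0 < c) (κ r n Q : ℝ) :
    ContinuousOn (fun t => excursion P C abar κ c r n Q b (α t) (y t) (z t) (q t)) (Ici 0) := by
  have hα := h.cont_α
  have hy := h.cont_y
  have hW := h.cont_quad (n ^ 2 / 4)
  have hb : Continuous (barrier c r) :=
    continuous_iff_continuousAt.mpr fun Y => (hasDerivAt_barrier hc r Y).continuousAt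
  have hf : ContinuousOn (fun t => ft P C abar (α t) (y t)) (Ici 0) := by
    unfold ft
    exact (((hα.sub continuousOn_const).const_mul _).sub (hy.const_mul _)).add
      ((Real.continuous_cos.comp_continuousOn hα).const_mul _)
  have hx := (hα.sub (continuousOn_const (c := abar))).div_const (n ^ 2)
  have hY := hy.div_const (n ^ 2)
  unfold excursion energy
  exact ((((((hx.pow 2).const_mul _).div_const 2).add
    ((hb.comp_continuousOn hY).const_mul _)).add ((hx.mul hY).const_mul _)).add
    ((((hf.div_const _).pow 2).mul hW).const_mul _)).add (hW.div_const _)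

lemma AttitudeMotion.exists_right_deriv_excursion
    (h : AttitudeMotion P C abar a b cr ax α y A z q D) {c n : ℝ} (hc : 0 < c) (hn : 1 ≤ n)
    (ha : n ^ 2 ≤ a) (hb : n ^ 2 * a ≤ b) (κ r Q : ℝ) {t : ℝ} (ht : 0 ≤ t) :
    ∃ d W' : ℝ, HasDerivWithinAt
        (fun t => excursion P C abar κ c r n Q b (α t) (y t) (z t) (q t)) d (Ici t) t ∧
      d = (C.kpa * ((α t - abar) / n ^ 2) * (y t / n ^ 2)
          + P.I0 * (y t / n ^ 2 / max c (Real.cos (r * (y t / n ^ 2))) * (A t / n ^ 2))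
          + κ * P.I0 * (y t / n ^ 2 * (y t / n ^ 2) + (α t - abar) / n ^ 2 * (A t / n ^ 2)))
        + Q / n * ((ft P C abar (α t) (y t) / n ^ 2) ^ 2 * W'
          + 2 * (ft P C abar (α t) (y t) / n ^ 2)
            * ((-C.kpa * y t - C.kda * A t - P.M * P.g * (Real.sin (α t) * y t)) / n ^ 2)
            * quad (n ^ 2 / 4) b (z t) (q t)) + W' / n ^ 3 ∧
      W' ≤ -(n ^ 2 / 5) * quad (n ^ 2 / 4) b (z t) (q t)
        + 20 * (a / b * A t - D t) ^ 2 / n ^ 2 + 5 * A t ^ 2 / (a * b) := by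
  have hn0 : 0 < n := by linarith
  obtain ⟨W', hW, hWle⟩ := h.exists_right_deriv_quad (μ := n ^ 2 / 4) (by positivity)
    (by linarith) (by linarith) ht
  have hα := h.right_α ht
  have hy := h.right_y ht
  have hf := hasDerivWithinAt_ft P C abar hα hy
  have hx := (hα.sub_const abar).div_const (n ^ 2)
  have hY := hy.div_const (n ^ 2)
  refine ⟨_, W', ((hasDerivWithinAt_energy (k := C.kpa) (J := P.I0) (κ := κ) (r := r) hc hx
    hY).fun_add ((((hf.div_const (n ^ 2)).fun_pow 2).fun_mul hW).const_mul (Q / n))).fun_add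
    (hW.div_const (n ^ 3)), ?_, ?_⟩
  · push_cast; ring
  · refine hWle.trans (le_of_eq ?_)
    have e : 5 * (a / b * A t - D t) ^ 2 / (n ^ 2 / 4) = 20 * (a / b * A t - D t) ^ 2 / n ^ 2 := by
      field_simp; ring
    rw [e]; ring

variable (P C) in
/-- Bounds on the signals of the inclination loop in a region of size proportional to `m`. -/
lemma exists_signal_bounds (cr : ℝ) (hcr : 0 < cr) {B lam : ℝ} (hB : 0 < B) (hlam : 0 ≤ lam) :
    ∃ c : ℝ, 0 < c ∧ ∀ (abar a b m : ℝ) (ax α y A z q D : ℝ → ℝ),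
      AttitudeMotion P C abar a b cr ax α y A z q D → 1 ≤ m → ∀ t, 0 ≤ t → |ax t| ≤ lam →
      |α t - abar| ≤ B * m → |y t| ≤ B * m →
      |A t| ≤ c * m ∧ |D t| ≤ c * m ∧ |ft P C abar (α t) (y t)| ≤ c * m ∧
      |-C.kpa * y t - C.kda * A t - P.M * P.g * (Real.sin (α t) * y t)| ≤ c * m := by
  obtain ⟨cu, hcu, haff⟩ := exists_objAcc_affine_bound P C
  have hkp := C.kpa_pos
  have hkd := C.kda_pos
  have hMg : 0 < P.M * P.g := mul_pos P.M_pos P.g_pos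
  obtain ⟨c₀, hc₀⟩ : ∃ c₀, c₀ = cu * (1 + 2 * B + lam) := ⟨_, rfl⟩
  have hc₀0 : 0 < c₀ := by rw [hc₀]; positivity
  refine ⟨c₀ + cr * (B + c₀) + (C.kpa * B + C.kda * c₀ + P.M * P.g * B), by positivity,
    fun abar a b m ax α y A z q D h hm t ht hax hα hy => ?_⟩
  have hm0 : 0 < m := by linarith
  have hA : |A t| ≤ c₀ * m := by
    rw [h.acc_eq t ht]
    refine (haff abar (α t) (y t) _ (ax t)).1.trans ?_
    rw [hc₀, mul_assoc]
    refine mul_le_mul_of_nonneg_left ?_ hcu.le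
    have := mul_le_mul_of_nonneg_left hm hlam
    linarith
  have hf : |ft P C abar (α t) (y t)| ≤ c₀ * m := by
    refine (haff abar (α t) (y t) 0 0).2.trans ?_
    rw [hc₀, mul_assoc]
    refine mul_le_mul_of_nonneg_left ?_ hcu.le
    have := mul_nonneg hlam hm0.le
    linarith
  have hD : |D t| ≤ cr * (B + c₀) * m := by
    refine (h.rate_le t ht).trans ?_
    rw [mul_assoc]
    refine mul_le_mul_of_nonneg_left ?_ hcr.le
    linarith
  have hf' : |-C.kpa * y t - C.kda * A t - P.M * P.g * (Real.sin (α t) * y t)|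
      ≤ (C.kpa * B + C.kda * c₀ + P.M * P.g * B) * m := by
    have k1 := abs_sub (-C.kpa * y t - C.kda * A t) (P.M * P.g * (Real.sin (α t) * y t))
    have k2 := abs_sub (-C.kpa * y t) (C.kda * A t)
    have k3 : |P.M * P.g * (Real.sin (α t) * y t)| ≤ P.M * P.g * (B * m) := by
      rw [abs_mul, abs_mul (Real.sin _), abs_of_pos hMg]
      refine mul_le_mul_of_nonneg_left ?_ hMg.le
      exact (mul_le_of_le_one_left (abs_nonneg _) (Real.abs_sin_le_one _)).trans hy
    rw [abs_mul, abs_mul, abs_neg, abs_of_pos hkp, abs_of_pos hkd] at k2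
    have k4 := mul_le_mul_of_nonneg_left hy hkp.le
    have k5 := mul_le_mul_of_nonneg_left hA hkd.le
    linarith
  have p1 : 0 ≤ c₀ * m := by positivity
  have p2 : 0 ≤ cr * (B + c₀) * m := by positivity
  have p3 : 0 ≤ (C.kpa * B + C.kda * c₀ + P.M * P.g * B) * m := by positivity
  refine ⟨?_, ?_, ?_, ?_⟩ <;> linarith

lemma cos_le_cos_of_abs_le {u v : ℝ} (h : |u| ≤ v) (hv : v ≤ Real.pi) :
    Real.cos v ≤ Real.cos u := by
  rw [← Real.cos_abs u]
  exact Real.cos_le_cos_of_nonneg_of_le_pi (abs_nonneg _) hv h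

set_option maxHeartbeats 1000000 in
variable (P C) in
/-- For fast attitude loops, motions that start with an inclination rate below the bandwidth of the
attitude loop eventually have rates that are small compared with this bandwidth. -/
lemma exists_excursion_bound {cr : ℝ} (hcr : 0 < cr) {θmax lam : ℝ} (hθ0 : 0 < θmax)
    (hθ : θmax < Real.pi / 2) (hlam : 0 ≤ lam) (abar : ℝ) :
    ∃ N K : ℝ, 1 ≤ N ∧ 0 < K ∧ ∀ (n a b : ℝ) (ax α y A z q D : ℝ → ℝ), N ≤ n →
      n ^ 2 ≤ a → n ^ 2 * a ≤ b → AttitudeMotion P C abar a b cr ax α y A z q D →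
      (∀ t, 0 ≤ t → |ax t| ≤ lam) → |α 0 - abar| ≤ n ^ 2 * θmax + |abar| →
      |y 0| ≤ n ^ 2 * θmax → |z 0| ≤ 5 → |q 0| ≤ 2 →
      ∀ᶠ t in atTop, (α t - abar) ^ 2 + y t ^ 2 ≤ K * n ^ 3 := by
  obtain ⟨cs, hcs, hshift⟩ := exists_objAcc_shift_bound P C
  have hk := C.kpa_pos
  have hd := C.kda_pos
  have hJ := P.I0_pos
  have hcosθ : 0 < Real.cos θmax := Real.cos_pos_of_mem_Ioo ⟨by linarith, hθ⟩
  -- weight of the cross term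
  obtain ⟨κ, hκ0, hκd, hκ2⟩ : ∃ κ : ℝ, 0 < κ ∧
      κ * (P.I0 + C.kda ^ 2 / (2 * C.kpa)) ≤ C.kda / 2 ∧ 4 * κ ^ 2 * P.I0 ≤ C.kpa := by
    have p1 : 0 < P.I0 + C.kda ^ 2 / (2 * C.kpa) := by positivity
    have p2 : 0 < C.kda / 2 / (P.I0 + C.kda ^ 2 / (2 * C.kpa)) := by positivity
    have p3 : 0 < √(C.kpa / (4 * P.I0)) := Real.sqrt_pos.mpr (by positivity)
    refine ⟨min (C.kda / 2 / (P.I0 + C.kda ^ 2 / (2 * C.kpa))) (√(C.kpa / (4 * P.I0))),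
      lt_min p2 p3, ?_, ?_⟩
    · rw [← le_div_iff₀ p1]; exact min_le_left _ _
    · have h1 := pow_le_pow_left₀ (lt_min p2 p3).le
        (min_le_right (C.kda / 2 / (P.I0 + C.kda ^ 2 / (2 * C.kpa))) (√(C.kpa / (4 * P.I0)))) 2
      rw [Real.sq_sqrt (by positivity), le_div_iff₀ (by positivity)] at h1
      linarith
  -- energy levels
  obtain ⟨E₀, hE₀⟩ : ∃ E₀, E₀ = 3 * C.kpa * (θmax + |abar|) ^ 2 / 4
    + 3 * P.I0 * (1 / Real.cos θmax * θmax ^ 2 / 2) / 2 := ⟨_, rfl⟩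
  -- E₀ bounds the initial energy. The extra 1 makes room for the initial attitude terms of
  -- `excursion`, which are O(1/n).
  obtain ⟨E₁, hE₁⟩ : ∃ E₁, E₁ = E₀ + 1 := ⟨_, rfl⟩
  have hE₀0 : 0 ≤ E₀ := by rw [hE₀]; positivity
  have hE₁0 : 0 < E₁ := by linarith
  obtain ⟨c, hc⟩ : ∃ c, c = Real.exp (-(2 * E₁ / P.I0 + 1)) := ⟨_, rfl⟩
  have hc0 : 0 < c := by rw [hc]; exact Real.exp_pos _
  have hc1 : c ≤ 1 := by
    rw [hc, Real.exp_le_one_iff]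
    have : 0 < 2 * E₁ / P.I0 := by positivity
    linarith
  obtain ⟨B₀, hB₀⟩ : ∃ B₀, B₀ = 1 + 4 * E₁ / C.kpa + 4 * E₁ / P.I0 := ⟨_, rfl⟩
  have hB₀0 : 0 < B₀ := by rw [hB₀]; positivity
  obtain ⟨B, hB⟩ : ∃ B, B = B₀ / c + κ * B₀ := ⟨_, rfl⟩
  have hBpos : 0 < B := by rw [hB]; positivity
  obtain ⟨cb, hcb, hsig⟩ := exists_signal_bounds P C cr hcr hB₀0 hlam
  obtain ⟨Q, hQ⟩ : ∃ Q, Q = 10 * (B + 1) := ⟨_, rfl⟩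
  have hQ0 : 0 < Q := by rw [hQ]; positivity
  obtain ⟨c₃, hc₃⟩ : ∃ c₃, c₃ = 45 * cb ^ 4 + 40 * P.Umax ^ 2 * cb ^ 2 := ⟨_, rfl⟩
  have hc₃0 : 0 ≤ c₃ := by rw [hc₃]; positivity
  obtain ⟨cE, hcE⟩ : ∃ cE, cE = min (κ * C.kpa * c / 2) (C.kda / 2) := ⟨_, rfl⟩
  have hcE0 : 0 < cE := by rw [hcE]; exact lt_min (by positivity) (by positivity)
  obtain ⟨CE, hCE⟩ : ∃ CE, CE = 3 * C.kpa / 4 + 3 * P.I0 / (4 * c) := ⟨_, rfl⟩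
  have hCE0 : 0 < CE := by rw [hCE]; positivity
  obtain ⟨c₅, h50, h51, h52, h53⟩ : ∃ c₅ : ℝ, 0 < c₅ ∧ c₅ * CE ≤ cE ∧ c₅ * Q ≤ 1 ∧
      c₅ ≤ 1 / 10 := by
    have p1 : 0 < cE / CE := by positivity
    have p2 : 0 < 1 / Q := by positivity
    refine ⟨min (min (cE / CE) (1 / Q)) (1 / 10), lt_min (lt_min p1 p2) (by norm_num), ?_, ?_,
      min_le_right _ _⟩
    · rw [← le_div_iff₀ hCE0]; exact (min_le_left _ _).trans (min_le_left _ _)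
    · rw [← le_div_iff₀ hQ0]; exact (min_le_left _ _).trans (min_le_right _ _)
  obtain ⟨K₄, hK₄⟩ : ∃ K₄, K₄ = B * cs * (2 + lam) + B + Q * c₃ + 85 * cb ^ 2 := ⟨_, rfl⟩
  have hK₄0 : 0 < K₄ := by rw [hK₄]; positivity
  obtain ⟨κ', hκ'⟩ : ∃ κ' : ℝ, κ' = 4 / C.kpa + 4 / P.I0 := ⟨_, rfl⟩
  have hκ'0 : 0 < κ' := by rw [hκ']; positivity
  -- The summands secure in turn n ≥ 1, the absorption in `excursion_rate_le`, the strict decrease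
  -- K₄/n < c₅ E₁ at the level E₁, and initial attitude terms of at most 1.
  refine ⟨1 + 10 * (2 * (B * cs) + 10 * Q * cb ^ 2) + 2 * (K₄ / (c₅ * E₁))
    + (40 * Q * cb ^ 2 + 40), κ' * (K₄ / c₅ + 1), ?_, by positivity, ?_⟩
  · have : 0 < K₄ / (c₅ * E₁) := by positivity
    have : 0 < B * cs := by positivity
    have : 0 < Q * cb ^ 2 := by positivity
    linarith
  intro n a b ax α y A z q D hN ha hb h hax hα0 hy0 hz0 hq0
  have p1 : 0 < K₄ / (c₅ * E₁) := by positivity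
  have p2 : 0 < B * cs := by positivity
  have p3 : 0 < Q * cb ^ 2 := by positivity
  have hn1 : 1 ≤ n := by linarith
  have hn0 : 0 < n := by linarith
  have hn' : 10 * (2 * (B * cs) + 10 * Q * cb ^ 2) ≤ n := by linarith
  have hnK : K₄ / n < c₅ * E₁ := by
    have : K₄ / (c₅ * E₁) < n := by linarith
    rw [div_lt_iff₀ (by positivity)] at this
    rw [div_lt_iff₀ hn0]; linarith
  have hnS : (40 * Q * cb ^ 2 + 40) / n ≤ 1 := by rw [div_le_one hn0]; linarith
  have hm1 : 1 ≤ n ^ 2 := one_le_pow₀ hn1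
  have hm0 : 0 < n ^ 2 := by positivity
  have hμ : 0 < n ^ 2 / 4 := by positivity
  have haμ : 4 * (n ^ 2 / 4) ≤ a := by linarith
  have hbμ : 4 * (n ^ 2 / 4) * a ≤ b := by
    rw [show 4 * (n ^ 2 / 4) * a = n ^ 2 * a by ring]; exact hb
  obtain ⟨ha0, hb0, hab0, hab, hab3⟩ := gain_ratio_bounds hμ haμ hbμ
  have hρ : a / b ≤ 1 / n ^ 2 := by
    rwa [show 4 * (n ^ 2 / 4) = n ^ 2 by ring] at hab
  have hr3 : (n ^ 2) ^ 3 ≤ a * b := by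
    rwa [show 64 * (n ^ 2 / 4) ^ 3 = (n ^ 2) ^ 3 by ring] at hab3
  obtain ⟨r, hr⟩ : ∃ r, r = a / b * n ^ 2 := ⟨_, rfl⟩
  have hr0 : 0 < r := by rw [hr]; positivity
  have hr1 : r ≤ 1 := by
    rw [hr, ← le_div_iff₀ hm0]; exact hρ
  have hWnn : ∀ t, 0 ≤ quad (n ^ 2 / 4) b (z t) (q t) := fun t => quad_nonneg hμ haμ hbμ _ _
  -- the excursion function controls the energy
  have energy_le_exc : ∀ t, energy C.kpa P.I0 κ c r ((α t - abar) / n ^ 2) (y t / n ^ 2)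
      ≤ excursion P C abar κ c r n Q b (α t) (y t) (z t) (q t) := by
    intro t
    have := hWnn t
    have k1 : 0 ≤ Q / n * ((ft P C abar (α t) (y t) / n ^ 2) ^ 2 * quad (n ^ 2 / 4) b (z t) (q t)) := by
      positivity
    have k2 : 0 ≤ quad (n ^ 2 / 4) b (z t) (q t) / n ^ 3 := by positivity
    unfold excursion
    linarith
  have unscale : ∀ w, |w / n ^ 2| ≤ B₀ → |w| ≤ B₀ * n ^ 2 := fun w hw => by
    rwa [abs_div, abs_of_pos hm0, div_le_iff₀ hm0] at hw
  -- decay inside the region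
  have decay : ∀ t, 0 ≤ t → ∃ d, HasDerivWithinAt
      (fun t => excursion P C abar κ c r n Q b (α t) (y t) (z t) (q t)) d (Ici t) t ∧
      (excursion P C abar κ c r n Q b (α t) (y t) (z t) (q t) ≤ E₁ →
        d ≤ -c₅ * excursion P C abar κ c r n Q b (α t) (y t) (z t) (q t) + K₄ / n) := by
    intro t ht
    obtain ⟨d, W', hder, hdeq, hW'⟩ := h.exists_right_deriv_excursion hc0 hn1 ha hb κ r Q ht
    refine ⟨d, hder, fun hexc => ?_⟩
    obtain ⟨hcos, hxB, hYB, hEs⟩ := region_of_energy_le hk hJ hκ2 hc hE₁0 hr0 hr1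
      ((energy_le_exc t).trans hexc)
    rw [← hB₀] at hxB hYB
    rw [← hCE] at hEs
    obtain ⟨bA, bD, bf, bf'⟩ := hsig abar a b (n ^ 2) ax α y A z q D h hm1 t ht (hax t ht)
      (unscale _ hxB) (unscale _ hYB)
    have hWt := hWnn t
    have hS' := weighted_rate_le (U := P.Umax) hm1 hWt hab0.le hρ bA bD bf bf'
      (h.rate_eq_zero t ht) hr3 hW'
    have hWr := attitude_rate_le hm1 hab0.le hρ bA bD hr3 hW'
    have hζ := sq_le_quad hμ haμ hbμ (z t) (q t)
    rw [← sq_abs (z t)] at hζ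
    -- the energy rate
    have hsh := hshift abar (α t) (y t) (a / b * y t) (z t) (ax t)
    have hAeq : A t = objAcc P C abar (α t) (y t)
        (thetaBar P C (ft P C abar (α t) (y t)) - a / b * y t + z t) (ax t) := by
      rw [h.acc_eq t ht]; congr 1; ring
    rw [← hAeq] at hsh
    obtain ⟨err, herr⟩ : ∃ err, err = P.I0 * A t
      + (C.kpa * (α t - abar) + C.kda * y t) * Real.cos (a / b * y t) := ⟨_, rfl⟩
    rw [← herr] at hsh
    have hrY : r * (y t / n ^ 2) = a / b * y t := by rw [hr]; field_simp
    have hY' : P.I0 * (A t / n ^ 2) = -((C.kpa * ((α t - abar) / n ^ 2) + C.kda * (y t / n ^ 2))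
        * Real.cos (r * (y t / n ^ 2))) + err / n ^ 2 := by
      rw [herr, hrY]; ring
    have hBY : |y t / n ^ 2 / Real.cos (r * (y t / n ^ 2)) + κ * ((α t - abar) / n ^ 2)| ≤ B := by
      refine (abs_add_le _ _).trans ?_
      rw [abs_div (y t / n ^ 2), abs_mul κ, abs_of_pos hκ0, abs_of_pos (hc0.trans_le hcos), hB]
      exact add_le_add (div_le_div₀ hB₀0.le hYB hc0 hcos) (mul_le_mul_of_nonneg_left hxB hκ0.le)
    have hEr := energy_deriv_le hk hd hκ0 hκd hc0 hcos (Real.cos_le_one _) hBY hY'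
    rw [← hcE] at hEr
    have hδ : |err / n ^ 2| ≤ (cs * (1 + lam + |z t|)) / n ^ 2
        + |ft P C abar (α t) (y t) / n ^ 2| * |z t| := by
      rw [abs_div, abs_div, abs_of_pos hm0, div_mul_eq_mul_div, ← add_div]
      refine div_le_div_of_nonneg_right (hsh.trans ?_) hm0.le
      have := mul_le_mul_of_nonneg_left (hax t ht) hcs.le
      linarith
    rw [hdeq, max_eq_right hcos, hK₄]
    exact excursion_rate_le hn1 hBpos.le hcs.le hlam hQ hc₃0 hn' (by positivity) hWt rfl hEs h50.le
      h51 h52 h53 hEr hδ hζ (by rw [hc₃]; exact hS') hWr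
  choose d hdd using decay
  -- initial level
  have init : excursion P C abar κ c r n Q b (α 0) (y 0) (z 0) (q 0) ≤ E₁ := by
    have hx0 : |(α 0 - abar) / n ^ 2| ≤ θmax + |abar| := by
      rw [abs_div, abs_of_pos hm0, div_le_iff₀ hm0]
      have := mul_le_mul_of_nonneg_left hm1 (abs_nonneg abar)
      linarith
    have hY0 : |y 0 / n ^ 2| ≤ θmax := by
      rw [abs_div, abs_of_pos hm0, div_le_iff₀ hm0]; linarith
    -- The initial lag satisfies |r Y| ≤ θmax < π/2, so the effectiveness is at least cos θmax and
    -- the initial energy is bounded independently of the gains.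
    have hbar : barrier c r (y 0 / n ^ 2) ≤ 1 / Real.cos θmax * θmax ^ 2 / 2 := by
      refine (barrier_le_half_sq hc0 hcosθ fun s hs => le_max_of_le_right ?_).trans ?_
      · refine cos_le_cos_of_abs_le ?_ (by linarith [Real.pi_pos])
        rw [abs_mul, abs_of_pos hr0]
        exact (mul_le_of_le_one_left (abs_nonneg _) hr1).trans (hs.trans hY0)
      · have := pow_le_pow_left₀ (abs_nonneg _) hY0 2
        rw [sq_abs] at this
        gcongr
    have hE0 : energy C.kpa P.I0 κ c r ((α 0 - abar) / n ^ 2) (y 0 / n ^ 2) ≤ E₀ := by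
      refine (energy_le hk hJ hκ2 hc0 hc1 r _ _).trans ?_
      have k1 := pow_le_pow_left₀ (abs_nonneg _) hx0 2
      rw [sq_abs] at k1
      have k2 := mul_le_mul_of_nonneg_left k1 (show 0 ≤ 3 * C.kpa / 4 by positivity)
      have k3 := mul_le_mul_of_nonneg_left hbar (show 0 ≤ 3 * P.I0 / 2 by positivity)
      rw [hE₀]; linarith
    obtain ⟨-, hxB, hYB, -⟩ := region_of_energy_le hk hJ hκ2 hc hE₁0 hr0 hr1
      (hE0.trans (by linarith))
    rw [← hB₀] at hxB hYB
    obtain ⟨-, -, bf, -⟩ := hsig abar a b (n ^ 2) ax α y A z q D h hm1 0 le_rfl (hax 0 le_rfl)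
      (unscale _ hxB) (unscale _ hYB)
    have hW0 : quad (n ^ 2 / 4) b (z 0) (q 0) ≤ 40 := by
      refine (quad_le hμ haμ hbμ _ _).trans ?_
      have k1 := pow_le_pow_left₀ (abs_nonneg _) hz0 2
      have k2 := pow_le_pow_left₀ (abs_nonneg _) hq0 2
      rw [sq_abs] at k1 k2
      have hb1 : 1 ≤ b := by
        calc (1 : ℝ) ≤ n ^ 2 * n ^ 2 := by nlinarith
          _ ≤ n ^ 2 * a := by gcongr
          _ ≤ b := hb
      have k3 : q 0 ^ 2 / b ≤ 4 := by
        rw [div_le_iff₀ hb0]; linarith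
      linarith
    have hW00 := hWnn 0
    have hφ : (ft P C abar (α 0) (y 0) / n ^ 2) ^ 2 ≤ cb ^ 2 := by
      rw [← sq_abs, abs_div, abs_of_pos hm0]
      exact pow_le_pow_left₀ (by positivity) (by rw [div_le_iff₀ hm0]; exact bf) 2
    have s1 : Q / n * ((ft P C abar (α 0) (y 0) / n ^ 2) ^ 2 * quad (n ^ 2 / 4) b (z 0) (q 0))
        ≤ Q / n * (cb ^ 2 * 40) := by gcongr
    have s2 : quad (n ^ 2 / 4) b (z 0) (q 0) / n ^ 3 ≤ 40 / n :=
      div_le_div₀ (by norm_num) hW0 hn0 (le_self_pow₀ hn1 three_ne_zero)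
    have e : Q / n * (cb ^ 2 * 40) + 40 / n = (40 * Q * cb ^ 2 + 40) / n := by field_simp
    unfold excursion
    linarith
  have hcont := h.continuousOn_excursion hc0 κ r n Q
  have hinv : ∀ t, 0 ≤ t → excursion P C abar κ c r n Q b (α t) (y t) (z t) (q t) ≤ E₁ :=
    fun t ht => le_of_deriv_right_neg (T := 0)
      (g := fun t => excursion P C abar κ c r n Q b (α t) (y t) (z t) (q t))
      (g' := fun t => if ht : 0 ≤ t then d t ht else 0) hcont
      (fun t ht => by simp only [dif_pos ht]; exact (hdd t ht).1) init (fun t ht hU => by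
        simp only [dif_pos ht]
        have := (hdd t ht).2 hU.le
        rw [hU] at this
        linarith) t ht
  have ev := eventually_le_of_deriv_right_le (T := 0) (c := c₅) (k := K₄ / n)
    (g := fun t => excursion P C abar κ c r n Q b (α t) (y t) (z t) (q t))
    (g' := fun t => if ht : 0 ≤ t then d t ht else 0) h50 hcont
    (fun t ht => by simp only [dif_pos ht]; exact (hdd t ht).1)
    (fun t ht => by simp only [dif_pos ht]; exact (hdd t ht).2 (hinv t ht))
    (η := 1 / n) (by positivity)
  filter_upwards [ev] with t ht
  have hE := (energy_le_exc t).trans ht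
  have h1 := (le_energy hk hJ hκ2 hc0 hc1 r ((α t - abar) / n ^ 2) (y t / n ^ 2)).trans hE
  have h2 := half_sq_le_barrier hc0 hc1 r (y t / n ^ 2)
  have h3 := mul_le_mul_of_nonneg_left h2 hJ.le
  obtain ⟨L, hL⟩ : ∃ L, L = K₄ / n / c₅ + 1 / n := ⟨_, rfl⟩
  rw [← hL] at h1
  have hx2 : ((α t - abar) / n ^ 2) ^ 2 ≤ 4 / C.kpa * L := by
    rw [div_mul_eq_mul_div, le_div_iff₀ hk]
    have : 0 ≤ P.I0 * (y t / n ^ 2) ^ 2 := by positivity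
    linarith
  have hY2 : (y t / n ^ 2) ^ 2 ≤ 4 / P.I0 * L := by
    rw [div_mul_eq_mul_div, le_div_iff₀ hJ]
    have : 0 ≤ C.kpa * ((α t - abar) / n ^ 2) ^ 2 := by positivity
    linarith
  -- The scaled squares are of order L = O(1/n); undoing the scaling multiplies them by n⁴.
  have e1 : (α t - abar) ^ 2 + y t ^ 2
      = (((α t - abar) / n ^ 2) ^ 2 + (y t / n ^ 2) ^ 2) * n ^ 4 := by field_simp
  have e2 : κ' * (K₄ / c₅ + 1) * n ^ 3 = (4 / C.kpa * L + 4 / P.I0 * L) * n ^ 4 := by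
    rw [hκ', hL]; field_simp
  rw [e1, e2]
  exact mul_le_mul_of_nonneg_right (add_le_add hx2 hY2) (by positivity)

end excursion

/-! ### Convergence from the small-gain region -/

section attraction

variable {P : Plant} {C : Tuning}

variable (P C) in
/-- A fast attitude loop has a small attitude error once the excursion is of order `n ^ (3 / 2)`. -/
lemma exists_small_attitude_error {cr lam K θ₀ : ℝ} (hcr : 0 < cr) (hK : 0 < K)
    (hθ₀ : 0 < θ₀) : ∃ N : ℝ, 1 ≤ N ∧ ∀ (n abar a b : ℝ) (ax α y A z q D : ℝ → ℝ), N ≤ n →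
      n ^ 2 ≤ a → n ^ 2 * a ≤ b → AttitudeMotion P C abar a b cr ax α y A z q D →
      (∀ t, 0 ≤ t → |ax t| ≤ lam) →
      (∀ᶠ t in atTop, (α t - abar) ^ 2 + y t ^ 2 ≤ K * n ^ 3) →
      ∀ᶠ t in atTop, |z t - a / b * y t| ≤ θ₀ := by
  obtain ⟨c, hc, hacc⟩ := exists_objAcc_affine_bound P C
  obtain ⟨G, hG⟩ : ∃ G, G = 4 * c ^ 2 * (1 + K + lam ^ 2) := ⟨_, rfl⟩
  have hG0 : 0 < G := by rw [hG]; positivity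
  obtain ⟨H, hH⟩ : ∃ H, H = 2 * G + 4 * cr ^ 2 * (K + G) := ⟨_, rfl⟩
  have hH0 : 0 < H := by rw [hH]; positivity
  -- The squared error is at most 2 z² + 2 (ρ y)², hence at most R/n: the first part of R comes from
  -- z² ≤ 4/3 W, the second from the lag.
  obtain ⟨R, hR⟩ : ∃ R, R = 8 / 3 * (5 * (20 * H + 5 * G) + 1) + 2 * K := ⟨_, rfl⟩
  have hR0 : 0 < R := by rw [hR]; positivity
  refine ⟨max 1 (R / θ₀ ^ 2), le_max_left _ _,
    fun n abar a b ax α y A z q D hn ha hb h hax hev => ?_⟩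
  have hn1 : 1 ≤ n := (le_max_left _ _).trans hn
  have hn0 : 0 < n := by linarith
  have hnR : R ≤ θ₀ ^ 2 * n := by
    have := (le_max_right 1 (R / θ₀ ^ 2)).trans hn
    rw [div_le_iff₀ (by positivity)] at this
    linarith
  have hμ : 0 < n ^ 2 / 4 := by positivity
  have ha' : 4 * (n ^ 2 / 4) ≤ a := by linarith
  have hb' : 4 * (n ^ 2 / 4) * a ≤ b := by linarith
  obtain ⟨ha0, hb0, hab0, hab, hprod⟩ := gain_ratio_bounds hμ ha' hb'
  have hρ : a / b ≤ 1 / n ^ 2 := by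
    have e : 4 * (n ^ 2 / 4) = n ^ 2 := by ring
    rwa [e] at hab
  have hr : n ^ 6 ≤ a * b := by
    have e : 64 * (n ^ 2 / 4) ^ 3 = n ^ 6 := by ring
    rwa [e] at hprod
  have hρ2 : (a / b) ^ 2 ≤ 1 / n ^ 4 := by
    have := pow_le_pow_left₀ hab0.le hρ 2
    rwa [show (1 / n ^ 2) ^ 2 = 1 / n ^ 4 by ring] at this
  have hρ1 : (a / b) ^ 2 ≤ 1 := hρ2.trans (by
    rw [div_le_one (by positivity)]; exact one_le_pow₀ hn1)
  obtain ⟨T₀, hT₀⟩ := eventually_atTop.mp hev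
  have hT : 0 ≤ max T₀ 0 := le_max_right _ _
  have n3 : 1 ≤ n ^ 3 := one_le_pow₀ hn1
  choose d hd using fun t (ht : 0 ≤ t) => h.exists_right_deriv_quad hμ ha' hb' ht
  -- Acceleration and reference rate now have squares of order n³. Divided by the bandwidth n² they
  -- force W at order n, so W settles at order 1/n.
  have rate : ∀ t, max T₀ 0 ≤ t → (if ht : 0 ≤ t then d t ht else 0)
      ≤ -(n ^ 2 / 5) * quad (n ^ 2 / 4) b (z t) (q t) + (20 * H + 5 * G) * n := by
    intro t ht
    have ht0 := hT.trans ht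
    simp only [dif_pos ht0]
    have hxy := hT₀ t ((le_max_left _ _).trans ht)
    have hA : A t ^ 2 ≤ G * n ^ 3 := by
      have h1 := (hacc abar (α t) (y t) (thetaBar P C (ft P C abar (α t) (y t))
        + (z t - a / b * y t)) (ax t)).1
      rw [← h.acc_eq t ht0] at h1
      have h2 := pow_le_pow_left₀ (abs_nonneg _) h1 2
      have h3 := sq_add_four_le (p := 1) (q := |α t - abar|) (r := |y t|) (s := |ax t|)
      have h4 := pow_le_pow_left₀ (abs_nonneg _) (hax t ht0) 2
      rw [sq_abs] at h2 h4
      rw [sq_abs, sq_abs, sq_abs] at h3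
      have h5 : 1 + lam ^ 2 ≤ (1 + lam ^ 2) * n ^ 3 := le_mul_of_one_le_right (by positivity) n3
      rw [mul_pow] at h2
      have h6 : 1 ^ 2 + (α t - abar) ^ 2 + y t ^ 2 + ax t ^ 2 ≤ (1 + K + lam ^ 2) * n ^ 3 := by
        linarith
      have h7 := mul_le_mul_of_nonneg_left (h3.trans (mul_le_mul_of_nonneg_left h6 zero_le_four))
        (sq_nonneg c)
      rw [hG]
      linarith
    have hD : D t ^ 2 ≤ 2 * cr ^ 2 * (K + G) * n ^ 3 := by
      have h2 := pow_le_pow_left₀ (abs_nonneg _) (h.rate_le t ht0) 2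
      rw [sq_abs, mul_pow] at h2
      have h3 : (|y t| + |A t|) ^ 2 ≤ 2 * ((K + G) * n ^ 3) := by
        have := add_sq_le (a := |y t|) (b := |A t|)
        rw [sq_abs, sq_abs] at this
        linarith [sq_nonneg (α t - abar)]
      have := mul_le_mul_of_nonneg_left h3 (sq_nonneg cr)
      linarith
    have hp : (a / b * A t - D t) ^ 2 ≤ H * n ^ 3 := by
      have h1 : (a / b * A t) ^ 2 ≤ A t ^ 2 := by
        rw [mul_pow]; exact mul_le_of_le_one_left (sq_nonneg _) hρ1
      rw [hH]
      linarith [sq_nonneg (a / b * A t + D t)]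
    have e1 : 5 * (a / b * A t - D t) ^ 2 / (n ^ 2 / 4) ≤ 20 * H * n := by
      rw [div_le_iff₀ hμ]; linarith
    have e2 : 5 * A t ^ 2 / (a * b) ≤ 5 * G * n := by
      rw [div_le_iff₀ (by positivity)]
      have k1 : n ^ 3 ≤ n * n ^ 6 := by
        have := pow_le_pow_right₀ hn1 (show 3 ≤ 7 by norm_num)
        linarith
      have k2 := mul_le_mul_of_nonneg_left hr (show 0 ≤ 5 * G * n by positivity)
      have k3 := mul_le_mul_of_nonneg_left k1 (show 0 ≤ 5 * G by positivity)
      linarith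
    have := (hd t ht0).2
    linarith
  have ev := eventually_le_of_deriv_right_le (c := n ^ 2 / 5) (T := max T₀ 0)
    (g := fun t => quad (n ^ 2 / 4) b (z t) (q t)) (by positivity)
    ((h.cont_quad _).mono (Ici_subset_Ici.mpr hT))
    (fun t ht => by simp only [dif_pos (hT.trans ht)]; exact (hd t (hT.trans ht)).1) rate
    (show 0 < 1 / n by positivity)
  filter_upwards [ev, hev] with t hW hxy
  have hz := sq_le_quad hμ ha' hb' (z t) (q t)
  have e1 : (20 * H + 5 * G) * n / (n ^ 2 / 5) + 1 / n = (5 * (20 * H + 5 * G) + 1) / n := by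
    field_simp
  rw [e1] at hW
  have hy : (a / b * y t) ^ 2 ≤ K / n := by
    rw [mul_pow]
    calc (a / b) ^ 2 * y t ^ 2 ≤ 1 / n ^ 4 * (K * n ^ 3) :=
          mul_le_mul hρ2 (by linarith [sq_nonneg (α t - abar)]) (sq_nonneg _) (by positivity)
      _ = K / n := by field_simp
  refine abs_le_of_sq_le_sq ?_ hθ₀.le
  have e2 : R / n ≤ θ₀ ^ 2 := by rw [div_le_iff₀ hn0]; exact hnR
  have e3 : R / n = 8 / 3 * ((5 * (20 * H + 5 * G) + 1) / n) + 2 * (K / n) := by rw [hR]; ring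
  linarith [sq_nonneg (z t + a / b * y t)]

/-- Lower bound for the gain of the attitude loop in terms of its bandwidth. -/
lemma le_gammaIn {kp kd : ℝ} (hkp : 0 < kp) (hkd : 0 < kd) :
    ENNReal.ofReal (1 / min (kd / P.Iu) (kp / kd)) ≤ gammaIn P kp kd := by
  rcases min_cases (kd / P.Iu) (kp / kd) with ⟨h, -⟩ | ⟨h, -⟩
  · rw [h, one_div_div]; exact le_gammaIn_resonant P hkp hkd
  · rw [h, one_div_div]; exact le_gammaIn_static P hkp hkd

/-- Bounds on the initial state in the small-gain region. -/
lemma SmallGainCondition.bounds {γin γout : ℝ≥0∞} {θmax m : ℝ} {s : Fin 6 → ℝ}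
    (h : SmallGainCondition γin γout θmax s) (hθ : 0 < θmax) (hm : 0 < m)
    (hγ : ENNReal.ofReal (1 / m) ≤ γin) :
    |s 4 - s 2| ≤ θmax ∧ |s 5 - s 3| ≤ θmax ∧ |s 2| ≤ m * θmax ∧ |s 3| ≤ m * θmax := by
  unfold SmallGainCondition at h
  have h1 := lt_of_le_of_lt (le_self_add.trans le_self_add) h
  have h2 := lt_of_le_of_lt (le_add_self.trans le_self_add) h
  rw [ENNReal.ofReal_lt_ofReal_iff hθ] at h1
  have h3 : ENNReal.ofReal (1 / m * √(s 2 ^ 2 + s 3 ^ 2)) < ENNReal.ofReal θmax := by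
    rw [ENNReal.ofReal_mul (by positivity)]
    exact lt_of_le_of_lt (mul_le_mul_left hγ _) h2
  rw [ENNReal.ofReal_lt_ofReal_iff hθ, one_div, inv_mul_lt_iff₀ hm] at h3
  refine ⟨?_, ?_, ?_, ?_⟩
  · exact (Real.abs_le_sqrt (by linarith [sq_nonneg (s 5 - s 3)])).trans h1.le
  · exact (Real.abs_le_sqrt (by linarith [sq_nonneg (s 4 - s 2)])).trans h1.le
  · exact (Real.abs_le_sqrt (by linarith [sq_nonneg (s 3)])).trans h3.le
  · exact (Real.abs_le_sqrt (by linarith [sq_nonneg (s 2)])).trans h3.le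

variable (P C) in
/-- Convergence from the small-gain region for fast attitude loops. -/
lemma exists_tendsto_equilibrium (xbar abar : ℝ) {θmax : ℝ} (hθ0 : 0 < θmax)
    (hθ : θmax < Real.pi / 2) :
    ∃ m₀ : ℝ, 1 ≤ m₀ ∧ ∀ (kp kd m : ℝ), m₀ ≤ m → m ≤ kd / P.Iu → m * (kd / P.Iu) ≤ kp / P.Iu →
      AsymptoticallyStable (closedLoop P C kp kd xbar abar) (equilibrium P C xbar abar) ∧
      ∀ X : ℝ → Fin 6 → ℝ, IsSolution (closedLoop P C kp kd xbar abar) X →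
        |X 0 4 - X 0 2| ≤ θmax → |X 0 5 - X 0 3| ≤ θmax → |X 0 2| ≤ m * θmax →
        |X 0 3| ≤ m * θmax → Tendsto X atTop (𝓝 (equilibrium P C xbar abar)) := by
  have hmc := P.mc_pos
  have hI := P.Iu_pos
  have hl := C.lam1_pos
  obtain ⟨cr, hcr, hmotion⟩ := exists_attitudeMotion P C
  obtain ⟨θ₀, μ₀, c, k, κ, H⟩ := exists_compositeDecay P C hcr
  obtain ⟨N₁, K, hN₁, hK, hexc⟩ :=
    exists_excursion_bound (P := P) (C := C) hcr hθ0 hθ (lam := C.lam1 / P.mc) (by positivity) abar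
  obtain ⟨N₂, hN₂, hsmall⟩ :=
    exists_small_attitude_error P C (lam := C.lam1 / P.mc) hcr hK H.θ₀_pos
  refine ⟨max (4 * μ₀) (max (N₁ ^ 2) (N₂ ^ 2)), ?_, fun kp kd m hm ha hb => ?_⟩
  · exact le_max_of_le_left (by linarith [H.one_le_μ₀])
  rw [max_le_iff, max_le_iff] at hm
  obtain ⟨hm0, hm1, hm2⟩ := hm
  have hμ₀ : μ₀ ≤ m / 4 := by linarith
  have hμ : 0 < m / 4 := by linarith [H.one_le_μ₀]
  have hm4 : 4 ≤ m := by linarith [H.one_le_μ₀]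
  have ha' : 4 * (m / 4) ≤ kd / P.Iu := by linarith
  have hb' : 4 * (m / 4) * (kd / P.Iu) ≤ kp / P.Iu := by linarith
  obtain ⟨ha0, hb0, hab0, hab, -⟩ := gain_ratio_bounds hμ ha' hb'
  have hkp : 0 < kp := by
    have := mul_pos hb0 hI
    rwa [div_mul_cancel₀ _ hI.ne'] at this
  refine ⟨asymptoticallyStable_closedLoop H (fun X hX => hmotion kp kd xbar abar X hkp hX)
    hμ₀ ha' hb', fun X hX h4 h5 h2 h3 => ?_⟩
  obtain ⟨hx, hv, A, D, hM⟩ := hmotion kp kd xbar abar X hkp hX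
  -- The estimates for large motions are applied with n = √m, so that the bandwidth n² is m.
  have hsq : √m ^ 2 = m := Real.sq_sqrt (by linarith)
  have hax : ∀ t, 0 ≤ t → |u3 C xbar (X t 0) (X t 1) / P.mc| ≤ C.lam1 / P.mc := fun t _ => by
    rw [abs_div, abs_of_pos hmc]
    exact div_le_div_of_nonneg_right (abs_u3_le C _ _ _) hmc.le
  have hpi := Real.pi_lt_d2
  have hα0 : |X 0 2 - abar| ≤ √m ^ 2 * θmax + |abar| := by
    rw [hsq]; exact (abs_sub _ _).trans (by linarith)
  have hy0 : |X 0 3| ≤ √m ^ 2 * θmax := by rw [hsq]; exact h3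
  -- Relative attitude, its reference and the lag are each at most π/2 in modulus, and 3π/2 < 5.
  have hz0 : |X 0 4 - betaBar P C abar (X 0 2) (X 0 3) + kd / P.Iu / (kp / P.Iu) * X 0 3| ≤ 5 := by
    have e : X 0 4 - betaBar P C abar (X 0 2) (X 0 3) + kd / P.Iu / (kp / P.Iu) * X 0 3
        = (X 0 4 - X 0 2) - thetaBar P C (ft P C abar (X 0 2) (X 0 3))
          + kd / P.Iu / (kp / P.Iu) * X 0 3 := by unfold betaBar; ring
    rw [e]
    have k1 := abs_add_le ((X 0 4 - X 0 2) - thetaBar P C (ft P C abar (X 0 2) (X 0 3)))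
      (kd / P.Iu / (kp / P.Iu) * X 0 3)
    have k2 := abs_sub (X 0 4 - X 0 2) (thetaBar P C (ft P C abar (X 0 2) (X 0 3)))
    have k3 := abs_thetaBar_le P C (ft P C abar (X 0 2) (X 0 3))
    have k4 : |kd / P.Iu / (kp / P.Iu) * X 0 3| ≤ θmax := by
      rw [abs_mul, abs_of_pos hab0]
      calc _ ≤ 1 / (4 * (m / 4)) * (m * θmax) :=
            mul_le_mul hab h3 (abs_nonneg _) (by positivity)
        _ = θmax := by field_simp
    linarith
  have hn1 : N₁ ≤ √m := Real.le_sqrt_of_sq_le hm1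
  have hn2 : N₂ ≤ √m := Real.le_sqrt_of_sq_le hm2
  have hna : √m ^ 2 ≤ kd / P.Iu := by rw [hsq]; exact ha
  have hnb : √m ^ 2 * (kd / P.Iu) ≤ kp / P.Iu := by rw [hsq]; exact hb
  have hexc' := hexc _ _ _ _ _ _ _ _ _ _ hn1 hna hnb hM hax hα0 hy0 hz0 (by linarith)
  have he := hsmall _ _ _ _ _ _ _ _ _ _ _ hn2 hna hnb hM hax hexc'
  obtain ⟨hx', hv'⟩ := cart_tendsto P C hx hv
  obtain ⟨t2, t3, t4, t5⟩ := AttitudeMotion.tendsto H.κ_pos H.c_pos H.incl_bounds hμ ha' hb' hM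
    (H.decay abar _ _ _ _ _ _ _ _ _ _ hμ₀ ha' hb' hM) he (tendsto_cartAcc P C hx' hv')
  exact tendsto_equilibrium hx' hv' t2 t3 t4 t5

end attraction

end UavUgv

/-! ### Choice of the attitude gains -/

theorem proposition3 (P : UavUgv.Plant) (C : UavUgv.Tuning) (xbar abar : ℝ)
    (habar : abar ∈ Set.Icc P.alphaMin P.alphaMax) :
    (∃ θ₀ : ℝ, 0 < θ₀ ∧ θ₀ < Real.pi / 2 ∧
      ∀ θmax : ℝ, 0 < θmax → θmax ≤ θ₀ → UavUgv.gammaOut P C abar θmax < ⊤) ∧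
    ∀ θmax : ℝ, 0 < θmax → θmax < Real.pi / 2 →
      ∃ K : ℝ, 0 < K ∧ ∀ kp kd : ℝ, K ≤ kd → K * kd ≤ kp →
        UavUgv.gammaIn P kp kd < ⊤ ∧
        (UavUgv.gammaOut P C abar θmax < ⊤ →
          UavUgv.gammaIn P kp kd * UavUgv.gammaOut P C abar θmax < 1) ∧
        UavUgv.AsymptoticallyStable (UavUgv.closedLoop P C kp kd xbar abar)
          (UavUgv.equilibrium P C xbar abar) ∧
        ∀ X : ℝ → Fin 6 → ℝ,
          UavUgv.IsSolution (UavUgv.closedLoop P C kp kd xbar abar) X →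
          UavUgv.SmallGainCondition (UavUgv.gammaIn P kp kd)
            (UavUgv.gammaOut P C abar θmax) θmax (X 0) →
          Filter.Tendsto X Filter.atTop (nhds (UavUgv.equilibrium P C xbar abar)) := by
  refine ⟨UavUgv.exists_gammaOut_lt_top P C abar, fun θmax hθ0 hθ => ?_⟩
  have hI := P.Iu_pos
  obtain ⟨m₀, hm₀, hconv⟩ := UavUgv.exists_tendsto_equilibrium P C xbar abar hθ0 hθ
  obtain ⟨γ, hγ⟩ : ∃ γ, γ = (UavUgv.gammaOut P C abar θmax).toReal := ⟨_, rfl⟩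
  have hγ0 : 0 ≤ γ := by rw [hγ]; exact ENNReal.toReal_nonneg
  -- Since γ_in ≤ 16/m, a bandwidth m > 16 γ_out gives a loop gain below one. For infinite γ_out the
  -- default value γ = 0 is harmless, that inequality being claimed only for finite γ_out.
  obtain ⟨m₁, hm₁⟩ : ∃ m₁, m₁ = m₀ + 16 * γ := ⟨_, rfl⟩
  have hm₁1 : 1 ≤ m₁ := by linarith
  -- The factor 1 + I_u makes both k_d/I_u and k_p/k_d at least m₁.
  refine ⟨m₁ * (1 + P.Iu), by positivity, fun kp kd h1 h2 => ?_⟩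
  have hkd : 0 < kd := lt_of_lt_of_le (by positivity) h1
  have hkp : 0 < kp := lt_of_lt_of_le (by positivity) h2
  have hmI := mul_pos (show 0 < m₁ by linarith) hI
  obtain ⟨m, hm⟩ : ∃ m, m = min (kd / P.Iu) (kp / kd) := ⟨_, rfl⟩
  have hm₁m : m₁ ≤ m := by
    rw [hm]
    refine le_min ?_ ?_
    · rw [le_div_iff₀ hI]; linarith
    · rw [le_div_iff₀ hkd]
      linarith [mul_pos hmI hkd]
  have hm0 : 0 < m := by linarith
  have ha : m ≤ kd / P.Iu := by rw [hm]; exact min_le_left _ _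
  have hb : m * (kd / P.Iu) ≤ kp / P.Iu := by
    have : m * kd ≤ kp := by rw [← le_div_iff₀ hkd, hm]; exact min_le_right _ _
    rw [← mul_div_assoc]
    exact div_le_div_of_nonneg_right this hI.le
  have hin : UavUgv.gammaIn P kp kd ≤ ENNReal.ofReal (16 / m) := by
    have := UavUgv.gammaIn_le P (kp := kp) (kd := kd) (μ := m / 4) (by positivity) (by linarith)
      (by linarith)
    rwa [show 4 / (m / 4) = 16 / m by field_simp; norm_num] at this
  obtain ⟨hstable, hattr⟩ := hconv kp kd m (by linarith) ha hb
  refine ⟨hin.trans_lt ENNReal.ofReal_lt_top, fun hout => ?_, hstable, fun X hX hsg => ?_⟩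
  · calc _ ≤ ENNReal.ofReal (16 / m) * ENNReal.ofReal γ := by
          rw [hγ, ENNReal.ofReal_toReal hout.ne]
          gcongr
      _ = ENNReal.ofReal (16 / m * γ) := (ENNReal.ofReal_mul (by positivity)).symm
      _ < 1 := by
          rw [ENNReal.ofReal_lt_one, div_mul_eq_mul_div, div_lt_one hm0]
          linarith
  · obtain ⟨i1, i2, i3, i4⟩ := hsg.bounds hθ0 hm0 (by rw [hm]; exact UavUgv.le_gammaIn hkp hkd)
    exact hattr X hX i1 i2 i3 i4
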